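/- Let $\mathbf{k}$ be a field of characteristic $3$ and $N\ge 2$ an integer with $3\nmid N$. **The algebra.** $A_{z^N}$ is the strictly unital $\mathbb{Z}/2$-graded $A_\infty$-algebra on $\mathbf{k}1\oplus\mathbf{k}\partial$ ($|1|=0$, $|\partial|=1$) with $m_2(a,1)=a$, $m_2(1,a)=(-1)^{|a|}a$, $m_N(\partial,\dots,\partial)=1$ and all other operations on basis tensors zero. Write $\|a\|=|a|-1$. Its diagonal bimodule $A_\Delta$ has structure maps $\mu^{r|1|s}(x_1,\dots,x_r,a,y_1,\dots,y_s)=(-1)^{\sum_i\|y_i\|+1}m_{r+1+s}(x_1,\dots,x_r,a,y_1,\dots,y_s)$. **The complexes.** Let $X$ be the normalized three-fold Hochschild complex of $A_{z^N}$, i.e. the quotient of the Hochschild chain complex $CC_*(A_{z^N},A_\Delta\otimes_A A_\Delta\otimes_A A_\Delta)$ by all chains with a unit outside the three bimodule positions. It has the basis $x|\partial^{k_1}|y|\partial^{k_2}|z|\partial^{k_3}$ with $x,y,z\in\{1,\partial\}$ the bimodule entries, $k_i\ge 0$, and $\partial^{m}=\partial|\cdots|\partial$ ($m$ factors). The differential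 $b^3$ is the sum of all applications of the $m_j$ inside a block and of the $\mu^{r|1|s}$ to a bimodule entry and its cyclic neighbours, with sign given by the total degree to the right of the operation, plus (if entries are moved from the end to the front) the degree of the moved part times that of the rest; degrees are reduced except for bimodule entries. Let $\tau$ be the cyclic permutation $x|\partial^{k_1}|y|\partial^{k_2}|z|\partial^{k_3}\mapsto \pm\, z|\partial^{k_3}|x|\partial^{k_1}|y|\partial^{k_2}$ with Koszul sign. The equivariant complex is $X[[t,\theta]]$, $\theta^2=0$, with the $t$-linear differential $$d_{eq}(x)=b^3x+(-1)^{|x|}(\tau x-x)\theta,\qquad d_{eq}(x\theta)=(b^3x)\theta+(-1)^{|x|}(x+\tau x+\tau^2x)t .$$ Its homology $HH^{\mathbb{Z}/3}_*(A_{z^N})$ is a module over $\mathbf{k}[[t,\theta]]$; $\theta$ acts on chains $t$-linearly by $x\mapsto(-1)^{|x|}\tau x\,\theta$, $x\theta\mapsto(-1)^{|x|}(\tau x+2\tau^2x)t$. **The cap product.** Let $\varphi^1_1$ be the Hochschild cochain with $\partial\mapsto 1$ that vanishes on all other basis tensors, and $\Psi(\varphi^1_1)$ the endomorphism of $A_\Delta$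 given by $(x,a,y_1,\dots,y_s)\mapsto\sum_{i}\mu^{r|1|s}(x,a,y_1,\dots,y_{i-1},\varphi^1_1(y_i),y_{i+1},\dots,y_s)$. The equivariant cap product $\bigcap^{\mathbb{Z}/3}(\varphi^1_1,-)$ is induced by the action of $\Psi(\varphi^1_1)^{\otimes 3}$ on $X$ (one factor for each of the three bimodule entries), extended coefficientwise in $t$ and $\theta$. **The generators.** For $0\le k\le N-2$ put $${}_3\tilde R^k=\sum_{k_1+k_2+k_3=k}1|\partial^{k_1}|1|\partial^{k_2}|\partial|\partial^{k_3}\;-\;\frac1N\sum_{k_1+k_2+k_3=k+N-1}\partial|\partial^{k_1}|1|\partial^{k_2}|\partial|\partial^{k_3}\,\theta\;+\;\frac1{N^2}\sum_{k_1+k_2+k_3=k+2(N-1)}\partial|\partial^{k_1}|\partial|\partial^{k_2}|\partial|\partial^{k_3}\,t .$$ **Theorem.** $d_{eq}^2=0$; the cap product with $\varphi^1_1$ and the action of $\theta$ descend to $HH^{\mathbb{Z}/3}_*(A_{z^N})$, where $\theta^2=0$ and the cap product is $\mathbf{k}[[t,\theta]]$-linear. The ${}_3\tilde R^k$, $0\le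 k\le N-2$, are cycles, and their classes form a basis of the $\mathbf{k}[[t,\theta]]$-module $HH^{\mathbb{Z}/3}_*(A_{z^N})$ (that is, the classes ${}_3\tilde R^k$ and $\theta\cdot{}_3\tilde R^k$ form a basis over $\mathbf{k}[[t]]$). If $N\ge 4$, then on homology $$\textstyle\bigcap^{\mathbb{Z}/3}(\varphi^1_1,{}_3\tilde R^k)={}_3\tilde R^{k-3}\ (3\le k<N-1),$$ $$\textstyle\bigcap^{\mathbb{Z}/3}(\varphi^1_1,{}_3\tilde R^0)=-\frac tN\,{}_3\tilde R^{N-3},\quad \bigcap^{\mathbb{Z}/3}(\varphi^1_1,{}_3\tilde R^1)=\frac tN\,{}_3\tilde R^{N-2},\quad \bigcap^{\mathbb{Z}/3}(\varphi^1_1,{}_3\tilde R^2)=0 ,$$ and if $N=2$, then $\bigcap^{\mathbb{Z}/3}(\varphi^1_1,{}_3\tilde R^0)=0$. This agrees with the B-side: the cohomology of $(\Omega^*_{\mathbf{k}[[z]]}[[t]],\,t\,d-d(z^N)\wedge)$ is a free $\mathbf{k}[[t]]$-module with basis $[z^{N-2-k}dz]$, $0\le k\le N-2$; the function $z$ acts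 on it, by multiplication by $z^3$, with the same matrix in this basis as $\bigcap^{\mathbb{Z}/3}(\varphi^1_1,-)$ in the basis ${}_3\tilde R^k$; hence the $\mathbf{k}[[t]]$-linear map $[z^{N-2-k}dz]\mapsto{}_3\tilde R^k$ intertwines the two actions. -/

import Mathlib

namespace ZModThreeCap

section PowerSeriesModule

/-- `PS M` is the module `M[[t]]` of formal power series `∑ cₙ tⁿ` with coefficients in a module
`M`; it is a module over `k[[t]]` (here `PowerSeries k`) by convolution. -/
def PS (M : Type*) : Type _ := ℕ → M

instance (M : Type*) [AddCommGroup M] : AddCommGroup (PS M) :=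
  inferInstanceAs (AddCommGroup (ℕ → M))

variable {k M M' : Type*} [Field k] [AddCommGroup M] [Module k M] [AddCommGroup M'] [Module k M']

noncomputable instance : SMul (PowerSeries k) (PS M) :=
  ⟨fun f c n => ∑ q ∈ Finset.HasAntidiagonal.antidiagonal n, PowerSeries.coeff q.1 f • c q.2⟩

theorem PS.smul_apply (f : PowerSeries k) (c : PS M) (n : ℕ) :
    (f • c) n = ∑ q ∈ Finset.HasAntidiagonal.antidiagonal n, PowerSeries.coeff q.1 f • c q.2 := rfl

theorem PS.add_apply (c c' : PS M) (n : ℕ) : (c + c') n = c n + c' n := rfl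

theorem PS.zero_apply (n : ℕ) : (0 : PS M) n = 0 := rfl

noncomputable instance : Module (PowerSeries k) (PS M) where
  one_smul c := by
    funext n
    rw [PS.smul_apply, Finset.sum_eq_single (0, n)]
    · simp
    · rintro ⟨i, j⟩ hij hne
      have hi : i ≠ 0 := by
        rintro rfl
        apply hne
        simpa using hij
      simp [PowerSeries.coeff_one, hi]
    · intro h
      simp at h
  mul_smul f g c := by
    funext n
    simp only [PS.smul_apply, PowerSeries.coeff_mul, Finset.sum_smul, Finset.smul_sum, mul_smul]
    rw [Finset.sum_sigma', Finset.sum_sigma']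
    refine Finset.sum_nbij' (fun q => ⟨(q.2.1, q.2.2 + q.1.2), (q.2.2, q.1.2)⟩)
      (fun q => ⟨(q.1.1 + q.2.1, q.2.2), (q.1.1, q.2.1)⟩) ?_ ?_ ?_ ?_ ?_ <;>
    simp +contextual [Finset.HasAntidiagonal.mem_antidiagonal, Finset.mem_sigma] <;> intros <;> omega
  smul_zero f := by
    funext n
    simp [PS.smul_apply, PS.zero_apply]
  smul_add f c c' := by
    funext n
    simp [PS.smul_apply, PS.add_apply, Finset.sum_add_distrib]
  add_smul f g c := by
    funext n
    simp [PS.smul_apply, PS.add_apply, add_smul, Finset.sum_add_distrib]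
  zero_smul c := by
    funext n
    simp [PS.smul_apply, PS.zero_apply]

/-- The `t`-linear extension `∑ cₙ tⁿ ↦ ∑ f(cₙ) tⁿ` of a `k`-linear map. -/
noncomputable def PS.map (f : M →ₗ[k] M') : PS M →ₗ[PowerSeries k] PS M' where
  toFun c := fun n => f (c n)
  map_add' c c' := by
    funext n
    exact map_add f (c n) (c' n)
  map_smul' g c := by
    funext n
    simp only [PS.smul_apply, map_sum, map_smul, RingHom.id_apply]
    rfl

/-- The element `m tⁿ` of `M[[t]]`. -/
def PS.monomial (n : ℕ) (m : M) : PS M := fun i => if i = n then m else 0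

end PowerSeriesModule

section Homology

variable {R E : Type*} [CommRing R] [AddCommGroup E] [Module R E]

/-- The homology `ker d / im d` of a differential module. -/
abbrev Homology (d : E →ₗ[R] E) : Type _ :=
  (LinearMap.ker d) ⧸ (LinearMap.range d).submoduleOf (LinearMap.ker d)

/-- The homology class of a cycle. -/
def homologyClass (d : E →ₗ[R] E) (x : E) (hx : d x = 0) : Homology d :=
  Submodule.Quotient.mk ⟨x, hx⟩

/-- `f` maps cycles to cycles and boundaries to boundaries. -/
def Descends (d f : E →ₗ[R] E) : Prop :=
  (∀ x, d x = 0 → d (f x) = 0) ∧ ∀ x, f (d x) ∈ LinearMap.range d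

/-- The map induced on homology, `[x] ↦ [f x]`. -/
def homologyMap (d f : E →ₗ[R] E) (hf : Descends d f) : Homology d →ₗ[R] Homology d :=
  Submodule.mapQ _ _
    (f.restrict (p := LinearMap.ker d) (q := LinearMap.ker d) fun x hx => hf.1 x hx) (by
      rintro ⟨x, hx⟩ ⟨y, hy⟩
      simp only [Submodule.subtype_apply] at hy
      subst hy
      exact hf.2 y)

end Homology

section Algebra

/-- The basis `1, ∂` of the underlying vector space `k⟨1, ∂⟩` of the `A_∞`-algebra. -/
inductive Gen
  | one
  | del
  deriving DecidableEq

/-- The degree (mod 2): `|1| = 0`, `|∂| = 1`. -/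
def Gen.deg : Gen → ℕ
  | one => 0
  | del => 1

/-- The reduced degree `‖a‖ = |a| - 1` (mod 2). -/
def Gen.rdeg : Gen → ℕ
  | one => 1
  | del => 0

/-- The total reduced degree of a tensor `a₁ ⊗ ⋯ ⊗ aₙ` of basis elements. -/
def rdeg (l : List Gen) : ℕ := (l.map Gen.rdeg).sum

variable (k : Type*) [Field k]

/-- The operations `m_d`, `d ≥ 1`, of `A_{z^N}` on basis tensors: `1` is a strict unit
(`m₂(a, 1) = a`, `m₂(1, a) = (-1)^{|a|} a`, and all other operations vanish on tensors containing
`1`), `m_N(∂, …, ∂) = 1`, and `m_d(∂, …, ∂) = 0` for `d ≠ N`. -/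
noncomputable def mu (N : ℕ) (l : List Gen) : Gen →₀ k :=
  if l = List.replicate N Gen.del then Finsupp.single Gen.one 1
  else if l = [Gen.one, Gen.one] then Finsupp.single Gen.one 1
  else if l = [Gen.del, Gen.one] then Finsupp.single Gen.del 1
  else if l = [Gen.one, Gen.del] then Finsupp.single Gen.del (-1)
  else 0

/-- The structure maps `μ^{r|1|s}` of the diagonal bimodule:
`(x₁, …, x_r, a, y₁, …, y_s) ↦ (-1)^{‖y₁‖ + ⋯ + ‖y_s‖ + 1} m_{r+1+s}(x, a, y)`. -/
noncomputable def muDelta (N : ℕ) (xs : List Gen) (a : Gen) (ys : List Gen) : Gen →₀ k :=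
  (-1 : k) ^ (rdeg ys + 1) • mu k N (xs ++ a :: ys)

/-- Hochschild cochains of the algebra, given by their values on basis tensors. -/
abbrev Cochain : Type _ := List Gen → Gen →₀ k

/-- The cochain `φ^m_1`, which sends `∂ ⊗ ⋯ ⊗ ∂` (`m` factors) to `1` and all other basis tensors
to `0`. It is of even degree. -/
noncomputable def phiOne (m : ℕ) : Cochain k := fun l =>
  if l = List.replicate m Gen.del then Finsupp.single Gen.one 1 else 0

/-- The bimodule endomorphism `Ψ(φ)` of the diagonal bimodule defined by an even cochain `φ`:
`(x, a, y₁, …, y_s) ↦ ∑ μ^{r|1|*}(x, a, y₁, …, y_i, φ(y_{i+1}, …, y_{i+j}), y_{i+j+1}, …, y_s)`.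
(The Koszul sign `(-1)^{|φ| (‖y_{i+j+1}‖ + ⋯ + ‖y_s‖)}` is trivial for even `φ`.) -/
noncomputable def Psi (N : ℕ) (φ : Cochain k) (xs : List Gen) (a : Gen) (ys : List Gen) :
    Gen →₀ k :=
  ∑ i ∈ Finset.range (ys.length + 1), ∑ j ∈ Finset.range (ys.length - i + 1),
    (φ ((ys.drop i).take j)).sum fun g c =>
      c • muDelta k N xs a (ys.take i ++ g :: ys.drop (i + j))

end Algebra

section ThreeFold

/-- A basis tensor `x₁ | l₁ | x₂ | l₂ | x₃ | l₃` of the three-fold Hochschild complex, with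
distinguished (bimodule) entries `x₁, x₂, x₃`. For `L = List Gen` the blocks `l_i` are arbitrary
basis tensors. For `L = ℕ` the block `l_i = n` stands for `∂ | ⋯ | ∂` (`n` factors); these are the
basis tensors of the normalized complex, in which every chain with a unit `1` outside the
distinguished positions is set to zero. -/
structure Word (L : Type) where
  x₁ : Gen
  l₁ : L
  x₂ : Gen
  l₂ : L
  x₃ : Gen
  l₃ : L

/-- The degree (mod 2): reduced degrees are used except for the distinguished entries. -/
def Word.deg (w : Word (List Gen)) : ℕ :=
  w.x₁.deg + rdeg w.l₁ + w.x₂.deg + rdeg w.l₂ + w.x₃.deg + rdeg w.l₃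

variable (k : Type*) [Field k]

/-- The terms of the differential in which a bimodule structure map is applied to a distinguished
entry, some (possibly no) entries at the end of the preceding block, and some entries at the
beginning of the following block; blocks are cyclically ordered. Sign: the sum of the degrees to
the right of the structure map; if entries are moved from the end of the tensor to its front, also
the degree of the moved part times the degree of the rest. -/
noncomputable def outerDiff (N : ℕ) (w : Word (List Gen)) : Word (List Gen) →₀ k :=
  (∑ i ∈ Finset.range (w.l₃.length + 1), ∑ j ∈ Finset.range (w.l₁.length + 1),
    (-1 : k) ^ (rdeg (w.l₃.drop i) *
          (w.x₁.deg + rdeg w.l₁ + w.x₂.deg + rdeg w.l₂ + w.x₃.deg + rdeg (w.l₃.take i)) +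
        (rdeg (w.l₁.drop j) + w.x₂.deg + rdeg w.l₂ + w.x₃.deg + rdeg (w.l₃.take i))) •
      (muDelta k N (w.l₃.drop i) w.x₁ (w.l₁.take j)).mapDomain
        fun g => ⟨g, w.l₁.drop j, w.x₂, w.l₂, w.x₃, w.l₃.take i⟩) +
  (∑ i ∈ Finset.range (w.l₁.length + 1), ∑ j ∈ Finset.range (w.l₂.length + 1),
    (-1 : k) ^ (rdeg (w.l₂.drop j) + w.x₃.deg + rdeg w.l₃) •
      (muDelta k N (w.l₁.drop i) w.x₂ (w.l₂.take j)).mapDomain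
        fun g => ⟨w.x₁, w.l₁.take i, g, w.l₂.drop j, w.x₃, w.l₃⟩) +
  (∑ i ∈ Finset.range (w.l₂.length + 1), ∑ j ∈ Finset.range (w.l₃.length + 1),
    (-1 : k) ^ rdeg (w.l₃.drop j) •
      (muDelta k N (w.l₂.drop i) w.x₃ (w.l₃.take j)).mapDomain
        fun g => ⟨w.x₁, w.l₁, w.x₂, w.l₂.take i, g, w.l₃.drop j⟩)

/-- The terms in which an operation `m_j`, `j ≥ 1`, is applied to consecutive entries
`a_{i+1}, …, a_{i+j}` of one block `l`, for a block followed by entries of total degree `tail`;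
`put` puts the new block back in place. -/
noncomputable def blockDiff (N : ℕ) (l : List Gen) (tail : ℕ)
    (put : List Gen → Word (List Gen)) : Word (List Gen) →₀ k :=
  ∑ i ∈ Finset.range (l.length + 1), ∑ j ∈ Finset.Icc 1 (l.length - i),
    (-1 : k) ^ (rdeg (l.drop (i + j)) + tail) •
      (mu k N ((l.drop i).take j)).mapDomain fun g => put (l.take i ++ g :: l.drop (i + j))

/-- The differential of the three-fold Hochschild complex, that is, of the Hochschild chain complex
with coefficients in `A_Δ ⊗_A A_Δ ⊗_A A_Δ`, on basis tensors. -/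
noncomputable def diff (N : ℕ) (w : Word (List Gen)) : Word (List Gen) →₀ k :=
  outerDiff k N w +
  blockDiff k N w.l₁ (w.x₂.deg + rdeg w.l₂ + w.x₃.deg + rdeg w.l₃) (fun l => { w with l₁ := l }) +
  blockDiff k N w.l₂ (w.x₃.deg + rdeg w.l₃) (fun l => { w with l₂ := l }) +
  blockDiff k N w.l₃ 0 (fun l => { w with l₃ := l })

/-- The generator `τ` of `ℤ/3`: cyclic permutation of the three blocks `x_i | l_i`, with Koszul
sign. -/
noncomputable def rot (w : Word (List Gen)) : Word (List Gen) →₀ k :=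
  Finsupp.single ⟨w.x₃, w.l₃, w.x₁, w.l₁, w.x₂, w.l₂⟩
    ((-1) ^ ((w.x₃.deg + rdeg w.l₃) * (w.x₁.deg + rdeg w.l₁ + w.x₂.deg + rdeg w.l₂)))

/-- The grading operator `x ↦ (-1)^{|x|} x`. -/
noncomputable def sgn (w : Word (List Gen)) : Word (List Gen) →₀ k :=
  Finsupp.single w ((-1) ^ w.deg)

/-- The action of `F ⊗ F ⊗ F` on the three-fold Hochschild complex, for an even pre-endomorphism
`F^{r|1|s}` of the diagonal bimodule: one sums over all ways to cut the blocks as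
`l₁ = s₁ m₁ p₂`, `l₂ = s₂ m₂ p₃`, `l₃ = s₃ m₃ p₁`, and takes
`F(p₁, x₁, s₁) | m₁ | F(p₂, x₂, s₂) | m₂ | F(p₃, x₃, s₃) | m₃`; the sign comes from moving `p₁` to
the front. The cut of `l_i` has `s_i` of length `a i` and `m_i` of length `b i`. -/
noncomputable def cube
    (F : List Gen → Gen → List Gen → Gen →₀ k) (w : Word (List Gen)) : Word (List Gen) →₀ k :=
  ∑ a₁ ∈ Finset.range (w.l₁.length + 1), ∑ b₁ ∈ Finset.range (w.l₁.length - a₁ + 1),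
  ∑ a₂ ∈ Finset.range (w.l₂.length + 1), ∑ b₂ ∈ Finset.range (w.l₂.length - a₂ + 1),
  ∑ a₃ ∈ Finset.range (w.l₃.length + 1), ∑ b₃ ∈ Finset.range (w.l₃.length - a₃ + 1),
    (-1 : k) ^ (rdeg (w.l₃.drop (a₃ + b₃)) *
        (w.x₁.deg + rdeg w.l₁ + w.x₂.deg + rdeg w.l₂ + w.x₃.deg +
          rdeg (w.l₃.take (a₃ + b₃)))) •
      (F (w.l₃.drop (a₃ + b₃)) w.x₁ (w.l₁.take a₁)).sum fun g₁ c₁ =>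
      (F (w.l₁.drop (a₁ + b₁)) w.x₂ (w.l₂.take a₂)).sum fun g₂ c₂ =>
      (F (w.l₂.drop (a₂ + b₂)) w.x₃ (w.l₃.take a₃)).sum fun g₃ c₃ =>
        Finsupp.single
          ⟨g₁, (w.l₁.drop a₁).take b₁, g₂, (w.l₂.drop a₂).take b₂, g₃, (w.l₃.drop a₃).take b₃⟩
          (c₁ * c₂ * c₃)

/-- The normalized three-fold Hochschild complex of `A_{z^N}`, the quotient of the three-fold
Hochschild complex by all chains with a unit `1` outside the distinguished positions. -/
abbrev Chain : Type _ := Word ℕ →₀ k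

/-- The basis tensor with blocks `∂ | ⋯ | ∂` of the given lengths. -/
def Word.lift (w : Word ℕ) : Word (List Gen) :=
  ⟨w.x₁, List.replicate w.l₁ Gen.del, w.x₂, List.replicate w.l₂ Gen.del,
    w.x₃, List.replicate w.l₃ Gen.del⟩

/-- The class of a basis tensor in the normalized complex: zero if a block contains a unit. -/
noncomputable def Word.proj (w : Word (List Gen)) : Chain k :=
  if Gen.one ∈ w.l₁ ∨ Gen.one ∈ w.l₂ ∨ Gen.one ∈ w.l₃ then 0
  else Finsupp.single ⟨w.x₁, w.l₁.length, w.x₂, w.l₂.length, w.x₃, w.l₃.length⟩ 1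

/-- The linear operator on the normalized complex induced by an operator on the three-fold
Hochschild complex. -/
noncomputable def onNormalized (f : Word (List Gen) → Word (List Gen) →₀ k) : Module.End k (Chain k) :=
  Finsupp.linearCombination k fun w =>
    (Finsupp.linearCombination k (Word.proj k)) (f w.lift)

end ThreeFold

section Equivariant

variable (k : Type*) [Field k]

/-- The negative `ℤ/3`-equivariant complex `X[[t, θ]] = X[[t]] ⊕ X[[t]] θ` (`θ² = 0`) of the
normalized three-fold Hochschild complex `X`. The pair `(c₀, c₁)` is `c₀ + c₁ θ`. -/
abbrev EqChain : Type _ := PS (Chain k) × PS (Chain k)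

/-- The equivariant differential: `t`-linear, with `x ↦ d x + (-1)^{|x|} (τ x - x) θ` and
`x θ ↦ d x θ + (-1)^{|x|} (x + τ x + τ² x) t`. -/
noncomputable def eqDiff (N : ℕ) : EqChain k →ₗ[PowerSeries k] EqChain k :=
  let d := onNormalized k (diff k N)
  let τ := onNormalized k (rot k)
  let s := onNormalized k (sgn k)
  LinearMap.prod
    (PS.map d ∘ₗ LinearMap.fst _ _ _ +
      (PowerSeries.X : PowerSeries k) • (PS.map ((1 + τ + τ ^ 2) * s) ∘ₗ LinearMap.snd _ _ _))
    (PS.map ((τ - 1) * s) ∘ₗ LinearMap.fst _ _ _ + PS.map d ∘ₗ LinearMap.snd _ _ _)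

/-- The action of `θ`, through the product of `ℤ/3`-homotopy fixed points: `t`-linear, with
`x ↦ (-1)^{|x|} τ x θ` and `x θ ↦ (-1)^{|x|} ∑_{0 ≤ i < j ≤ 2} τ^j x t`. -/
noncomputable def thetaAct : EqChain k →ₗ[PowerSeries k] EqChain k :=
  let τ := onNormalized k (rot k)
  let s := onNormalized k (sgn k)
  LinearMap.prod
    ((PowerSeries.X : PowerSeries k) • (PS.map ((τ + 2 * τ ^ 2) * s) ∘ₗ LinearMap.snd _ _ _))
    (PS.map (τ * s) ∘ₗ LinearMap.fst _ _ _)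

/-- The `ℤ/3`-equivariant cap product with an even cochain `φ` on the chain level: the action of
`Ψ(φ) ⊗ Ψ(φ) ⊗ Ψ(φ)`, extended `t`- and `θ`-linearly. -/
noncomputable def eqCap (N : ℕ) (φ : Cochain k) : EqChain k →ₗ[PowerSeries k] EqChain k :=
  LinearMap.prodMap (PS.map (onNormalized k (cube k (Psi k N φ))))
    (PS.map (onNormalized k (cube k (Psi k N φ))))

/-- `HH^{ℤ/3}_*(A_{z^N})`, as a module over `k[[t]]`. -/
abbrev HHEq (N : ℕ) : Type _ := Homology (eqDiff k N)

/-- `∑_{k₁ + k₂ + k₃ = n} x | ∂^{k₁} | y | ∂^{k₂} | z | ∂^{k₃}`. -/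
noncomputable def blockSum (x y z : Gen) (n : ℕ) : Chain k :=
  ∑ κ ∈ Finset.Nat.antidiagonalTuple 3 n, Finsupp.single ⟨x, κ 0, y, κ 1, z, κ 2⟩ 1

/-- The chain `₃R̃^j_∂`:
`∑_{k₁+k₂+k₃=j} 1|∂^{k₁}|1|∂^{k₂}|∂|∂^{k₃} - N⁻¹ ∑_{k₁+k₂+k₃=j+N-1} ∂|∂^{k₁}|1|∂^{k₂}|∂|∂^{k₃} θ
  + N⁻² ∑_{k₁+k₂+k₃=j+2(N-1)} ∂|∂^{k₁}|∂|∂^{k₂}|∂|∂^{k₃} t`.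
With the sign conventions above for the differential, the minus sign in front of the `θ`-term is
the one for which this lift of the first sum is a cycle. -/
noncomputable def Rtilde (N j : ℕ) : EqChain k :=
  (PS.monomial 0 (blockSum k .one .one .del j) +
      PS.monomial 1 (((N : k) ^ 2)⁻¹ • blockSum k .del .del .del (j + 2 * (N - 1))),
    PS.monomial 0 (-(N : k)⁻¹ • blockSum k .del .one .del (j + (N - 1))))

/-- The `(N-1) × (N-1)` matrix over `k[[t]]` whose only nonzero entries are `1` at `(j-3, j)` for
`3 ≤ j < N-1`, `-t/N` at `(N-3, 0)` and `t/N` at `(N-2, 1)`; rows and columns are numbered from `0`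
to `N-2`. -/
noncomputable def capMatrix (N : ℕ) : Matrix (Fin (N - 1)) (Fin (N - 1)) (PowerSeries k) :=
  Matrix.of fun i j =>
    if (i : ℕ) + 3 = j then 1
    else if (j : ℕ) = 0 ∧ (i : ℕ) + 3 = N then -(PowerSeries.C (N : k)⁻¹ * PowerSeries.X)
    else if (j : ℕ) = 1 ∧ (i : ℕ) + 2 = N then PowerSeries.C (N : k)⁻¹ * PowerSeries.X
    else 0

end Equivariant

section BSide

variable (k : Type*) [Field k]

/-- `Ω^*_A[[t]] = A[[t]] ⊕ A[[t]] dz` for `A = k[[z]]`. The pair `(g, h)` is `g + h dz`. -/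
abbrev Forms : Type _ := PS (PowerSeries k) × PS (PowerSeries k)

/-- The differential `t d - df ∧` for `f = z^N`: `g + h dz ↦ (t g' - f' g) dz`. -/
noncomputable def formsDiff (N : ℕ) : Forms k →ₗ[PowerSeries k] Forms k :=
  let f : PowerSeries k := PowerSeries.X ^ N
  let dz : PowerSeries k →ₗ[k] PowerSeries k := (PowerSeries.derivative k).toLinearMap
  LinearMap.prod 0
    (((PowerSeries.X : PowerSeries k) • PS.map dz - PS.map (LinearMap.mulLeft k (dz f))) ∘ₗ
      LinearMap.fst _ _ _)

/-- The action of the function `a ∈ A` on forms: multiplication by `a³`. -/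
noncomputable def formsMul (a : PowerSeries k) : Forms k →ₗ[PowerSeries k] Forms k :=
  LinearMap.prodMap (PS.map (LinearMap.mulLeft k (a ^ 3))) (PS.map (LinearMap.mulLeft k (a ^ 3)))

/-- The form `z^m dz`. -/
noncomputable def zdz (m : ℕ) : Forms k := (0, PS.monomial 0 (PowerSeries.X ^ m))

end BSide

section Classes

variable (k : Type*) [Field k] (N : ℕ)

/-- The operator on `HH^{ℤ/3}_*(A_{z^N})` given by the equivariant cap product with `φ^1_1`. -/
noncomputable def capHH (h : Descends (eqDiff k N) (eqCap k N (phiOne k 1))) :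
    HHEq k N →ₗ[PowerSeries k] HHEq k N :=
  homologyMap _ _ h

/-- The action of `θ` on `HH^{ℤ/3}_*(A_{z^N})`. -/
noncomputable def thetaHH (h : Descends (eqDiff k N) (thetaAct k)) :
    HHEq k N →ₗ[PowerSeries k] HHEq k N :=
  homologyMap _ _ h

/-- The class of `₃R̃^j_∂` in `HH^{ℤ/3}_*(A_{z^N})`. -/
noncomputable def RClass (h : ∀ j : Fin (N - 1), eqDiff k N (Rtilde k N j) = 0)
    (j : Fin (N - 1)) : HHEq k N :=
  homologyClass _ _ (h j)

/-- The cohomology of `(Ω^*_A[[t]], t d - d(z^N) ∧)`, `A = k[[z]]`, as a module over `k[[t]]`. -/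
abbrev HForms : Type _ := Homology (formsDiff k N)

/-- The operator on cohomology given by the action of the function `z`. -/
noncomputable def mulHForms (h : Descends (formsDiff k N) (formsMul k PowerSeries.X)) :
    HForms k N →ₗ[PowerSeries k] HForms k N :=
  homologyMap _ _ h

/-- The class `[z^{N-2-j} dz]`. -/
noncomputable def zClass
    (h : ∀ j : Fin (N - 1), formsDiff k N (zdz k (N - 2 - j)) = 0)
    (j : Fin (N - 1)) : HForms k N :=
  homologyClass _ _ (h j)

end Classes

end ZModThreeCap

open ZModThreeCap

/-! A chain of X amounts to finitely supported coefficient functions of the three block lengths, one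
function for each choice of the distinguished entries. Let S_i evaluate such a function with the
i-th block longer by one; these shifts commute. In the normalized complex the operations inside
blocks disappear, and b^3 becomes a cyclic Koszul-type matrix factorization (`dX_apply`): at an
entry between blocks with shifts S (before) and S' (after), the part 1 → ∂ is S' - S and the part ∂
→ 1 is -∑ S^i S'^(N-1-i), up to the signs of the other entries. Its square at one entry is S^N -
S'^N, and the three squares cancel cyclically. The operator Ψ(φ^1_1)^{⊗3} is S₁S₂S₃ (`capX_apply`),
the counterpart of multiplication by z³.

Homology of X: S₁ - S₃ is surjective on finitely supported functions, and S₂ - S₁ is surjective on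
its kernel. Hence a cycle can be moved into 1|1|1 and 1|1|∂ with coefficients depending only on the
total length (`exists_isSymmetric`). There all S_i become a single shift S, and the remaining
differential is -N S^(N-1). Since N is invertible in the field, the N-1 sums of type 1|1|∂ of total
length at most N-2 form a basis of the homology.

Equivariant homology: the rotation fixes these classes up to the sign operator, so modulo t the
homology is spanned freely by the generators and their products with θ. Completeness and
torsion-freeness in t lift this to a basis over k[[t]] (`exists_homology_basis`,
`exists_fixDiff_homology_basis`). Characteristic 3 is what makes θ anticommute with the differential
and square to a null-homotopic operator.

Cap product: for k ≥ 3 the formula holds on chains. For k = 2 - m the leading term dies; explicit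
polynomial primitives (`dX_primitive_one`, `dX_primitive_zero`) identify the rest with (m/N) t
R_{N-1-m} up to a boundary and an error tξ. The error ξ is a cycle because t is torsion-free; it is
homogeneous, begins with θ, and its coefficients lie in grades of X without homology, so it is a
boundary by successive approximation (`mem_range_fixDiff`). On the B-side the same factor m/N comes
from applying t d - d(z^N)∧ to z^m. -/

namespace ZModThreeCap

/-! ### Structure maps on tensors of ∂'s. -/

section Coordinates

variable {k : Type*} [Field k]

@[simp] theorem rdeg_replicate_del (n : ℕ) : rdeg (List.replicate n Gen.del) = 0 := by
  simp [rdeg, Gen.rdeg]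

theorem mu_replicate (N j : ℕ) :
    mu k N (List.replicate j Gen.del) = if j = N then Finsupp.single Gen.one 1 else 0 := by
  have h1 : List.replicate j Gen.del ≠ [Gen.one, Gen.one] := fun h => by
    have : Gen.one ∈ List.replicate j Gen.del := by simp [h]
    simp [List.mem_replicate] at this
  have h2 : List.replicate j Gen.del ≠ [Gen.del, Gen.one] := fun h => by
    have : Gen.one ∈ List.replicate j Gen.del := by simp [h]
    simp [List.mem_replicate] at this
  have h3 : List.replicate j Gen.del ≠ [Gen.one, Gen.del] := fun h => by
    have : Gen.one ∈ List.replicate j Gen.del := by simp [h]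
    simp [List.mem_replicate] at this
  simp [mu, h1, h2, h3]

theorem muDelta_del (N r s : ℕ) :
    muDelta k N (List.replicate r Gen.del) Gen.del (List.replicate s Gen.del) =
      if r + s + 1 = N then -Finsupp.single Gen.one 1 else 0 := by
  have : List.replicate r Gen.del ++ Gen.del :: List.replicate s Gen.del =
      List.replicate (r + s + 1) Gen.del := by
    rw [← List.replicate_succ, List.replicate_append_replicate]; rfl
  rw [muDelta, this, mu_replicate]
  split_ifs <;> simp

theorem muDelta_one (N r s : ℕ) :
    muDelta k N (List.replicate r Gen.del) Gen.one (List.replicate s Gen.del) =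
      if r = 0 ∧ s = 1 then Finsupp.single Gen.del 1
      else if r = 1 ∧ s = 0 then -Finsupp.single Gen.del 1 else 0 := by
  have h0 : List.replicate r Gen.del ++ Gen.one :: List.replicate s Gen.del ≠
      List.replicate N Gen.del := fun h => by
    have : Gen.one ∈ List.replicate N Gen.del := by simp [← h]
    simp [List.mem_replicate] at this
  rw [muDelta, mu, if_neg h0]
  rcases r with - | - | r <;> rcases s with - | - | s <;> simp [List.replicate_succ, rdeg, Gen.rdeg]

end Coordinates


/-! ### Differential, rotation and grading operator in coordinates. -/

section Coordinates

variable {k : Type*} [Field k]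

/-- The coefficients of the structure map of the diagonal bimodule, applied to one distinguished
entry, in terms of the coefficients `f g p q` of a chain, where `g` is the distinguished entry and
`p`, `q` are the lengths of the preceding and the following block. -/
def localDiff (N : ℕ) (f : Gen → ℕ → ℕ → k) : Gen → ℕ → ℕ → k
  | .del, p, q => f .one p (q + 1) - f .one (p + 1) q
  | .one, p, q => -∑ i ∈ Finset.range N, f .del (p + i) (q + (N - 1 - i))

/-- One computation serves all three distinguished positions: `W` places the entry and its two
neighbouring blocks into a word, and `P` says that the remaining data, which the operation does not
touch, agree with those of `v`. -/
theorem sum_muDelta_apply (N : ℕ) (W : Gen → ℕ → ℕ → Word ℕ) (v : Word ℕ) (P : Prop) [Decidable P]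
    (g' : Gen) (p' q' : ℕ) (hv : ∀ g p q, W g p q = v ↔ P ∧ g = g' ∧ p = p' ∧ q = q')
    (g : Gen) (p q : ℕ) :
    (∑ i ∈ Finset.range (p + 1), ∑ j ∈ Finset.range (q + 1),
      (muDelta k N (List.replicate (p - i) Gen.del) g (List.replicate j Gen.del)).mapDomain
        fun h => W h i (q - j)) v =
      localDiff N (fun h p'' q'' => if P ∧ g = h ∧ p = p'' ∧ q = q'' then (1 : k) else 0) g' p' q' := by
  classical
  simp only [Finsupp.finsetSum_apply]
  by_cases hP : P
  swap
  · have h0 : ∀ g p q, W g p q ≠ v := fun g p q h => hP ((hv g p q).1 h).1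
    rw [Finset.sum_eq_zero]
    · cases g' <;> simp [localDiff, hP]
    · intro i _
      refine Finset.sum_eq_zero fun j _ => ?_
      refine Finsupp.mapDomain_of_notMem_range _ _ ?_
      rintro ⟨h, hh⟩
      exact h0 _ _ _ hh
  simp only [hP, true_and] at hv ⊢
  cases g
  -- A unit absorbs exactly one ∂, either from the following block (i = p, j = 1) or from the
  -- preceding one (i = p - 1, j = 0).
  · have key : ∀ i ∈ Finset.range (p + 1), ∀ j ∈ Finset.range (q + 1),
        ((muDelta k N (List.replicate (p - i) Gen.del) .one (List.replicate j Gen.del)).mapDomain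
        fun h => W h i (q - j)) v =
        (if i = p ∧ j = 1 ∧ g' = .del ∧ p' = p ∧ q = q' + 1 then 1 else 0) -
        (if i = p' ∧ j = 0 ∧ g' = .del ∧ p = p' + 1 ∧ q = q' then 1 else 0) := by
      intro i hi j hj
      rw [Finset.mem_range] at hi hj
      rw [muDelta_one]
      split_ifs <;> simp only [Finsupp.mapDomain_single, Finsupp.mapDomain_zero, Finsupp.single_apply,
        ← Finsupp.single_neg, Finsupp.zero_apply, hv] <;> (try split_ifs) <;> first | rfl | simp
      all_goals grind
    rw [Finset.sum_congr rfl fun i hi => Finset.sum_congr rfl (key i hi)]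
    cases g'
    · simp [localDiff]
    · simp only [true_and, Finset.sum_sub_distrib, localDiff]
      congr 1
      · rw [Finset.sum_eq_single p, Finset.sum_eq_single 1]
        · simp [eq_comm]
        · intros; simp [*]
        · intro h; simp at h; simp [h]
        · intros; simp [*]
        · simp
      · rw [Finset.sum_eq_single p', Finset.sum_eq_single 0]
        · simp
        · intros; simp [*]
        · simp
        · intros; simp [*]
        · intro h; simp at h; rw [Finset.sum_eq_zero]; intros; rw [if_neg]; omega
  -- The operation m_N swallows p - p' entries on the left and q - q' on the right, N - 1 in all, so
  -- a given target word receives at most one term. In `localDiff` this is the summand with index p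
  -- - p'.
  · have key : ∀ i ∈ Finset.range (p + 1), ∀ j ∈ Finset.range (q + 1),
        ((muDelta k N (List.replicate (p - i) Gen.del) .del (List.replicate j Gen.del)).mapDomain
        fun h => W h i (q - j)) v =
        if i = p' ∧ j = q - q' ∧ g' = .one ∧ p' ≤ p ∧ q' ≤ q ∧ (p - p') + (q - q') + 1 = N
          then -1 else 0 := by
      intro i hi j hj
      rw [Finset.mem_range] at hi hj
      rw [muDelta_del]
      split_ifs <;> simp only [Finsupp.mapDomain_single, Finsupp.mapDomain_zero, Finsupp.single_apply,
        ← Finsupp.single_neg, Finsupp.zero_apply, hv] <;> (try split_ifs) <;> first | rfl | simp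
      all_goals grind
    rw [Finset.sum_congr rfl fun i hi => Finset.sum_congr rfl (key i hi)]
    cases g'
    · simp only [true_and, localDiff]
      by_cases h : p' ≤ p ∧ q' ≤ q ∧ (p - p') + (q - q') + 1 = N
      · rw [Finset.sum_eq_single p', Finset.sum_eq_single (q - q'), Finset.sum_eq_single (p - p')]
        · rw [if_pos ⟨rfl, rfl, h⟩, if_pos (by omega)]
        · intro i _ hi; rw [if_neg]; omega
        · intro hi; simp at hi; omega
        · intro i _ hi; rw [if_neg]; omega
        · intro hi; simp at hi
        · intro i _ hi; refine Finset.sum_eq_zero fun j _ => ?_; rw [if_neg]; omega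
        · intro hi; simp at hi; omega
      · rw [Finset.sum_eq_zero, Finset.sum_eq_zero, neg_zero]
        · intro i hi; rw [if_neg]; rw [Finset.mem_range] at hi; omega
        · intro i hi; refine Finset.sum_eq_zero fun j _ => ?_; rw [if_neg]; omega
    · simp [localDiff]

theorem mu_mapDomain_proj (N j : ℕ) (put : List Gen → Word (List Gen)) (p q : List Gen)
    (hput : ∀ l, Gen.one ∈ l → (put l).proj k = 0) :
    Finsupp.linearCombination k (Word.proj k)
      ((mu k N (List.replicate j Gen.del)).mapDomain fun g => put (p ++ g :: q)) = 0 := by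
  rw [mu_replicate]
  split_ifs <;> simp [Finsupp.mapDomain_single, hput]

/-- On a block of ∂'s the only nonzero operation is m_N(∂, …, ∂) = 1, and it leaves a unit inside
the block, which is zero in the normalized complex. -/
theorem proj_blockDiff (N n t : ℕ) (put : List Gen → Word (List Gen))
    (hput : ∀ l, Gen.one ∈ l → (put l).proj k = 0) :
    Finsupp.linearCombination k (Word.proj k) (blockDiff k N (List.replicate n Gen.del) t put) = 0 := by
  simp only [blockDiff, map_sum, map_smul, List.drop_replicate, List.take_replicate]
  refine Finset.sum_eq_zero fun i _ => Finset.sum_eq_zero fun j _ => ?_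
  rw [mu_mapDomain_proj _ _ _ _ _ hput, smul_zero]

theorem proj_lift (w : Word ℕ) : w.lift.proj k = Finsupp.single w 1 := by
  simp [Word.proj, Word.lift, List.mem_replicate]

/-- The sign `(-1)^{|g|}`. -/
def Gen.sign (k : Type*) [Field k] (g : Gen) : k := (-1) ^ g.deg

theorem sign_eq (g : Gen) : (-1 : k) ^ g.deg = g.sign k := rfl

theorem proj_mapDomain_lift (W : Gen → Word ℕ) (f : Gen →₀ k) :
    Finsupp.linearCombination k (Word.proj k) (f.mapDomain fun g => (W g).lift) =
      f.mapDomain W := by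
  rw [Finsupp.linearCombination_mapDomain]
  simp only [Finsupp.linearCombination_apply, Finsupp.mapDomain, Function.comp_def, proj_lift]
  simp

theorem proj_mapDomain₁ (a : ℕ) (y : Gen) (b : ℕ) (z : Gen) (e : ℕ) (f : Gen →₀ k) :
    Finsupp.linearCombination k (Word.proj k) (f.mapDomain fun g =>
      ⟨g, List.replicate a .del, y, List.replicate b .del, z, List.replicate e .del⟩) =
      f.mapDomain fun g => (⟨g, a, y, b, z, e⟩ : Word ℕ) :=
  proj_mapDomain_lift (fun g => ⟨g, a, y, b, z, e⟩) f

theorem proj_mapDomain₂ (x : Gen) (a : ℕ) (b : ℕ) (z : Gen) (e : ℕ) (f : Gen →₀ k) :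
    Finsupp.linearCombination k (Word.proj k) (f.mapDomain fun g =>
      ⟨x, List.replicate a .del, g, List.replicate b .del, z, List.replicate e .del⟩) =
      f.mapDomain fun g => (⟨x, a, g, b, z, e⟩ : Word ℕ) :=
  proj_mapDomain_lift (fun g => ⟨x, a, g, b, z, e⟩) f

theorem proj_mapDomain₃ (x : Gen) (a : ℕ) (y : Gen) (b : ℕ) (e : ℕ) (f : Gen →₀ k) :
    Finsupp.linearCombination k (Word.proj k) (f.mapDomain fun g =>
      ⟨x, List.replicate a .del, y, List.replicate b .del, g, List.replicate e .del⟩) =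
      f.mapDomain fun g => (⟨x, a, y, b, g, e⟩ : Word ℕ) :=
  proj_mapDomain_lift (fun g => ⟨x, a, y, b, g, e⟩) f

/-- The differential of the normalized complex. -/
noncomputable abbrev dX (k : Type*) [Field k] (N : ℕ) : Module.End k (Chain k) :=
  onNormalized k (diff k N)

theorem onNormalized_single (f : Word (List Gen) → Word (List Gen) →₀ k) (w : Word ℕ) (r : k) :
    onNormalized k f (Finsupp.single w r) =
      r • Finsupp.linearCombination k (Word.proj k) (f w.lift) := by
  simp [onNormalized]

theorem proj_diff (N : ℕ) (w : Word ℕ) :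
    Finsupp.linearCombination k (Word.proj k) (diff k N w.lift) =
      (w.x₂.sign k * w.x₃.sign k) • (∑ i ∈ Finset.range (w.l₃ + 1), ∑ j ∈ Finset.range (w.l₁ + 1),
        (muDelta k N (List.replicate (w.l₃ - i) .del) w.x₁ (List.replicate j .del)).mapDomain
        fun h => (⟨h, w.l₁ - j, w.x₂, w.l₂, w.x₃, i⟩ : Word ℕ)) +
      w.x₃.sign k • (∑ i ∈ Finset.range (w.l₁ + 1), ∑ j ∈ Finset.range (w.l₂ + 1),
        (muDelta k N (List.replicate (w.l₁ - i) .del) w.x₂ (List.replicate j .del)).mapDomain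
        fun h => (⟨w.x₁, i, h, w.l₂ - j, w.x₃, w.l₃⟩ : Word ℕ)) +
      ∑ i ∈ Finset.range (w.l₂ + 1), ∑ j ∈ Finset.range (w.l₃ + 1),
        (muDelta k N (List.replicate (w.l₂ - i) .del) w.x₃ (List.replicate j .del)).mapDomain
        fun h => (⟨w.x₁, w.l₁, w.x₂, i, h, w.l₃ - j⟩ : Word ℕ) := by
  have e : ∀ (p q : ℕ) (h : p ∈ Finset.range (q + 1)), min p q = p := fun p q h => by
    rw [Finset.mem_range] at h; omega
  rw [diff, map_add, map_add, map_add]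
  simp only [Word.lift]
  rw [proj_blockDiff _ _ _ _ fun l hl => by simp [Word.proj, hl],
    proj_blockDiff _ _ _ _ fun l hl => by simp [Word.proj, hl],
    proj_blockDiff _ _ _ _ fun l hl => by simp [Word.proj, hl], add_zero, add_zero, add_zero,
    outerDiff, map_add, map_add]
  simp only [map_sum, map_smul, Finset.smul_sum, List.length_replicate, List.drop_replicate,
    List.take_replicate, rdeg_replicate_del, zero_mul, zero_add, add_zero, pow_zero, one_smul,
    pow_add, sign_eq, proj_mapDomain₁, proj_mapDomain₂, proj_mapDomain₃]
  refine congrArg₂ _ (congrArg₂ _ ?_ ?_) ?_ <;>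
    exact Finset.sum_congr rfl fun i hi => Finset.sum_congr rfl fun j hj => by
      rw [e _ _ hi, e _ _ hj]

theorem localDiff_add (N : ℕ) (f f' : Gen → ℕ → ℕ → k) (g : Gen) (p q : ℕ) :
    localDiff N (fun h i j => f h i j + f' h i j) g p q =
      localDiff N f g p q + localDiff N f' g p q := by
  cases g <;> simp only [localDiff, Finset.sum_add_distrib] <;> ring

theorem localDiff_mul (N : ℕ) (r : k) (f : Gen → ℕ → ℕ → k) (g : Gen) (p q : ℕ) :
    localDiff N (fun h i j => r * f h i j) g p q = r * localDiff N f g p q := by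
  cases g <;> simp only [localDiff, ← Finset.mul_sum] <;> ring

/-- Lets signs computed from the entries of the source word be replaced by signs of the target word,
since the operation leaves these entries unchanged. -/
theorem mul_localDiff_congr (N : ℕ) (r r' : k) (P : Prop) [Decidable P] (h : P → r = r')
    (Q : Gen → ℕ → ℕ → Prop) [∀ g p q, Decidable (Q g p q)] (g : Gen) (p q : ℕ) :
    r * localDiff N (fun g p q => if P ∧ Q g p q then (1 : k) else 0) g p q =
      r' * localDiff N (fun g p q => if P ∧ Q g p q then (1 : k) else 0) g p q := by
  by_cases hP : P
  · rw [h hP]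
  · cases g <;> simp [localDiff, hP]

/-- The differential of the normalized complex in coordinates. -/
theorem dX_apply (N : ℕ) (c : Chain k) (x : Gen) (a : ℕ) (y : Gen) (b : ℕ) (z : Gen) (e : ℕ) :
    dX k N c ⟨x, a, y, b, z, e⟩ =
      y.sign k * z.sign k * localDiff N (fun g p q => c ⟨g, q, y, b, z, p⟩) x e a +
      z.sign k * localDiff N (fun g p q => c ⟨x, p, g, q, z, e⟩) y a b +
      localDiff N (fun g p q => c ⟨x, a, y, p, g, q⟩) z b e := by
  classical
  induction c using Finsupp.induction_linear with
  | zero => 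
    have : ∀ (g : Gen) p q, localDiff N (fun _ _ _ => (0 : k)) g p q = 0 := by
      intro g p q; cases g <;> simp [localDiff]
    simp [this]
  | add c c' hc hc' =>
    simp only [map_add, Finsupp.add_apply, localDiff_add, hc, hc']
    ring
  | single w r =>
    obtain ⟨x', a', y', b', z', e'⟩ := w
    have h1 : ∀ w v : Word ℕ, Finsupp.single w r v = r * if w = v then 1 else 0 := by
      intro w v; rw [Finsupp.single_apply]; split_ifs <;> simp
    rw [onNormalized_single, proj_diff]
    simp only [h1, localDiff_mul, Finsupp.smul_apply, Finsupp.add_apply, smul_eq_mul]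
    rw [sum_muDelta_apply N (fun h i j => ⟨h, j, y', b', z', i⟩) ⟨x, a, y, b, z, e⟩
        (y' = y ∧ b' = b ∧ z' = z) x e a (by intros; simp; tauto),
      sum_muDelta_apply N (fun h i j => ⟨x', i, h, j, z', e'⟩) ⟨x, a, y, b, z, e⟩
        (x' = x ∧ z' = z ∧ e' = e) y a b (by intros; simp; tauto),
      sum_muDelta_apply N (fun h i j => ⟨x', a', y', i, h, j⟩) ⟨x, a, y, b, z, e⟩
        (x' = x ∧ a' = a ∧ y' = y) z b e (by intros; simp; tauto)]
    rw [mul_localDiff_congr N (y'.sign k * z'.sign k) (y.sign k * z.sign k) _ (by rintro ⟨rfl, -, rfl⟩; rfl),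
      mul_localDiff_congr N (z'.sign k) (z.sign k) _ (by rintro ⟨-, rfl, -⟩; rfl)]
    have e1 : ∀ h p'' q'', ((y' = y ∧ b' = b ∧ z' = z) ∧ x' = h ∧ e' = p'' ∧ a' = q'') ↔
      (⟨x', a', y', b', z', e'⟩ : Word ℕ) = ⟨h, q'', y, b, z, p''⟩ := by intros; simp; tauto
    have e2 : ∀ h p'' q'', ((x' = x ∧ z' = z ∧ e' = e) ∧ y' = h ∧ a' = p'' ∧ b' = q'') ↔
      (⟨x', a', y', b', z', e'⟩ : Word ℕ) = ⟨x, p'', h, q'', z, e⟩ := by intros; simp; tauto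
    have e3 : ∀ h p'' q'', ((x' = x ∧ a' = a ∧ y' = y) ∧ z' = h ∧ b' = p'' ∧ e' = q'') ↔
      (⟨x', a', y', b', z', e'⟩ : Word ℕ) = ⟨x, a, y, p'', h, q''⟩ := by intros; simp; tauto
    simp only [e1, e2, e3]
    ring

/-- The generator of `ℤ/3` on the normalized complex in coordinates. -/
theorem rot_apply (c : Chain k) (x : Gen) (a : ℕ) (y : Gen) (b : ℕ) (z : Gen) (e : ℕ) :
    onNormalized k (rot k) c ⟨x, a, y, b, z, e⟩ =
      (-1) ^ (x.deg * (y.deg + z.deg)) * c ⟨y, b, z, e, x, a⟩ := by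
  classical
  induction c using Finsupp.induction_linear with
  | zero => simp
  | add c c' hc hc' => simp only [map_add, Finsupp.add_apply, hc, hc']; ring
  | single w r =>
    obtain ⟨x', a', y', b', z', e'⟩ := w
    have h : rot k (Word.lift ⟨x', a', y', b', z', e'⟩) =
      Finsupp.single (Word.lift ⟨z', e', x', a', y', b'⟩) ((-1) ^ (z'.deg * (x'.deg + y'.deg))) := by
      simp [rot, Word.lift]
    rw [onNormalized_single, h, Finsupp.linearCombination_single, proj_lift]
    simp only [Finsupp.smul_apply, Finsupp.single_apply, smul_eq_mul, Word.mk.injEq]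
    grind

/-- The grading operator on the normalized complex in coordinates. -/
theorem sgn_apply (c : Chain k) (x : Gen) (a : ℕ) (y : Gen) (b : ℕ) (z : Gen) (e : ℕ) :
    onNormalized k (sgn k) c ⟨x, a, y, b, z, e⟩ =
      (-1) ^ (x.deg + y.deg + z.deg) * c ⟨x, a, y, b, z, e⟩ := by
  classical
  induction c using Finsupp.induction_linear with
  | zero => simp
  | add c c' hc hc' => simp only [map_add, Finsupp.add_apply, hc, hc']; ring
  | single w r =>
    obtain ⟨x', a', y', b', z', e'⟩ := w
    have h : sgn k (Word.lift ⟨x', a', y', b', z', e'⟩) =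
      Finsupp.single (Word.lift ⟨x', a', y', b', z', e'⟩) ((-1) ^ (x'.deg + y'.deg + z'.deg)) := by
      simp [sgn, Word.lift, Word.deg]
    rw [onNormalized_single, h, Finsupp.linearCombination_single, proj_lift]
    simp only [Finsupp.smul_apply, Finsupp.single_apply, smul_eq_mul, Word.mk.injEq]
    grind

end Coordinates


/-! ### The cap product as a simultaneous shift of the three blocks. -/

section CubeCoordinates

variable {k : Type*} [Field k]

theorem phiOne_replicate (j : ℕ) :
    phiOne k 1 (List.replicate j .del) = if j = 1 then Finsupp.single .one 1 else 0 := by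
  have : List.replicate j Gen.del = List.replicate 1 Gen.del ↔ j = 1 := by
    constructor
    · intro h; simpa using congrArg List.length h
    · rintro rfl; rfl
  rw [phiOne]
  simp only [this]

theorem muDelta_one_mem (N : ℕ) (g : Gen) (r i s : ℕ) :
    muDelta k N (List.replicate r .del) g
      (List.replicate i .del ++ .one :: List.replicate s .del) =
      if r = 0 ∧ i = 0 ∧ s = 0 then Finsupp.single g 1 else 0 := by
  have h0 : List.replicate r Gen.del ++ g :: (List.replicate i .del ++ .one :: List.replicate s .del) ≠
      List.replicate N Gen.del := fun h => by
    have : Gen.one ∈ List.replicate N Gen.del := by simp [← h]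
    simp [List.mem_replicate] at this
  rw [muDelta, mu, if_neg h0]
  rcases r with - | - | r <;> rcases i with - | i <;> rcases s with - | s <;> cases g <;>
    simp [List.replicate_succ, rdeg, Gen.rdeg]

/-- The endomorphism `Ψ(φ^1_1)` absorbs one `∂` to the right of the distinguished entry. -/
theorem Psi_phiOne (N : ℕ) (g : Gen) (r s : ℕ) :
    Psi k N (phiOne k 1) (List.replicate r .del) g (List.replicate s .del) =
      if r = 0 ∧ s = 1 then Finsupp.single g 1 else 0 := by
  simp only [Psi, List.length_replicate, List.drop_replicate, List.take_replicate,
    phiOne_replicate]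
  have key : ∀ i ∈ Finset.range (s + 1), ∀ j ∈ Finset.range (s - i + 1),
      ((if min j (s - i) = 1 then Finsupp.single Gen.one (1 : k) else 0).sum fun h c =>
      c • muDelta k N (List.replicate r .del) g
        (List.replicate (min i s) .del ++ h :: List.replicate (s - (i + j)) .del)) =
      if i = 0 ∧ j = 1 then (if r = 0 ∧ s = 1 then Finsupp.single g 1 else 0) else 0 := by
    intro i hi j hj
    rw [Finset.mem_range] at hi hj
    split_ifs <;> simp [Finsupp.sum_single_index, muDelta_one_mem] <;> grind
  rw [Finset.sum_congr rfl fun i hi => Finset.sum_congr rfl (key i hi), Finset.sum_eq_single 0]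
  · by_cases h : r = 0 ∧ s = 1
    · simp [h]
    · simp [h]
  · intro i _ hi; simp [hi]
  · simp

/-- For the cuts of a block in `cube`: `Psi_phiOne` needs exactly one ∂ to the right of an entry and
none to its left, so only the cut into lengths 1, n - 1, 0 survives, and an empty block has no such
cut. -/
theorem sum_range_cut (M : Type*) [AddCommMonoid M] (n : ℕ) (F : ℕ → ℕ → M)
    (hF : ∀ a ≤ n, ∀ b ≤ n - a, ¬ (a = 1 ∧ a + b = n) → F a b = 0) :
    ∑ a ∈ Finset.range (n + 1), ∑ b ∈ Finset.range (n - a + 1), F a b =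
      if n = 0 then 0 else F 1 (n - 1) := by
  split_ifs with h
  · subst h; simp [hF]
  · rw [Finset.sum_eq_single 1, Finset.sum_eq_single (n - 1)]
    · intro b hb hb'; rw [Finset.mem_range] at hb; exact hF _ (by omega) _ (by omega) (by omega)
    · simp
    · intro a ha ha'
      rw [Finset.mem_range] at ha
      refine Finset.sum_eq_zero fun b hb => ?_
      rw [Finset.mem_range] at hb
      exact hF _ (by omega) _ (by omega) (by omega)
    · simp; omega

/-- The operator by which the cap product with `φ^1_1` acts on the normalized complex. -/
noncomputable abbrev capX (k : Type*) [Field k] (N : ℕ) : Module.End k (Chain k) :=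
  onNormalized k (cube k (Psi k N (phiOne k 1)))

theorem sum_sum_sum_ite {P Q R : Prop} [Decidable P] [Decidable Q] [Decidable R] (x y z : Gen)
    {L : Type} (W : Gen → Gen → Gen → Word L) :
    ((if P then Finsupp.single x (1 : k) else 0).sum fun g₁ c₁ =>
      (if Q then Finsupp.single y (1 : k) else 0).sum fun g₂ c₂ =>
      (if R then Finsupp.single z (1 : k) else 0).sum fun g₃ c₃ =>
        Finsupp.single (W g₁ g₂ g₃) (c₁ * c₂ * c₃)) =
      if P ∧ Q ∧ R then Finsupp.single (W x y z) 1 else 0 := by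
  by_cases hP : P <;> by_cases hQ : Q <;> by_cases hR : R <;>
    simp [hP, hQ, hR, -Finsupp.single_mul, Finsupp.sum_single_index]

/-- Each distinguished entry consumes the first ∂ of the block that follows it. Nothing is moved
from the end to the front in a surviving term, and all ∂'s have reduced degree 0, so no sign
appears. -/
theorem cube_lift (N : ℕ) (w : Word ℕ) :
    cube k (Psi k N (phiOne k 1)) w.lift =
      if w.l₁ = 0 ∨ w.l₂ = 0 ∨ w.l₃ = 0 then 0 else
        Finsupp.single (Word.lift ⟨w.x₁, w.l₁ - 1, w.x₂, w.l₂ - 1, w.x₃, w.l₃ - 1⟩) 1 := by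
  obtain ⟨x, a, y, b, z, e⟩ := w
  simp only [cube, Word.lift, List.length_replicate, List.drop_replicate, List.take_replicate,
    Psi_phiOne, rdeg_replicate_del, zero_mul, pow_zero, one_smul]
  simp only [sum_sum_sum_ite x y z fun g₁ g₂ g₃ => ⟨g₁, _, g₂, _, g₃, _⟩]
  rw [sum_range_cut, sum_range_cut, sum_range_cut]
  · rcases a with - | a <;> rcases b with - | b <;> rcases e with - | e <;> simp
  · intro a' ha b' hb h
    rw [if_neg]; omega
  · intro a' ha b' hb h
    refine Finset.sum_eq_zero fun _ _ => Finset.sum_eq_zero fun _ _ => ?_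
    rw [if_neg]; omega
  · intro a' ha b' hb h
    refine Finset.sum_eq_zero fun _ _ => Finset.sum_eq_zero fun _ _ => 
      Finset.sum_eq_zero fun _ _ => Finset.sum_eq_zero fun _ _ => ?_
    rw [if_neg]; omega

/-- The cap product with `φ^1_1` on the normalized complex in coordinates. -/
theorem capX_apply (N : ℕ) (c : Chain k) (x : Gen) (a : ℕ) (y : Gen) (b : ℕ) (z : Gen) (e : ℕ) :
    capX k N c ⟨x, a, y, b, z, e⟩ = c ⟨x, a + 1, y, b + 1, z, e + 1⟩ := by
  classical
  induction c using Finsupp.induction_linear with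
  | zero => simp
  | add c c' hc hc' => simp only [map_add, Finsupp.add_apply, hc, hc']
  | single w r =>
    obtain ⟨x', a', y', b', z', e'⟩ := w
    rw [onNormalized_single, cube_lift]
    dsimp only
    split_ifs with h
    · simp [Finsupp.single_apply]
      omega
    · rw [Finsupp.linearCombination_single, proj_lift]
      simp only [one_smul, Finsupp.smul_apply, Finsupp.single_apply, smul_eq_mul, Word.mk.injEq]
      grind

end CubeCoordinates


/-! ### Identities between the operators on the normalized complex. -/

section Operators

variable {k : Type*} [Field k]

/-- The rotation of the normalized complex. -/
noncomputable abbrev τX (k : Type*) [Field k] : Module.End k (Chain k) := onNormalized k (rot k)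

/-- The grading operator of the normalized complex. -/
noncomputable abbrev sX (k : Type*) [Field k] : Module.End k (Chain k) := onNormalized k (sgn k)

theorem end_ext {f g : Module.End k (Chain k)}
    (h : ∀ c x a y b z e, f c ⟨x, a, y, b, z, e⟩ = g c ⟨x, a, y, b, z, e⟩) : f = g := by
  refine LinearMap.ext fun c => Finsupp.ext ?_
  rintro ⟨x, a, y, b, z, e⟩
  exact h c x a y b z e

theorem sum_range_telescope (N : ℕ) (f : ℕ → ℕ → k) (p q : ℕ) :
    ∑ i ∈ Finset.range N, (f (p + i) (q + (N - 1 - i) + 1) - f (p + i + 1) (q + (N - 1 - i))) =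
      f p (q + N) - f (p + N) q := by
  rw [← Nat.sub_zero N, ← neg_inj]
  have := Finset.sum_range_sub (fun i => f (p + i) (q + (N - i))) N
  simp only [Nat.sub_zero, Nat.sub_self, Nat.add_zero] at this ⊢
  rw [neg_sub, ← this, ← Finset.sum_neg_distrib]
  refine Finset.sum_congr rfl fun i hi => ?_
  rw [Finset.mem_range] at hi
  rw [neg_sub, show q + (N - 1 - i) + 1 = q + (N - i) by omega,
    show q + (N - 1 - i) = q + (N - (i + 1)) by omega, add_assoc]

/-- With S and S' the shifts in `p` and `q`, this is the factorization S'^N - S^N = (S' - S) ∑ S^i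
S'^(N-1-i); the order of the two factors is irrelevant, so both entries give the same answer. -/
theorem localDiff_localDiff (N : ℕ) (f : Gen → ℕ → ℕ → k) (x : Gen) (p q : ℕ) :
    localDiff N (fun g i j => localDiff N f g i j) x p q = f x (p + N) q - f x p (q + N) := by
  have key := sum_range_telescope N (f x) p q
  simp only [Finset.sum_sub_distrib] at key
  cases x <;> simp only [localDiff, Finset.sum_sub_distrib, add_right_comm _ 1] <;>
    linear_combination -key

/-- The operations at two neighbouring entries share the block between them, but both only add to
its length, and these shifts commute. -/
theorem localDiff_comm (N : ℕ) (f : Gen → ℕ → ℕ → Gen → ℕ → k) (x y : Gen) (e a b : ℕ) :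
    localDiff N (fun g p q => localDiff N (fun g' p' q' => f g p p' g' q') y q b) x e a =
      localDiff N (fun g' p' q' => localDiff N (fun g p q => f g p q g' q') x e p') y a b := by
  cases x <;> cases y <;>
    simp only [localDiff, Finset.sum_sub_distrib, Finset.sum_neg_distrib, add_right_comm _ _ 1]
  · rw [Finset.sum_comm]
    simp only [add_right_comm]
  · ring
  · ring
  · ring

/-- `localDiff` always exchanges 1 and ∂, hence anticommutes with the sign operator. -/
theorem localDiff_sign (N : ℕ) (f : Gen → ℕ → ℕ → k) (x : Gen) (p q : ℕ) :
    localDiff N (fun g i j => g.sign k * f g i j) x p q = -x.sign k * localDiff N f x p q := by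
  cases x <;> simp [localDiff, Gen.sign, Gen.deg]

theorem localDiff_sign_mul (N : ℕ) (r : k) (f : Gen → ℕ → ℕ → k) (x : Gen) (p q : ℕ) :
    localDiff N (fun g i j => g.sign k * r * f g i j) x p q =
      -x.sign k * r * localDiff N f x p q := by
  simp only [mul_assoc, localDiff_sign, localDiff_mul]

theorem localDiff_mul_sign (N : ℕ) (r : k) (f : Gen → ℕ → ℕ → k) (x : Gen) (p q : ℕ) :
    localDiff N (fun g i j => r * g.sign k * f g i j) x p q =
      r * -x.sign k * localDiff N f x p q := by
  simp only [mul_assoc, localDiff_sign, localDiff_mul]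

/-- The coefficients of `localDiff` do not depend on the block lengths; this translation invariance
is why the cap product is a chain map. -/
theorem localDiff_shift (N : ℕ) (f : Gen → ℕ → ℕ → k) (x : Gen) (p q : ℕ) :
    localDiff N f x (p + 1) (q + 1) = localDiff N (fun g i j => f g (i + 1) (j + 1)) x p q := by
  cases x <;> simp only [localDiff, add_right_comm _ 1]

theorem Gen.sign_mul_sign (g : Gen) : g.sign k * g.sign k = 1 := by
  cases g <;> simp [Gen.sign, Gen.deg]

/-- The mixed terms cancel in pairs, because operations at different entries commute while the sign
operator anticommutes. The three squares are differences of N-th powers of consecutive shifts, and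
they telescope around the cycle. -/
theorem dX_mul_dX (N : ℕ) : dX k N * dX k N = 0 := by
  refine end_ext fun c x a y b z e => ?_
  rw [Module.End.mul_apply, LinearMap.zero_apply, Finsupp.zero_apply, dX_apply]
  simp only [dX_apply, localDiff_add, localDiff_sign_mul, localDiff_mul_sign, localDiff_sign,
    localDiff_mul]
  have h12 := localDiff_comm N (fun g p p' g' q' => c ⟨g, p', g', q', z, p⟩) x y e a b
  have h23 := localDiff_comm N (fun g p p' g' q' => c ⟨x, p, g, p', g', q'⟩) y z a b e
  have h31 := localDiff_comm N (fun g p p' g' q' => c ⟨g', q', y, p, g, p'⟩) z x b e a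
  have h1 := localDiff_localDiff N (fun g p q => c ⟨g, q, y, b, z, p⟩) x e a
  have h2 := localDiff_localDiff N (fun g p q => c ⟨x, p, g, q, z, e⟩) y a b
  have h3 := localDiff_localDiff N (fun g p q => c ⟨x, a, y, p, g, q⟩) z b e
  rw [h1, h2, h3, h12, h23, ← h31]
  linear_combination
    (c ⟨x, a, y, b, z, e + N⟩ - c ⟨x, a + N, y, b, z, e⟩) *
      (z.sign k * z.sign k * y.sign_mul_sign (k := k) + z.sign_mul_sign (k := k)) +
    (c ⟨x, a + N, y, b, z, e⟩ - c ⟨x, a, y, b + N, z, e⟩) * z.sign_mul_sign (k := k)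

theorem dX_mul_τX (N : ℕ) : dX k N * τX k = τX k * dX k N := by
  refine end_ext fun c x a y b z e => ?_
  rw [Module.End.mul_apply, Module.End.mul_apply, dX_apply, rot_apply, dX_apply]
  cases x <;> cases y <;> cases z <;>
    simp only [localDiff, rot_apply, Gen.sign, Gen.deg, ← Finset.mul_sum] <;> ring

theorem dX_mul_sX (N : ℕ) : dX k N * sX k = -(sX k * dX k N) := by
  refine end_ext fun c x a y b z e => ?_
  rw [LinearMap.neg_apply, Finsupp.neg_apply, Module.End.mul_apply, Module.End.mul_apply, dX_apply,
    sgn_apply, dX_apply]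
  cases x <;> cases y <;> cases z <;>
    simp only [localDiff, sgn_apply, Gen.sign, Gen.deg, ← Finset.mul_sum] <;> ring

theorem τX_pow_three : τX k ^ 3 = 1 := by
  refine end_ext fun c x a y b z e => ?_
  rw [pow_succ, pow_two, Module.End.mul_apply, Module.End.mul_apply, rot_apply, rot_apply,
    rot_apply]
  cases x <;> cases y <;> cases z <;> simp [Gen.deg]

theorem sX_mul_sX : sX k * sX k = 1 := by
  refine end_ext fun c x a y b z e => ?_
  rw [Module.End.mul_apply, sgn_apply, sgn_apply]
  cases x <;> cases y <;> cases z <;> norm_num [Gen.deg]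

theorem sX_mul_τX : sX k * τX k = τX k * sX k := by
  refine end_ext fun c x a y b z e => ?_
  rw [Module.End.mul_apply, Module.End.mul_apply, rot_apply, sgn_apply, rot_apply, sgn_apply]
  cases x <;> cases y <;> cases z <;> simp [Gen.deg, pow_succ]

theorem capX_mul_dX (N : ℕ) : capX k N * dX k N = dX k N * capX k N := by
  refine end_ext fun c x a y b z e => ?_
  rw [Module.End.mul_apply, Module.End.mul_apply, capX_apply, dX_apply, dX_apply]
  simp only [capX_apply, localDiff_shift]

theorem capX_mul_τX (N : ℕ) : capX k N * τX k = τX k * capX k N := by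
  refine end_ext fun c x a y b z e => ?_
  rw [Module.End.mul_apply, Module.End.mul_apply, capX_apply, rot_apply, rot_apply, capX_apply]

theorem capX_mul_sX (N : ℕ) : capX k N * sX k = sX k * capX k N := by
  refine end_ext fun c x a y b z e => ?_
  rw [Module.End.mul_apply, Module.End.mul_apply, capX_apply, sgn_apply, sgn_apply, capX_apply]

end Operators


/-! ### Coefficients in M[[t]]. -/

section PowerSeriesModule

variable {k M : Type*} [Field k] [AddCommGroup M] [Module k M]

theorem PS.map_apply (f : Module.End k M) (c : PS M) (n : ℕ) : PS.map f c n = f (c n) := rfl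

theorem PS.X_smul_zero (c : PS M) : ((PowerSeries.X : PowerSeries k) • c) 0 = 0 := by
  simp [PS.smul_apply]

theorem PS.X_smul_succ (c : PS M) (n : ℕ) :
    ((PowerSeries.X : PowerSeries k) • c) (n + 1) = c n := by
  rw [PS.smul_apply, Finset.sum_eq_single (1, n)]
  · simp
  · rintro ⟨i, j⟩ hij hne
    have hi : i ≠ 1 := by
      rintro rfl
      apply hne
      have := Finset.HasAntidiagonal.mem_antidiagonal.1 hij
      simp at this ⊢
      omega
    simp [PowerSeries.coeff_X, hi]
  · intro h
    simp [add_comm] at h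

theorem PS.C_smul_apply (r : k) (c : PS M) (n : ℕ) : (PowerSeries.C r • c) n = r • c n := by
  rw [PS.smul_apply, Finset.sum_eq_single (0, n)]
  · simp
  · rintro ⟨i, j⟩ hij hne
    have hi : i ≠ 0 := by
      rintro rfl
      apply hne
      simpa using hij
    simp [PowerSeries.coeff_C, hi]
  · intro h
    simp at h

theorem PS.sub_apply (c c' : PS M) (n : ℕ) : (c - c') n = c n - c' n := rfl

theorem PS.map_map (f g : Module.End k M) (c : PS M) :
    PS.map f (PS.map g c) = PS.map (f * g) c := rfl

theorem PS.map_add_end (f g : Module.End k M) (c : PS M) :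
    PS.map (f + g) c = PS.map f c + PS.map g c := rfl

theorem PS.map_zero_end (c : PS M) : PS.map (0 : Module.End k M) c = 0 := rfl

end PowerSeriesModule

/-! ### The ℤ/3-fixed point complex of an abstract differential module. -/

section FixedPoints

variable {k : Type*} [Field k]

section Relations

variable {M : Type*} [AddCommGroup M] [Module k M] {d τ s f : Module.End k M}

/-- Cancels the grading operators in pairs, so that the relations below become polynomial identities
in τ. -/
theorem mul_mul_mul_mul {p q : Module.End k M} (hs : s * s = 1) (hq : Commute s q) :
    p * s * (q * s) = p * q := by
  rw [mul_assoc p, ← mul_assoc _ q, hq.eq, mul_assoc q, hs, mul_one]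

theorem norm_mul_sub_one (hτ : τ ^ 3 = 1) (hs : s * s = 1) (hsτ : s * τ = τ * s) :
    (1 + τ + τ ^ 2) * s * ((τ - 1) * s) = 0 := by
  have h : Commute s τ := hsτ
  rw [mul_mul_mul_mul hs (h.sub_right (Commute.one_right _))]
  calc (1 + τ + τ ^ 2) * (τ - 1) = τ ^ 3 - 1 := by noncomm_ring
    _ = 0 := by rw [hτ, sub_self]

theorem sub_one_mul_norm (hτ : τ ^ 3 = 1) (hs : s * s = 1) (hsτ : s * τ = τ * s) :
    (τ - 1) * s * ((1 + τ + τ ^ 2) * s) = 0 := by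
  have h : Commute s τ := hsτ
  rw [mul_mul_mul_mul hs (((Commute.one_right _).add_right h).add_right (h.pow_right 2))]
  calc (τ - 1) * (1 + τ + τ ^ 2) = τ ^ 3 - 1 := by noncomm_ring
    _ = 0 := by rw [hτ, sub_self]

theorem End_three [CharP k 3] : (3 : Module.End k M) = 0 := by
  have : (3 : k) = 0 := CharP.cast_eq_zero k 3
  rw [← map_ofNat (algebraMap k (Module.End k M)) 3, this, map_zero]

/-- The polynomial in question is 3τ³. Here, and in the companion identity that follows, the action
of θ anticommutes with the differential because 3 = 0. -/
theorem norm_mul_add_theta_mul [CharP k 3] (hs : s * s = 1) (hsτ : s * τ = τ * s) :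
    (τ + 2 * τ ^ 2) * s * ((τ - 1) * s) + (1 + τ + τ ^ 2) * s * (τ * s) = 0 := by
  have h : Commute s τ := hsτ
  rw [mul_mul_mul_mul hs (h.sub_right (Commute.one_right _)), mul_mul_mul_mul hs h]
  calc (τ + 2 * τ ^ 2) * (τ - 1) + (1 + τ + τ ^ 2) * τ = 3 * τ ^ 3 := by noncomm_ring
    _ = 0 := by rw [End_three, zero_mul]

theorem sub_one_mul_add_theta_mul [CharP k 3] (hs : s * s = 1) (hsτ : s * τ = τ * s) :
    τ * s * ((1 + τ + τ ^ 2) * s) + (τ - 1) * s * ((τ + 2 * τ ^ 2) * s) = 0 := by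
  have h : Commute s τ := hsτ
  rw [mul_mul_mul_mul hs (((Commute.one_right _).add_right h).add_right (h.pow_right 2)),
    mul_mul_mul_mul hs (h.add_right ((Commute.ofNat_right _ 2).mul_right (h.pow_right 2)))]
  calc τ * (1 + τ + τ ^ 2) + (τ - 1) * (τ + 2 * τ ^ 2) = 3 * τ ^ 3 := by noncomm_ring
    _ = 0 := by rw [End_three, zero_mul]

/-- Since τ³ = 1 and 2 = -1, the left side is τ² - 1; the factorization on the right exhibits the
homotopy τ + 1. -/
theorem theta_mul_theta [CharP k 3] (hτ : τ ^ 3 = 1) (hs : s * s = 1) (hsτ : s * τ = τ * s) :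
    (τ + 2 * τ ^ 2) * s * (τ * s) = (τ + 1) * s * ((τ - 1) * s) := by
  have h : Commute s τ := hsτ
  rw [mul_mul_mul_mul hs (h.sub_right (Commute.one_right _)), mul_mul_mul_mul hs h]
  calc (τ + 2 * τ ^ 2) * τ = (τ + 1) * (τ - 1) + (2 * τ ^ 3 + 1) := by noncomm_ring
    _ = (τ + 1) * (τ - 1) + 3 := by rw [hτ, mul_one, two_add_one_eq_three]
    _ = (τ + 1) * (τ - 1) := by rw [End_three, add_zero]

theorem theta_mul_theta' [CharP k 3] (hτ : τ ^ 3 = 1) (hs : s * s = 1) (hsτ : s * τ = τ * s) :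
    τ * s * ((τ + 2 * τ ^ 2) * s) = (τ - 1) * s * ((τ + 1) * s) := by
  have h : Commute s τ := hsτ
  rw [mul_mul_mul_mul hs (h.add_right (Commute.one_right _)),
    mul_mul_mul_mul hs (h.add_right ((Commute.ofNat_right _ 2).mul_right (h.pow_right 2)))]
  calc τ * (τ + 2 * τ ^ 2) = (τ - 1) * (τ + 1) + (2 * τ ^ 3 + 1) := by noncomm_ring
    _ = (τ - 1) * (τ + 1) + 3 := by rw [hτ, mul_one, two_add_one_eq_three]
    _ = (τ - 1) * (τ + 1) := by rw [End_three, add_zero]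

theorem mul_mul_add_mul_mul_eq_zero {p : Module.End k M} (hdp : Commute d p)
    (hds : d * s = -(s * d)) : d * (p * s) + p * s * d = 0 := by
  rw [← mul_assoc, hdp.eq, mul_assoc, hds, mul_assoc]
  simp

theorem commute_sub_one (h : f * τ = τ * f) : Commute f (τ - 1) :=
  Commute.sub_right h (Commute.one_right _)

theorem commute_add_one (h : f * τ = τ * f) : Commute f (τ + 1) :=
  Commute.add_right h (Commute.one_right _)

theorem commute_norm (h : f * τ = τ * f) : Commute f (1 + τ + τ ^ 2) :=
  ((Commute.one_right _).add_right h).add_right (Commute.pow_right h 2)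

theorem commute_theta (h : f * τ = τ * f) : Commute f (τ + 2 * τ ^ 2) :=
  Commute.add_right h ((Commute.ofNat_right _ 2).mul_right (Commute.pow_right h 2))

theorem mul_norm_mul (hτ : f * τ = τ * f) (hs : f * s = s * f) :
    f * ((1 + τ + τ ^ 2) * s) = (1 + τ + τ ^ 2) * s * f :=
  ((commute_norm hτ).mul_right hs).eq

theorem mul_sub_one_mul (hτ : f * τ = τ * f) (hs : f * s = s * f) :
    f * ((τ - 1) * s) = (τ - 1) * s * f :=
  ((commute_sub_one hτ).mul_right hs).eq

theorem mul_theta_mul (hτ : f * τ = τ * f) (hs : f * s = s * f) :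
    f * ((τ + 2 * τ ^ 2) * s) = (τ + 2 * τ ^ 2) * s * f :=
  ((commute_theta hτ).mul_right hs).eq

theorem PS.map_add_map (p q : Module.End k M) (h : p + q = 0) (c : PS M) :
    PS.map p c + PS.map q c = 0 := by
  rw [← PS.map_add_end, h, PS.map_zero_end]

/-- The `t`-linear differential `x ↦ d x + (-1)^{|x|} (τ x - x) θ`,
`x θ ↦ d x θ + (-1)^{|x|} (x + τ x + τ² x) t` on `M[[t, θ]]`, for operators `d`, `τ` and
`s = (-1)^{|·|}` on `M`. -/
noncomputable def fixDiff (d τ s : Module.End k M) :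
    PS M × PS M →ₗ[PowerSeries k] PS M × PS M :=
  LinearMap.prod
    (PS.map d ∘ₗ LinearMap.fst _ _ _ +
      (PowerSeries.X : PowerSeries k) • (PS.map ((1 + τ + τ ^ 2) * s) ∘ₗ LinearMap.snd _ _ _))
    (PS.map ((τ - 1) * s) ∘ₗ LinearMap.fst _ _ _ + PS.map d ∘ₗ LinearMap.snd _ _ _)

/-- The action of `θ` on `M[[t, θ]]`. -/
noncomputable def fixTheta (τ s : Module.End k M) :
    PS M × PS M →ₗ[PowerSeries k] PS M × PS M :=
  LinearMap.prod
    ((PowerSeries.X : PowerSeries k) • (PS.map ((τ + 2 * τ ^ 2) * s) ∘ₗ LinearMap.snd _ _ _))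
    (PS.map (τ * s) ∘ₗ LinearMap.fst _ _ _)

theorem fixDiff_mk (c₀ c₁ : PS M) :
    fixDiff d τ s (c₀, c₁) =
      (PS.map d c₀ + (PowerSeries.X : PowerSeries k) • PS.map ((1 + τ + τ ^ 2) * s) c₁,
        PS.map ((τ - 1) * s) c₀ + PS.map d c₁) := rfl

theorem fixTheta_mk (c₀ c₁ : PS M) :
    fixTheta τ s (c₀, c₁) =
      ((PowerSeries.X : PowerSeries k) • PS.map ((τ + 2 * τ ^ 2) * s) c₁,
        PS.map (τ * s) c₀) := rfl

theorem fixDiff_comp_fixDiff (hd : d * d = 0) (hdτ : d * τ = τ * d) (hds : d * s = -(s * d))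
    (hτ : τ ^ 3 = 1) (hs : s * s = 1) (hsτ : s * τ = τ * s) :
    fixDiff d τ s ∘ₗ fixDiff d τ s = 0 := by
  refine LinearMap.ext ?_
  rintro ⟨c₀, c₁⟩
  have h1 := PS.map_add_map _ _ (mul_mul_add_mul_mul_eq_zero (commute_sub_one hdτ) hds) c₀
  have h2 := PS.map_add_map _ _ (mul_mul_add_mul_mul_eq_zero (commute_norm hdτ) hds) c₁
  rw [LinearMap.comp_apply, fixDiff_mk, fixDiff_mk]
  simp only [map_add, map_smul, PS.map_map, hd, PS.map_zero_end, zero_add,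
    add_zero, LinearMap.zero_apply, norm_mul_sub_one hτ hs hsτ, sub_one_mul_norm hτ hs hsτ]
  refine Prod.ext ?_ ?_
  · dsimp only [Prod.fst_zero]
    rw [← smul_add, h2, smul_zero]
  · dsimp only [Prod.snd_zero]
    rw [smul_zero, add_zero, add_comm, h1]

theorem fixTheta_fixDiff [CharP k 3] (hdτ : d * τ = τ * d) (hds : d * s = -(s * d))
    (hs : s * s = 1) (hsτ : s * τ = τ * s) (x : PS M × PS M) :
    fixTheta τ s (fixDiff d τ s x) = -fixDiff d τ s (fixTheta τ s x) := by
  obtain ⟨c₀, c₁⟩ := x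
  have h1 := PS.map_add_map _ _ (mul_mul_add_mul_mul_eq_zero (commute_theta hdτ) hds) c₁
  have h2 := PS.map_add_map _ _ (mul_mul_add_mul_mul_eq_zero hdτ hds) c₀
  have h4 := PS.map_add_map _ _ (norm_mul_add_theta_mul hs hsτ) c₀
  have h5 := PS.map_add_map _ _ (sub_one_mul_add_theta_mul hs hsτ) c₁
  rw [fixDiff_mk, fixTheta_mk, fixTheta_mk, fixDiff_mk, eq_neg_iff_add_eq_zero, Prod.mk_add_mk]
  simp only [map_add, map_smul, PS.map_map]
  refine Prod.ext ?_ ?_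
  · dsimp only [Prod.fst_zero]
    rw [← smul_add, ← smul_add, eq_neg_of_add_eq_zero_left h4, eq_neg_of_add_eq_zero_left h1]
    refine (congrArg _ ?_).trans (smul_zero _)
    abel
  · dsimp only [Prod.snd_zero]
    rw [eq_neg_of_add_eq_zero_left h5, eq_neg_of_add_eq_zero_left h2, smul_neg]
    abel

/-- The square of the action of `θ` is `t (τ² - 1)`, which is null-homotopic. -/
theorem fixTheta_fixTheta [CharP k 3] (hdτ : d * τ = τ * d) (hds : d * s = -(s * d))
    (hτ : τ ^ 3 = 1) (hs : s * s = 1) (hsτ : s * τ = τ * s) (x : PS M × PS M)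
    (hx : fixDiff d τ s x = 0) :
    fixTheta τ s (fixTheta τ s x) ∈ LinearMap.range (fixDiff d τ s) := by
  obtain ⟨c₀, c₁⟩ := x
  rw [fixDiff_mk, Prod.mk_eq_zero] at hx
  obtain ⟨-, hx⟩ := hx
  -- The θ-part of the differential of this element is t(τ² - 1)c₁ directly. Its other part is -t(τ
  -- + 1)s d c₁, which the cycle condition (τ - 1)s c₀ = -d c₁ turns into t(τ² - 1)c₀.
  refine ⟨((PowerSeries.X : PowerSeries k) • PS.map ((τ + 1) * s) c₁, 0), ?_⟩
  have h1 := PS.map_add_map _ _ (mul_mul_add_mul_mul_eq_zero (commute_add_one hdτ) hds) c₁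
  have h2 := congrArg (PS.map ((τ + 1) * s)) hx
  rw [fixTheta_mk, fixTheta_mk, fixDiff_mk]
  simp only [map_add, map_smul, PS.map_map, map_zero, smul_zero, add_zero,
    theta_mul_theta hτ hs hsτ, theta_mul_theta' hτ hs hsτ] at h2 ⊢
  rw [eq_neg_of_add_eq_zero_left h1, eq_neg_of_add_eq_zero_left h2]

theorem prodMap_fixDiff (hd : f * d = d * f) (hτ : f * τ = τ * f) (hs : f * s = s * f)
    (x : PS M × PS M) :
    LinearMap.prodMap (PS.map f) (PS.map f) (fixDiff d τ s x) =
      fixDiff d τ s (LinearMap.prodMap (PS.map f) (PS.map f) x) := by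
  obtain ⟨c₀, c₁⟩ := x
  rw [fixDiff_mk, LinearMap.prodMap_apply, LinearMap.prodMap_apply, fixDiff_mk]
  simp only [map_add, map_smul, PS.map_map, hd, mul_norm_mul hτ hs, mul_sub_one_mul hτ hs]

theorem prodMap_fixTheta (hτ : f * τ = τ * f) (hs : f * s = s * f) (x : PS M × PS M) :
    LinearMap.prodMap (PS.map f) (PS.map f) (fixTheta τ s x) =
      fixTheta τ s (LinearMap.prodMap (PS.map f) (PS.map f) x) := by
  obtain ⟨c₀, c₁⟩ := x
  have h2 : f * (τ * s) = τ * s * f := by rw [← mul_assoc, hτ, mul_assoc, hs, mul_assoc]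
  rw [fixTheta_mk, LinearMap.prodMap_apply, LinearMap.prodMap_apply, fixTheta_mk]
  simp only [map_smul, PS.map_map, mul_theta_mul hτ hs, h2]

end Relations

end FixedPoints

/-! ### Descent of the operators to equivariant homology. -/

section Equivariant

variable {k : Type*} [Field k]

theorem eqDiff_comp_eqDiff (N : ℕ) : eqDiff k N ∘ₗ eqDiff k N = 0 :=
  fixDiff_comp_fixDiff (M := Chain k) (dX_mul_dX N) (dX_mul_τX N) (dX_mul_sX N) τX_pow_three
    sX_mul_sX sX_mul_τX

theorem thetaAct_eqDiff [CharP k 3] (N : ℕ) (x : EqChain k) :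
    thetaAct k (eqDiff k N x) = -eqDiff k N (thetaAct k x) :=
  fixTheta_fixDiff (M := Chain k) (dX_mul_τX N) (dX_mul_sX N) sX_mul_sX sX_mul_τX x

theorem thetaAct_thetaAct [CharP k 3] (N : ℕ) (x : EqChain k) (hx : eqDiff k N x = 0) :
    thetaAct k (thetaAct k x) ∈ LinearMap.range (eqDiff k N) :=
  fixTheta_fixTheta (M := Chain k) (dX_mul_τX N) (dX_mul_sX N) τX_pow_three sX_mul_sX sX_mul_τX x hx

theorem eqCap_eqDiff (N : ℕ) (x : EqChain k) :
    eqCap k N (phiOne k 1) (eqDiff k N x) = eqDiff k N (eqCap k N (phiOne k 1) x) :=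
  prodMap_fixDiff (M := Chain k) (capX_mul_dX N) (capX_mul_τX N) (capX_mul_sX N) x

theorem eqCap_thetaAct (N : ℕ) (x : EqChain k) :
    eqCap k N (phiOne k 1) (thetaAct k x) = thetaAct k (eqCap k N (phiOne k 1) x) :=
  prodMap_fixTheta (M := Chain k) (capX_mul_τX N) (capX_mul_sX N) x

theorem descends_eqCap (N : ℕ) : Descends (eqDiff k N) (eqCap k N (phiOne k 1)) :=
  ⟨fun x hx => by rw [← eqCap_eqDiff, hx, map_zero], fun x => ⟨_, (eqCap_eqDiff N x).symm⟩⟩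

theorem descends_thetaAct [CharP k 3] (N : ℕ) : Descends (eqDiff k N) (thetaAct k) :=
  ⟨fun x hx => by rw [← neg_eq_zero, ← thetaAct_eqDiff, hx, map_zero],
    fun x => ⟨-thetaAct k x, by rw [map_neg, thetaAct_eqDiff]⟩⟩

theorem homologyMap_mk {R E : Type*} [CommRing R] [AddCommGroup E] [Module R E] {d f : E →ₗ[R] E}
    (hf : Descends d f) (x : E) (hx : d x = 0) :
    homologyMap d f hf (homologyClass d x hx) = homologyClass d (f x) (hf.1 x hx) := rfl

theorem homologyClass_eq_iff {R E : Type*} [CommRing R] [AddCommGroup E] [Module R E]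
    {d : E →ₗ[R] E} (x y : E) (hx : d x = 0) (hy : d y = 0) :
    homologyClass d x hx = homologyClass d y hy ↔ ∃ z, x = y + d z := by
  rw [homologyClass, homologyClass, Submodule.Quotient.eq]
  constructor
  · rintro ⟨z, hz⟩
    exact ⟨z, by rw [hz]; simp⟩
  · rintro ⟨z, hz⟩
    exact ⟨z, eq_sub_of_add_eq' hz.symm⟩

theorem exists_homologyClass {R E : Type*} [CommRing R] [AddCommGroup E] [Module R E]
    {d : E →ₗ[R] E} (c : Homology d) : ∃ x hx, c = homologyClass d x hx := by
  obtain ⟨⟨x, hx⟩, rfl⟩ := Submodule.Quotient.mk_surjective _ c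
  exact ⟨x, hx, rfl⟩

theorem thetaHH_comp_thetaHH [CharP k 3] (N : ℕ) (h : Descends (eqDiff k N) (thetaAct k)) :
    thetaHH k N h ∘ₗ thetaHH k N h = 0 := by
  refine LinearMap.ext fun c => ?_
  obtain ⟨x, hx, rfl⟩ := exists_homologyClass c
  obtain ⟨z, hz⟩ := thetaAct_thetaAct N x hx
  exact ((homologyClass_eq_iff _ 0 _ (map_zero _)).2 ⟨z, hz.symm.trans (zero_add _).symm⟩).trans rfl

theorem capHH_comp_thetaHH [CharP k 3] (N : ℕ)
    (hcap : Descends (eqDiff k N) (eqCap k N (phiOne k 1)))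
    (h : Descends (eqDiff k N) (thetaAct k)) :
    capHH k N hcap ∘ₗ thetaHH k N h = thetaHH k N h ∘ₗ capHH k N hcap := by
  refine LinearMap.ext fun c => ?_
  obtain ⟨x, hx, rfl⟩ := exists_homologyClass c
  refine (homologyClass_eq_iff _ _ _ _).2 ⟨0, ?_⟩
  rw [map_zero, add_zero]
  exact eqCap_thetaAct N x

end Equivariant


/-! ### Lifting a basis of the homology from t = 0 to k[[t]]. -/

section TAdic

variable {k : Type*} [Field k]

/-- A `k[[t]]`-module is `t`-adically complete, Hausdorff and torsion-free. -/
structure IsTAdic (k : Type*) [Field k] (E : Type*) [AddCommGroup E] [Module (PowerSeries k) E] :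
    Prop where
  hausdorff (x : E) (hx : ∀ n : ℕ, ∃ r : E, x = (PowerSeries.X : PowerSeries k) ^ n • r) : x = 0
  complete (y : ℕ → E) : ∃ Y : E, ∀ m : ℕ, ∃ r : E,
    Y = ∑ n ∈ Finset.range m, (PowerSeries.X : PowerSeries k) ^ n • y n +
      (PowerSeries.X : PowerSeries k) ^ m • r
  torsionFree (x : E) (hx : (PowerSeries.X : PowerSeries k) • x = 0) : x = 0

section PowerSeriesModule

variable {M : Type*} [AddCommGroup M] [Module k M]

/-- The power series with the given coefficients. -/
def PS.mk (f : ℕ → M) : PS M := f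

theorem PS.mk_apply (f : ℕ → M) (n : ℕ) : PS.mk f n = f n := rfl

theorem PS.ext {c c' : PS M} (h : ∀ n, c n = c' n) : c = c' := funext h

theorem PS.X_pow_smul_apply_of_lt (c : PS M) {n i : ℕ} (h : i < n) :
    ((PowerSeries.X : PowerSeries k) ^ n • c) i = 0 := by
  rw [PS.smul_apply]
  refine Finset.sum_eq_zero fun q hq => ?_
  have := Finset.HasAntidiagonal.mem_antidiagonal.1 hq
  rw [PowerSeries.coeff_X_pow, if_neg (by omega), zero_smul]

theorem PS.X_pow_smul_apply_add (c : PS M) (n i : ℕ) :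
    ((PowerSeries.X : PowerSeries k) ^ n • c) (n + i) = c i := by
  rw [PS.smul_apply, Finset.sum_eq_single (n, i)]
  · simp
  · rintro ⟨p, q⟩ hq hne
    have := Finset.HasAntidiagonal.mem_antidiagonal.1 hq
    rw [PowerSeries.coeff_X_pow, if_neg, zero_smul]
    rintro rfl
    apply hne
    simp at this ⊢
    omega
  · intro h
    exact absurd (Finset.HasAntidiagonal.mem_antidiagonal.2 (by rfl)) h

theorem PS.exists_eq_X_pow_smul (c : PS M) (n : ℕ) (h : ∀ i < n, c i = 0) :
    ∃ r : PS M, c = (PowerSeries.X : PowerSeries k) ^ n • r := by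
  refine ⟨PS.mk fun i => c (n + i), PS.ext fun i => ?_⟩
  rcases lt_or_ge i n with hi | hi
  · rw [h i hi, PS.X_pow_smul_apply_of_lt _ hi]
  · obtain ⟨j, rfl⟩ := Nat.exists_eq_add_of_le hi
    rw [PS.X_pow_smul_apply_add, PS.mk_apply]

theorem PS.exists_eq_X_smul (c : PS M) (h : c 0 = 0) :
    ∃ r : PS M, c = (PowerSeries.X : PowerSeries k) • r := by
  obtain ⟨r, hr⟩ := PS.exists_eq_X_pow_smul (k := k) c 1 (by
    intro i hi
    rwa [Nat.lt_one_iff.1 hi])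
  exact ⟨r, by rw [hr, pow_one]⟩

/-- Evaluation of a coefficient. -/
def PS.coeffHom (M : Type*) [AddCommGroup M] (n : ℕ) : PS M →+ M where
  toFun c := c n
  map_zero' := rfl
  map_add' _ _ := rfl

theorem PS.sum_apply {ι : Type*} (s : Finset ι) (f : ι → PS M) (n : ℕ) :
    (∑ i ∈ s, f i) n = ∑ i ∈ s, f i n :=
  map_sum (PS.coeffHom M n) f s

theorem PS.isTAdic : IsTAdic k (PS M) where
  hausdorff x hx := by
    funext i
    obtain ⟨r, hr⟩ := hx (i + 1)
    rw [hr, PS.X_pow_smul_apply_of_lt _ (Nat.lt_succ_self i)]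
    rfl
  complete y := by
    refine ⟨PS.mk fun i => (∑ n ∈ Finset.range (i + 1), (PowerSeries.X : PowerSeries k) ^ n • y n) i,
      fun m => ?_⟩
    obtain ⟨r, hr⟩ := PS.exists_eq_X_pow_smul (k := k)
      (PS.mk (fun i => (∑ n ∈ Finset.range (i + 1), (PowerSeries.X : PowerSeries k) ^ n • y n) i) -
        ∑ n ∈ Finset.range m, (PowerSeries.X : PowerSeries k) ^ n • y n) m (by
      intro i hi
      rw [PS.sub_apply, sub_eq_zero, PS.mk_apply, PS.sum_apply, PS.sum_apply]
      refine Finset.sum_subset (Finset.range_subset_range.2 hi) fun n _ hn => ?_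
      rw [Finset.mem_range] at hn
      exact PS.X_pow_smul_apply_of_lt _ (by omega))
    exact ⟨r, eq_add_of_sub_eq' hr⟩
  torsionFree x hx := by
    funext i
    have := congrFun hx (i + 1)
    rwa [PS.X_smul_succ] at this

end PowerSeriesModule

theorem IsTAdic.prod {E F : Type*} [AddCommGroup E] [Module (PowerSeries k) E] [AddCommGroup F]
    [Module (PowerSeries k) F] (hE : IsTAdic k E) (hF : IsTAdic k F) : IsTAdic k (E × F) where
  hausdorff x hx := by
    refine Prod.ext (hE.hausdorff _ fun n => ?_) (hF.hausdorff _ fun n => ?_) <;>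
      obtain ⟨r, hr⟩ := hx n
    · exact ⟨r.1, congrArg Prod.fst hr⟩
    · exact ⟨r.2, congrArg Prod.snd hr⟩
  complete y := by
    obtain ⟨Y, hY⟩ := hE.complete fun n => (y n).1
    obtain ⟨Z, hZ⟩ := hF.complete fun n => (y n).2
    refine ⟨(Y, Z), fun m => ?_⟩
    obtain ⟨r, hr⟩ := hY m
    obtain ⟨r', hr'⟩ := hZ m
    refine ⟨(r, r'), Prod.ext ?_ ?_⟩
    · simpa [Prod.fst_sum] using hr
    · simpa [Prod.snd_sum] using hr'
  torsionFree x hx :=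
    Prod.ext (hE.torsionFree _ (congrArg Prod.fst hx)) (hF.torsionFree _ (congrArg Prod.snd hx))

theorem IsTAdic.pi {ι : Type*} {E : Type*} [AddCommGroup E] [Module (PowerSeries k) E]
    (hE : IsTAdic k E) : IsTAdic k (ι → E) where
  hausdorff x hx := by
    funext i
    refine hE.hausdorff _ fun n => ?_
    obtain ⟨r, hr⟩ := hx n
    exact ⟨r i, congrFun hr i⟩
  complete y := by
    choose Y hY using fun i => hE.complete fun n => y n i
    refine ⟨Y, fun m => ?_⟩
    choose r hr using fun i => hY i m
    refine ⟨r, ?_⟩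
    funext i
    simpa [Finset.sum_apply] using hr i
  torsionFree x hx := by
    funext i
    exact hE.torsionFree _ (congrFun hx i)

theorem PowerSeries.isTAdic : IsTAdic k (PowerSeries k) where
  hausdorff x hx := by
    refine PowerSeries.ext fun i => ?_
    obtain ⟨r, hr⟩ := hx (i + 1)
    rw [hr, smul_eq_mul, PowerSeries.coeff_X_pow_mul', if_neg (by omega), map_zero]
  complete y := by
    refine ⟨PowerSeries.mk fun i => PowerSeries.coeff i
      (∑ n ∈ Finset.range (i + 1), (PowerSeries.X : PowerSeries k) ^ n • y n), fun m => ?_⟩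
    obtain ⟨r, hr⟩ := PowerSeries.X_pow_dvd_iff.2 (show ∀ i < m, PowerSeries.coeff i
      ((PowerSeries.mk fun i => PowerSeries.coeff i
        (∑ n ∈ Finset.range (i + 1), (PowerSeries.X : PowerSeries k) ^ n • y n)) -
        ∑ n ∈ Finset.range m, (PowerSeries.X : PowerSeries k) ^ n • y n) = 0 by
      intro i hi
      rw [map_sub, PowerSeries.coeff_mk, sub_eq_zero, map_sum, map_sum]
      refine Finset.sum_subset (Finset.range_subset_range.2 hi) fun n _ hn => ?_
      rw [Finset.mem_range] at hn
      rw [smul_eq_mul, PowerSeries.coeff_X_pow_mul', if_neg (by omega)])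
    exact ⟨r, eq_add_of_sub_eq' hr⟩
  torsionFree x hx := by
    simpa using hx

variable {E F : Type*} [AddCommGroup E] [Module (PowerSeries k) E] [AddCommGroup F]
  [Module (PowerSeries k) F]

/-- Successive approximation. -/
theorem exists_eq_of_step (hE : IsTAdic k E) (hF : IsTAdic k F) (L : F →ₗ[PowerSeries k] E)
    (S : ℕ → E → Prop)
    (step : ∀ n x, S n x → ∃ y x', S (n + 1) x' ∧ x = L y + (PowerSeries.X : PowerSeries k) • x')
    (x : E) (hx : S 0 x) : ∃ y, x = L y := by
  -- Iterating the step gives remainders `u n` with u n = L(y n (u n)) + t u(n+1). The predicate `S`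
  -- is indexed by the stage because a grade may have to move with each division by t.
  choose! y x' hS h using step
  let u : ℕ → E := fun n => Nat.rec x x' n
  have hu : ∀ n, S n (u n) := fun n => Nat.rec hx (fun n ih => hS n _ ih) n
  have hsum : ∀ m, x = L (∑ n ∈ Finset.range m, (PowerSeries.X : PowerSeries k) ^ n • y n (u n)) +
      (PowerSeries.X : PowerSeries k) ^ m • u m := by
    intro m
    induction m with
    | zero => simp [u]
    | succ m ih =>
      rw [Finset.sum_range_succ, map_add, map_smul, add_assoc, pow_succ, mul_smul, ← smul_add]
      have : u m = L (y m (u m)) + (PowerSeries.X : PowerSeries k) • u (m + 1) := h m _ (hu m)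
      rwa [← this]
  obtain ⟨Y, hY⟩ := hF.complete fun n => y n (u n)
  refine ⟨Y, sub_eq_zero.1 (hE.hausdorff _ fun m => ?_)⟩
  obtain ⟨r, hr⟩ := hY m
  refine ⟨u m - L r, ?_⟩
  nth_rw 1 [hsum m]
  rw [hr, map_add, map_smul, smul_sub]
  abel

theorem sum_smul_homologyClass {R E : Type*} [CommRing R] [AddCommGroup E] [Module R E]
    {D : E →ₗ[R] E} {ι : Type*} [Fintype ι] (b : ι → E) (hb : ∀ i, D (b i) = 0) (f : ι → R)
    (h : D (∑ i, f i • b i) = 0) :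
    ∑ i, f i • homologyClass D (b i) (hb i) = homologyClass D (∑ i, f i • b i) h := by
  simp only [homologyClass, ← Submodule.Quotient.mk_smul]
  simp only [← Submodule.mkQ_apply]
  rw [← map_sum]
  congr 1
  ext
  simp

/-- Cycles of a `t`-adically complete differential module which give a basis of the homology mod
`t` give a basis of the homology. -/
theorem exists_homology_basis (hE : IsTAdic k E) (D : E →ₗ[PowerSeries k] E) (hD : D ∘ₗ D = 0)
    {ι : Type*} [Fintype ι] (b : ι → E) (hb : ∀ i, D (b i) = 0)
    (hspan : ∀ y z, D y = (PowerSeries.X : PowerSeries k) • z → ∃ (a : ι → k) (w y' : E),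
      y = ∑ i, PowerSeries.C (a i) • b i + D w + (PowerSeries.X : PowerSeries k) • y')
    (hind : ∀ (a : ι → k) (w y' : E),
      ∑ i, PowerSeries.C (a i) • b i = D w + (PowerSeries.X : PowerSeries k) • y' → ∀ i, a i = 0) :
    ∃ B : Module.Basis ι (PowerSeries k) (Homology D),
      ∀ i, B i = homologyClass D (b i) (hb i) := by
  have hDD : ∀ x, D (D x) = 0 := fun x => LinearMap.congr_fun hD x
  have hD_sum : ∀ f : ι → PowerSeries k, D (∑ i, f i • b i) = 0 := fun f => by
    simp [hb]
  have hmk : ∀ f : ι → PowerSeries k, ∑ i, f i • homologyClass D (b i) (hb i) =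
      homologyClass D (∑ i, f i • b i) (hD_sum f) := fun f => sum_smul_homologyClass b hb f _
  -- `g f` is f without its constant term, divided by t.
  let g : (ι → PowerSeries k) → ι → PowerSeries k := fun f i =>
    PowerSeries.mk fun p => PowerSeries.coeff (p + 1) (f i)
  have hg : ∀ f : ι → PowerSeries k, ∑ i, f i • b i =
      ∑ i, PowerSeries.C (PowerSeries.coeff 0 (f i)) • b i +
        (PowerSeries.X : PowerSeries k) • ∑ i, g f i • b i := by
    intro f
    rw [Finset.smul_sum, ← Finset.sum_add_distrib]
    refine Finset.sum_congr rfl fun i _ => ?_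
    rw [← mul_smul, ← add_smul]
    congr 1
    conv_lhs => rw [PowerSeries.eq_X_mul_shift_add_const (f i)]
    rw [add_comm]
    simp [g]
  have h0 : ∀ (f : ι → PowerSeries k) y, ∑ i, f i • b i = D y →
      ∀ i, PowerSeries.coeff 0 (f i) = 0 := by
    intro f y h
    refine hind _ y (-∑ i, g f i • b i) ?_
    rw [← h, smul_neg, ← sub_eq_add_neg, eq_sub_iff_add_eq, hg f]
  have hli : ∀ n (f : ι → PowerSeries k) y, ∑ i, f i • b i = D y →
      ∀ i, PowerSeries.coeff n (f i) = 0 := by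
    intro n
    induction n with
    | zero => exact h0
    | succ n ih =>
      intro f y h i
      have hf : D y = (PowerSeries.X : PowerSeries k) • ∑ i, g f i • b i := by
        have := h0 f y h
        rw [← h, hg f]
        simp [this]
      -- Since `y` is a cycle modulo t, spanning modulo t replaces it by t y' without changing D y.
      -- Cancelling t leaves a relation for `g f`, whose n-th coefficients are the (n+1)-st ones of
      -- f.
      obtain ⟨a, w, y', rfl⟩ := hspan y _ hf
      rw [map_add, map_add, hD_sum, hDD, zero_add, zero_add, map_smul, ← sub_eq_zero, ← smul_sub]
        at hf
      have := ih (g f) y' (sub_eq_zero.1 (hE.torsionFree _ hf)).symm i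
      simpa [g] using this
  have hLI : LinearIndependent (PowerSeries k) fun i => homologyClass D (b i) (hb i) := by
    rw [Fintype.linearIndependent_iff]
    intro f hf i
    rw [hmk] at hf
    obtain ⟨z, hz⟩ := (homologyClass_eq_iff _ 0 _ (map_zero D)).1 (hf.trans rfl)
    exact PowerSeries.ext fun n => (hli n f z (by rw [hz, zero_add]) i).trans (map_zero _).symm
  have hSpan : ⊤ ≤ Submodule.span (PowerSeries k)
      (Set.range fun i => homologyClass D (b i) (hb i)) := by
    rintro c -
    obtain ⟨x, hx, rfl⟩ := exists_homologyClass c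
    let L : (ι → PowerSeries k) × E →ₗ[PowerSeries k] E :=
      LinearMap.coprod (Fintype.linearCombination (PowerSeries k) b) D
    have hL : ∀ f y, L (f, y) = ∑ i, f i • b i + D y := fun f y => by
      simp [L, Fintype.linearCombination_apply]
    obtain ⟨⟨f, y⟩, rfl⟩ := exists_eq_of_step hE ((IsTAdic.pi PowerSeries.isTAdic).prod hE) L
      (fun _ x => D x = 0) (by
        intro _ x hx
        obtain ⟨a, w, y', hy⟩ := hspan x 0 (by rw [hx, smul_zero])
        refine ⟨(fun i => PowerSeries.C (a i), w), y', ?_, by rw [hL]; exact hy⟩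
        rw [hy, map_add, map_add, hD_sum, hDD, zero_add, zero_add, map_smul] at hx
        exact hE.torsionFree _ hx) x hx
    have : homologyClass D (L (f, y)) hx = homologyClass D (∑ i, f i • b i) (hD_sum f) :=
      (homologyClass_eq_iff _ _ _ _).2 ⟨y, hL f y⟩
    rw [this, ← hmk]
    exact Submodule.sum_mem _ fun i _ => Submodule.smul_mem _ _ (Submodule.subset_span ⟨i, rfl⟩)
  exact ⟨Module.Basis.mk hLI hSpan, fun i => Module.Basis.mk_apply hLI hSpan i⟩

end TAdic


/-! ### Koszul acyclicity of the differences of shifts. -/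

section Acyclicity

variable {k : Type*} [Field k]

theorem exists_bound (f : ℕ × ℕ × ℕ →₀ k) :
    ∃ W : ℕ, ∀ a b c, W ≤ a + b + c → f (a, b, c) = 0 := by
  refine ⟨f.support.sup (fun p => p.1 + p.2.1 + p.2.2) + 1, fun a b c h => ?_⟩
  by_contra hf
  have := Finset.le_sup (f := fun p : ℕ × ℕ × ℕ => p.1 + p.2.1 + p.2.2)
    (Finsupp.mem_support_iff.2 hf)
  simp only at this
  omega

theorem exists_finsupp (F : ℕ → ℕ → ℕ → k) (W : ℕ) (h : ∀ a b c, W ≤ a + b + c → F a b c = 0) :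
    ∃ f : ℕ × ℕ × ℕ →₀ k, ∀ a b c, f (a, b, c) = F a b c := by
  refine ⟨Finsupp.onFinset (Finset.range W ×ˢ Finset.range W ×ˢ Finset.range W)
    (fun p => F p.1 p.2.1 p.2.2) ?_, fun a b c => rfl⟩
  rintro ⟨a, b, c⟩ hF
  simp only [Finset.mem_product, Finset.mem_range]
  by_contra hn
  exact hF (h a b c (by omega))

/-- `S₁ - S₃` is surjective, where `Sᵢ` lowers the length of the `i`-th block. -/
theorem exists_shift_sub_shift (f : ℕ × ℕ × ℕ →₀ k) :
    ∃ g : ℕ × ℕ × ℕ →₀ k, ∀ a b c, g (a + 1, b, c) - g (a, b, c + 1) = f (a, b, c) := by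
  obtain ⟨W, hW⟩ := exists_bound f
  -- The solution of g(a+1, b, c) = g(a, b, c+1) + f(a, b, c) with g(0, b, c) = 0. Each summand has
  -- total length one less than the argument of g, so g has finite support.
  obtain ⟨g, hg⟩ := exists_finsupp (fun a b c => ∑ i ∈ Finset.range a, f (a - 1 - i, b, c + i))
    (W + 1) (by
      intro a b c h
      refine Finset.sum_eq_zero fun i hi => hW _ _ _ ?_
      rw [Finset.mem_range] at hi
      omega)
  refine ⟨g, fun a b c => ?_⟩
  rw [hg, hg, Finset.sum_range_succ']
  have : ∀ i ∈ Finset.range a, f (a + 1 - 1 - (i + 1), b, c + (i + 1)) =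
      f (a - 1 - i, b, c + 1 + i) := by
    intro i _
    rw [show a + 1 - 1 - (i + 1) = a - 1 - i by omega, show c + (i + 1) = c + 1 + i by omega]
  rw [Finset.sum_congr rfl this]
  simp

theorem eq_of_shift_eq_shift {f : ℕ × ℕ × ℕ →₀ k}
    (hf : ∀ a b c, f (a + 1, b, c) = f (a, b, c + 1)) (a b c : ℕ) : f (a, b, c) = f (0, b, a + c) := by
  induction a generalizing c with
  | zero => rw [zero_add]
  | succ a ih => rw [hf, ih, add_right_comm, add_assoc]

/-- `S₂ - S₁` is surjective on the kernel of `S₁ - S₃`. -/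
theorem exists_shift_sub_shift_of_eq (f : ℕ × ℕ × ℕ →₀ k)
    (hf : ∀ a b c, f (a + 1, b, c) = f (a, b, c + 1)) :
    ∃ g : ℕ × ℕ × ℕ →₀ k, (∀ a b c, g (a + 1, b, c) = g (a, b, c + 1)) ∧
      ∀ a b c, g (a, b + 1, c) - g (a + 1, b, c) = f (a, b, c) := by
  obtain ⟨W, hW⟩ := exists_bound f
  -- Now f depends only on b and a + c. The same recursion is solved in b, and the solution again
  -- depends only on b and a + c.
  obtain ⟨g, hg⟩ := exists_finsupp
    (fun a b c => ∑ i ∈ Finset.range b, f (0, b - 1 - i, a + c + i)) (W + 1) (by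
      intro a b c h
      refine Finset.sum_eq_zero fun i hi => hW _ _ _ ?_
      rw [Finset.mem_range] at hi
      omega)
  refine ⟨g, fun a b c => ?_, fun a b c => ?_⟩
  · rw [hg, hg, add_right_comm, add_assoc]
  · rw [hg, hg, Finset.sum_range_succ', eq_of_shift_eq_shift hf a b c]
    have : ∀ i ∈ Finset.range b, f (0, b + 1 - 1 - (i + 1), a + c + (i + 1)) =
        f (0, b - 1 - i, a + 1 + c + i) := by
      intro i _
      congr 3 <;> omega
    rw [Finset.sum_congr rfl this]
    simp

theorem eq_of_shift_eq_shift' {f : ℕ × ℕ × ℕ →₀ k}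
    (hf : ∀ a b c, f (a + 1, b, c) = f (a, b, c + 1))
    (hf' : ∀ a b c, f (a, b + 1, c) = f (a + 1, b, c)) (a b c : ℕ) :
    f (a, b, c) = f (0, 0, a + b + c) := by
  induction b generalizing a with
  | zero => exact eq_of_shift_eq_shift hf a 0 c
  | succ b ih => rw [hf', ih]; congr 3; omega

/-- The inclusion of the chains with the given distinguished entries. -/
noncomputable def emb (x y z : Gen) (f : ℕ × ℕ × ℕ →₀ k) : Chain k :=
  f.mapDomain fun p => ⟨x, p.1, y, p.2.1, z, p.2.2⟩

theorem emb_apply (x y z : Gen) (f : ℕ × ℕ × ℕ →₀ k) (x' : Gen) (a : ℕ) (y' : Gen) (b : ℕ)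
    (z' : Gen) (c : ℕ) :
    emb x y z f ⟨x', a, y', b, z', c⟩ = if x = x' ∧ y = y' ∧ z = z' then f (a, b, c) else 0 := by
  split_ifs with h
  · obtain ⟨rfl, rfl, rfl⟩ := h
    refine Finsupp.mapDomain_apply (f := fun p : ℕ × ℕ × ℕ => (⟨x, p.1, y, p.2.1, z, p.2.2⟩ : Word ℕ))
      ?_ f (a, b, c)
    rintro ⟨a, b, c⟩ ⟨a', b', c'⟩ h
    simpa using h
  · refine Finsupp.mapDomain_of_notMem_range _ _ ?_
    rintro ⟨p, hp⟩
    simp only [Word.mk.injEq] at hp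
    tauto

/-- The part of a chain with the given distinguished entries. -/
noncomputable def comp (u : Chain k) (x y z : Gen) : ℕ × ℕ × ℕ →₀ k :=
  u.comapDomain (fun p => ⟨x, p.1, y, p.2.1, z, p.2.2⟩) (by
    rintro ⟨a, b, c⟩ _ ⟨a', b', c'⟩ _ h
    simpa using h)

theorem comp_apply (u : Chain k) (x y z : Gen) (a b c : ℕ) :
    comp u x y z (a, b, c) = u ⟨x, a, y, b, z, c⟩ := rfl

theorem dX_dX (N : ℕ) (u : Chain k) : dX k N (dX k N u) = 0 :=
  LinearMap.congr_fun (dX_mul_dX N) u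

theorem dX_sub_dX (N : ℕ) (u v : Chain k) : dX k N (u - dX k N v) = dX k N u := by
  rw [map_sub, dX_dX, sub_zero]

/-- A chain is concentrated in `1|⋯|1|⋯|1|⋯` and `1|⋯|1|⋯|∂|⋯`, where its coefficients depend only
on the total length. -/
structure IsSymmetric (u : Chain k) : Prop where
  x_del (a y b z c) : u ⟨.del, a, y, b, z, c⟩ = 0
  y_del (x a b z c) : u ⟨x, a, .del, b, z, c⟩ = 0
  eq (z a b c) : u ⟨.one, a, .one, b, z, c⟩ = u ⟨.one, 0, .one, 0, z, a + b + c⟩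

/-- The components are removed in decreasing number of ∂-entries: those with x = ∂ by surjectivity
of S₁ - S₃, then those with x = 1, y = ∂ by surjectivity of S₂ - S₁ on its kernel. What is left lies
in both kernels. The hypotheses are weaker than being a cycle, so that primitives of 1|1|∂-chains
are covered as well. -/
theorem exists_isSymmetric (N : ℕ) (u : Chain k)
    (hu_x : ∀ a y b z c, dX k N u ⟨.del, a, y, b, z, c⟩ = 0)
    (hu_y : ∀ x a b z c, dX k N u ⟨x, a, .del, b, z, c⟩ = 0) :
    ∃ v, IsSymmetric (u - dX k N v) := by
  -- remove `∂|⋯|∂|⋯|∂|⋯`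
  obtain ⟨v₁, h₁⟩ : ∃ v, ∀ a b c, (u - dX k N v) ⟨.del, a, .del, b, .del, c⟩ = 0 := by
    obtain ⟨g, hg⟩ := exists_shift_sub_shift (comp u .del .del .del)
    refine ⟨emb .one .del .del g, fun a b c => ?_⟩
    have := hg a b c
    rw [comp_apply] at this
    simp [dX_apply, localDiff, emb_apply, Gen.sign, Gen.deg, this]
  obtain ⟨u₁, hu₁⟩ : ∃ u₁, u₁ = u - dX k N v₁ := ⟨_, rfl⟩
  rw [← hu₁] at h₁
  have hd₁ : dX k N u₁ = dX k N u := by rw [hu₁, dX_sub_dX]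
  -- remove the parts with two entries `∂`
  obtain ⟨v₂, h₂, h₂'⟩ : ∃ v, (∀ a b c, (u₁ - dX k N v) ⟨.del, a, .del, b, .del, c⟩ = 0) ∧
      (∀ a b c, (u₁ - dX k N v) ⟨.del, a, .one, b, .del, c⟩ = 0) ∧
      ∀ a b c, (u₁ - dX k N v) ⟨.del, a, .del, b, .one, c⟩ = 0 := by
    obtain ⟨g, hg⟩ := exists_shift_sub_shift (comp u₁ .del .one .del)
    obtain ⟨g', hg'⟩ := exists_shift_sub_shift (comp u₁ .del .del .one)
    refine ⟨-(emb .one .one .del g + emb .one .del .one g'), fun a b c => ?_, fun a b c => ?_,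
      fun a b c => ?_⟩
    · simp [dX_apply, localDiff, emb_apply, Gen.sign, Gen.deg, h₁]
    · have := hg a b c
      rw [comp_apply] at this
      simp [dX_apply, localDiff, emb_apply, Gen.sign, Gen.deg, ← this]
    · have := hg' a b c
      rw [comp_apply] at this
      simp [dX_apply, localDiff, emb_apply, Gen.sign, Gen.deg, ← this]
  obtain ⟨u₂, hu₂⟩ : ∃ u₂, u₂ = u₁ - dX k N v₂ := ⟨_, rfl⟩
  rw [← hu₂] at h₂ h₂'
  have hd₂ : dX k N u₂ = dX k N u := by rw [hu₂, dX_sub_dX, hd₁]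
  obtain ⟨v₃, h₃⟩ : ∃ v, ∀ x a y b z c, x = .del ∧ y = .del ∨ x = .del ∧ z = .del ∨
      y = .del ∧ z = .del → (u₂ - dX k N v) ⟨x, a, y, b, z, c⟩ = 0 := by
    -- With all other two-∂ components gone, the ∂|∂|∂-part of the differential says that this
    -- component is in the kernel of S₁ - S₃. Taking g in the same kernel keeps the components
    -- already removed at zero.
    obtain ⟨g, hg, hg'⟩ := exists_shift_sub_shift_of_eq (comp u₂ .one .del .del) (by
      intro a b c
      have := hu_x a .del b .del c
      rw [← hd₂] at this
      simp [dX_apply, localDiff, Gen.sign, Gen.deg, h₂'] at this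
      rw [comp_apply, comp_apply, sub_eq_zero.1 this])
    refine ⟨-emb .one .one .del g, fun x a y b z c h => ?_⟩
    have := hg' a b c
    rw [comp_apply] at this
    have h' := hg a b c
    rcases x <;> rcases y <;> rcases z <;> simp at h <;>
      simp [dX_apply, localDiff, emb_apply, Gen.sign, Gen.deg, h₂, h₂', h', ← this]
  obtain ⟨u₃, hu₃⟩ : ∃ u₃, u₃ = u₂ - dX k N v₃ := ⟨_, rfl⟩
  rw [← hu₃] at h₃
  have hd₃ : dX k N u₃ = dX k N u := by rw [hu₃, dX_sub_dX, hd₂]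
  -- remove two of the parts with one entry `∂`
  obtain ⟨v₄, h₄, h₄'⟩ : ∃ v, (∀ x a y b z c, x = .del ∧ y = .del ∨ x = .del ∧ z = .del ∨
      y = .del ∧ z = .del → (u₃ - dX k N v) ⟨x, a, y, b, z, c⟩ = 0) ∧
      ∀ a b c, (u₃ - dX k N v) ⟨.del, a, .one, b, .one, c⟩ = 0 := by
    obtain ⟨g, hg⟩ := exists_shift_sub_shift (comp u₃ .del .one .one)
    refine ⟨emb .one .one .one g, fun x a y b z c h => ?_, fun a b c => ?_⟩
    · rcases x <;> rcases y <;> rcases z <;> simp at h <;>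
        simp [dX_apply, localDiff, emb_apply, Gen.sign, Gen.deg, h₃]
    · have := hg a b c
      rw [comp_apply] at this
      simp [dX_apply, localDiff, emb_apply, Gen.sign, Gen.deg, ← this]
  obtain ⟨u₄, hu₄⟩ : ∃ u₄, u₄ = u₃ - dX k N v₄ := ⟨_, rfl⟩
  rw [← hu₄] at h₄ h₄'
  have hd₄ : dX k N u₄ = dX k N u := by rw [hu₄, dX_sub_dX, hd₃]
  obtain ⟨v₅, h₅, h₅'⟩ : ∃ v, (∀ a y b z c, (u₄ - dX k N v) ⟨.del, a, y, b, z, c⟩ = 0) ∧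
      (∀ x a b z c, (u₄ - dX k N v) ⟨x, a, .del, b, z, c⟩ = 0) := by
    obtain ⟨g, hg, hg'⟩ := exists_shift_sub_shift_of_eq (comp u₄ .one .del .one) (by
      intro a b c
      have := hu_x a .del b .one c
      rw [← hd₄] at this
      simp [dX_apply, localDiff, Gen.sign, Gen.deg, h₄, h₄'] at this
      rw [comp_apply, comp_apply]
      linear_combination -this)
    refine ⟨emb .one .one .one g, fun a y b z c => ?_, fun x a b z c => ?_⟩
    · have := hg a b c
      rcases y <;> rcases z <;>
        simp [dX_apply, localDiff, emb_apply, Gen.sign, Gen.deg, h₄, h₄', this]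
    · have := hg' a b c
      rw [comp_apply] at this
      have h' := hg a b c
      rcases x <;> rcases z <;>
        simp [dX_apply, localDiff, emb_apply, Gen.sign, Gen.deg, h₄, h', ← this]
  obtain ⟨u₅, hu₅⟩ : ∃ u₅, u₅ = u₄ - dX k N v₅ := ⟨_, rfl⟩
  rw [← hu₅] at h₅ h₅'
  have hd₅ : dX k N u₅ = dX k N u := by rw [hu₅, dX_sub_dX, hd₄]
  refine ⟨v₁ + v₂ + v₃ + v₄ + v₅, ?_⟩
  have : u - dX k N (v₁ + v₂ + v₃ + v₄ + v₅) = u₅ := by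
    rw [hu₅, hu₄, hu₃, hu₂, hu₁]
    simp only [map_add]
    abel
  rw [this]
  refine ⟨h₅, h₅', fun z a b c => ?_⟩
  -- The vanishing of the differential at x = ∂ and at y = ∂ puts both remaining components in the
  -- kernels of S₁ - S₃ and S₂ - S₁.
  refine eq_of_shift_eq_shift' (f := comp u₅ .one .one z) (fun a b c => ?_) (fun a b c => ?_) a b c
  · have := hu_x a .one b z c
    rw [← hd₅] at this
    cases z <;> simp [dX_apply, localDiff, Gen.sign, Gen.deg, h₅] at this <;>
      rw [comp_apply, comp_apply] <;>
        first | linear_combination this | linear_combination -this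
  · have := hu_y .one a b z c
    rw [← hd₅] at this
    cases z <;> simp [dX_apply, localDiff, Gen.sign, Gen.deg, h₅, h₅'] at this <;>
      rw [comp_apply, comp_apply] <;>
        first | linear_combination this | linear_combination -this

end Acyclicity


/-! ### Boundaries from vanishing homology in the relevant degrees. -/

section GradedAcyclicity

variable {k : Type*} [Field k] {M : Type*} [AddCommGroup M] [Module k M] {d τ s : Module.End k M}

theorem PS.monomial_apply (n : ℕ) (m : M) (i : ℕ) :
    PS.monomial n m i = if i = n then m else 0 := rfl

theorem fixDiff_fst_zero (x : PS M × PS M) : (fixDiff d τ s x).1 0 = d (x.1 0) := by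
  obtain ⟨c₀, c₁⟩ := x
  rw [fixDiff_mk]
  simp [PS.add_apply, PS.X_smul_zero, PS.map_apply]

theorem fixDiff_fst_succ (x : PS M × PS M) (n : ℕ) :
    (fixDiff d τ s x).1 (n + 1) = d (x.1 (n + 1)) + ((1 + τ + τ ^ 2) * s : Module.End k M) (x.2 n) := by
  obtain ⟨c₀, c₁⟩ := x
  rw [fixDiff_mk]
  simp only [PS.add_apply, PS.X_smul_succ, PS.map_apply]

theorem fixDiff_snd (x : PS M × PS M) (n : ℕ) :
    (fixDiff d τ s x).2 n = ((τ - 1) * s) (x.1 n) + d (x.2 n) := rfl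

theorem exists_eq_X_smul_prod (x : PS M × PS M) (h₁ : x.1 0 = 0) (h₂ : x.2 0 = 0) :
    ∃ r : PS M × PS M, x = (PowerSeries.X : PowerSeries k) • r := by
  obtain ⟨r, hr⟩ := PS.exists_eq_X_smul (k := k) x.1 h₁
  obtain ⟨r', hr'⟩ := PS.exists_eq_X_smul (k := k) x.2 h₂
  exact ⟨(r, r'), Prod.ext hr hr'⟩

theorem prod_X_smul_fst_succ (x : PS M × PS M) (n : ℕ) :
    ((PowerSeries.X : PowerSeries k) • x).1 (n + 1) = x.1 n := PS.X_smul_succ x.1 n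

theorem prod_X_smul_snd_succ (x : PS M × PS M) (n : ℕ) :
    ((PowerSeries.X : PowerSeries k) • x).2 (n + 1) = x.2 n := PS.X_smul_succ x.2 n

theorem prod_isTAdic : IsTAdic k (PS M × PS M) := PS.isTAdic.prod PS.isTAdic

/-- A homogeneous cycle which starts with `θ` is a boundary, if there is no homology in the
degrees of its coefficients. Here `V p` are the graded pieces of degree `p`, for the grading in
which `θ` has degree `1` and `t` has degree `2`. -/
theorem mem_range_fixDiff (hdτ : d * τ = τ * d) (hds : d * s = -(s * d))
    (hD : fixDiff d τ s ∘ₗ fixDiff d τ s = 0) (V : ℕ → Submodule k M)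
    (hVτ : ∀ p, ∀ u ∈ V p, τ u ∈ V p) (hVs : ∀ p, ∀ u ∈ V p, s u ∈ V p)
    (hV : ∀ p, 1 ≤ p → ∀ u ∈ V p, d u = 0 → ∃ v ∈ V (p + 1), u = d v)
    (x : PS M × PS M) (hx : fixDiff d τ s x = 0) (hx0 : x.1 0 = 0)
    (hx₁ : ∀ l, x.1 l ∈ V (2 * l)) (hx₂ : ∀ l, x.2 l ∈ V (2 * l + 1)) :
    ∃ y, x = fixDiff d τ s y := by
  have hE : IsTAdic k (PS M × PS M) := prod_isTAdic
  refine exists_eq_of_step hE hE (fixDiff d τ s) (fun n x => fixDiff d τ s x = 0 ∧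
    (n = 0 → x.1 0 = 0) ∧ (∀ l, x.1 l ∈ V (2 * (l + n))) ∧ ∀ l, x.2 l ∈ V (2 * (l + n) + 1)) ?_ x
    ⟨hx, fun _ => hx0, hx₁, hx₂⟩
  intro n x ⟨hx, hx0, hx₁, hx₂⟩
  -- `V 0` may carry homology, but at the initial stage the leading coefficient is zero by
  -- assumption; later stages only meet degrees ≥ 1.
  obtain ⟨w₀, hw₀, hw₀'⟩ : ∃ w ∈ V (2 * n + 1), x.1 0 = d w := by
    rcases Nat.eq_zero_or_pos n with h | h
    · exact ⟨0, Submodule.zero_mem _, by rw [hx0 h, map_zero]⟩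
    · refine hV (2 * n) (by omega) _ (by simpa using hx₁ 0) ?_
      rw [← fixDiff_fst_zero (τ := τ) (s := s), hx]
      rfl
  have hτ1 : ((τ - 1) * s) w₀ ∈ V (2 * n + 1) := by
    rw [Module.End.mul_apply, LinearMap.sub_apply, Module.End.one_apply]
    exact Submodule.sub_mem _ (hVτ _ _ (hVs _ _ hw₀)) (hVs _ _ hw₀)
  -- After subtracting the differential of w₀, the θ-coefficient is a cycle in X-degree 2n + 1.
  -- Removing it too leaves t times a cycle whose degrees have grown by 2, the degree of t.
  obtain ⟨w₁, hw₁, hw₁'⟩ : ∃ w ∈ V (2 * n + 1 + 1), x.2 0 - ((τ - 1) * s) w₀ = d w := by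
    refine hV (2 * n + 1) (by omega) _ (Submodule.sub_mem _ (by simpa using hx₂ 0) hτ1) ?_
    have h1 := congrArg (fun y : PS M × PS M => y.2 0) hx
    simp only [fixDiff_snd, hw₀'] at h1
    have h2 := LinearMap.congr_fun
      (mul_mul_add_mul_mul_eq_zero (commute_sub_one hdτ) hds) w₀
    rw [LinearMap.add_apply, Module.End.mul_apply d, Module.End.mul_apply _ d] at h2
    have h3 : ((τ - 1) * s) (d w₀) + d (x.2 0) = 0 := h1
    rw [map_sub, eq_neg_of_add_eq_zero_right h3, eq_neg_of_add_eq_zero_left h2]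
    simp
  obtain ⟨x', hx'⟩ := exists_eq_X_smul_prod (k := k)
    (x - fixDiff d τ s (PS.monomial 0 w₀, PS.monomial 0 w₁)) (by
      rw [Prod.fst_sub, PS.sub_apply, fixDiff_fst_zero]
      dsimp only
      rw [PS.monomial_apply, if_pos rfl, hw₀', sub_self]) (by
      rw [Prod.snd_sub, PS.sub_apply, fixDiff_snd]
      dsimp only
      rw [PS.monomial_apply, if_pos rfl,
        PS.monomial_apply, if_pos rfl, ← hw₁']
      abel)
  refine ⟨(PS.monomial 0 w₀, PS.monomial 0 w₁), x', ⟨?_, by simp, fun l => ?_, fun l => ?_⟩,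
    eq_add_of_sub_eq' hx'⟩
  · refine hE.torsionFree _ ?_
    rw [← map_smul, ← hx', map_sub, hx, zero_sub, neg_eq_zero]
    exact LinearMap.congr_fun hD _
  · rw [← prod_X_smul_fst_succ (k := k), ← hx', Prod.fst_sub, PS.sub_apply, fixDiff_fst_succ]
    refine Submodule.sub_mem _ (by convert hx₁ (l + 1) using 2; ring) ?_
    simp only [PS.monomial_apply]
    rw [if_neg (Nat.succ_ne_zero l), map_zero, zero_add]
    split_ifs with h
    · subst h
      rw [Module.End.mul_apply]
      have := hVs _ _ hw₁
      rw [show 2 * (0 + (n + 1)) = 2 * n + 1 + 1 by ring]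
      refine Submodule.add_mem _ (Submodule.add_mem _ this (hVτ _ _ this)) ?_
      rw [pow_two]
      exact hVτ _ _ (hVτ _ _ this)
    · rw [map_zero]; exact Submodule.zero_mem _
  · rw [← prod_X_smul_snd_succ (k := k), ← hx', Prod.snd_sub, PS.sub_apply, fixDiff_snd]
    refine Submodule.sub_mem _ (by convert hx₂ (l + 1) using 2; ring) ?_
    simp only [PS.monomial_apply]
    rw [if_neg (Nat.succ_ne_zero l), if_neg (Nat.succ_ne_zero l), map_zero, map_zero, zero_add]
    exact Submodule.zero_mem _

end GradedAcyclicity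

/-! ### Homology of the non-equivariant complex. -/

section HomologyX

variable {k : Type*} [Field k]

/-- The chain `∑_{a + b + c = q} F(a, b, c) x|∂^a|y|∂^b|z|∂^c`. -/
noncomputable def homChain (x y z : Gen) (q : ℕ) (F : ℕ → ℕ → ℕ → k) : Chain k :=
  ∑ κ ∈ Finset.Nat.antidiagonalTuple 3 q,
    Finsupp.single ⟨x, κ 0, y, κ 1, z, κ 2⟩ (F (κ 0) (κ 1) (κ 2))

theorem homChain_apply (x y z : Gen) (q : ℕ) (F : ℕ → ℕ → ℕ → k) (x' : Gen) (a : ℕ) (y' : Gen)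
    (b : ℕ) (z' : Gen) (c : ℕ) :
    homChain x y z q F ⟨x', a, y', b, z', c⟩ =
      if x = x' ∧ y = y' ∧ z = z' ∧ a + b + c = q then F a b c else 0 := by
  classical
  rw [homChain, Finsupp.finsetSum_apply]
  split_ifs with h
  · obtain ⟨rfl, rfl, rfl, rfl⟩ := h
    rw [Finset.sum_eq_single ![a, b, c]]
    · simp
    · intro κ _ hκ
      rw [Finsupp.single_apply, if_neg]
      intro h
      simp only [Word.mk.injEq, true_and] at h
      apply hκ
      funext i
      fin_cases i
      · exact h.1
      · exact h.2.1
      · exact h.2.2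
    · intro h
      exfalso
      apply h
      rw [Finset.Nat.mem_antidiagonalTuple, Fin.sum_univ_three]
      rfl
  · refine Finset.sum_eq_zero fun κ hκ => ?_
    rw [Finset.Nat.mem_antidiagonalTuple, Fin.sum_univ_three] at hκ
    rw [Finsupp.single_apply, if_neg]
    intro h'
    simp only [Word.mk.injEq] at h'
    apply h
    refine ⟨h'.1, h'.2.2.1, h'.2.2.2.2.1, ?_⟩
    rw [← h'.2.1, ← h'.2.2.2.1, ← h'.2.2.2.2.2, hκ]

theorem blockSum_apply (x y z : Gen) (q : ℕ) (x' : Gen) (a : ℕ) (y' : Gen)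
    (b : ℕ) (z' : Gen) (c : ℕ) :
    blockSum k x y z q ⟨x', a, y', b, z', c⟩ =
      if x = x' ∧ y = y' ∧ z = z' ∧ a + b + c = q then 1 else 0 :=
  homChain_apply x y z q (fun _ _ _ => 1) x' a y' b z' c

/-- On symmetric chains the differential is -N S^(N-1) from the 1|1|∂-part to the 1|1|1-part, with S
the shift of the total length. It is surjective, and its kernel consists of the lengths below N - 1.
-/
theorem exists_eq_sum_blockSum (N : ℕ) (hN : (N : k) ≠ 0) (u : Chain k) (hu : dX k N u = 0) :
    ∃ (a : Fin (N - 1) → k) (v : Chain k),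
      u = ∑ j, a j • blockSum k .one .one .del j + dX k N v := by
  obtain ⟨v, hv⟩ := exists_isSymmetric N u (by simp [hu]) (by simp [hu])
  obtain ⟨u', hu'⟩ : ∃ u', u' = u - dX k N v := ⟨_, rfl⟩
  rw [← hu'] at hv
  have hd : dX k N u' = 0 := by rw [hu', dX_sub_dX, hu]
  have hpos : 1 ≤ N := Nat.one_le_iff_ne_zero.2 fun h => hN (by simp [h])
  have hsum : ∀ (F : ℕ → k) (a b c : ℕ), ∑ i ∈ Finset.range N, F (a + (b + i) + (c + (N - 1 - i))) =
      N * F (a + b + c + (N - 1)) := by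
    intro F a b c
    rw [Finset.sum_congr rfl (g := fun _ => F (a + b + c + (N - 1)))]
    · simp
    · intro i hi
      rw [Finset.mem_range] at hi
      congr 1
      omega
  have hvan : ∀ n, N - 1 ≤ n → u' ⟨.one, 0, .one, 0, .del, n⟩ = 0 := by
    intro n hn
    have := congrArg (fun u : Chain k => u ⟨.one, 0, .one, 0, .one, n - (N - 1)⟩) hd
    simp only [dX_apply, localDiff, hv.x_del, hv.y_del] at this
    rw [Finset.sum_congr rfl fun i _ => hv.eq .del 0 (0 + i) (n - (N - 1) + (N - 1 - i)),
      hsum fun m => u' ⟨.one, 0, .one, 0, .del, m⟩] at this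
    rw [show 0 + 0 + (n - (N - 1)) + (N - 1) = n by omega] at this
    simpa [hN] using this
  obtain ⟨W, hW⟩ := exists_bound (comp u' .one .one .one)
  -- The symmetric 1|1|∂-chain whose image under -N S^(N-1) is the 1|1|1-part of `u'`.
  obtain ⟨g, hg⟩ := exists_finsupp (fun a b c => if N - 1 ≤ a + b + c then
    -(N : k)⁻¹ * u' ⟨.one, 0, .one, 0, .one, a + b + c - (N - 1)⟩ else 0) (W + (N - 1)) (by
      intro a b c h
      rw [if_pos (by omega), ← comp_apply, hW _ _ _ (by omega), mul_zero])
  refine ⟨fun j => u' ⟨.one, 0, .one, 0, .del, j⟩, v + emb .one .one .del g, ?_⟩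
  rw [map_add, add_left_comm, ← sub_eq_iff_eq_add', ← hu']
  ext w
  obtain ⟨x, a, y, b, z, c⟩ := w
  rw [Finsupp.add_apply, Finsupp.finsetSum_apply]
  simp only [Finsupp.smul_apply, blockSum_apply, smul_eq_mul]
  cases x
  swap
  · rw [hv.x_del]
    cases y <;> cases z <;> simp [dX_apply, localDiff, emb_apply, hg]
    right
    rw [show a + 1 + b + c = a + b + (c + 1) by ring, sub_self]
  cases y
  swap
  · rw [hv.y_del]
    cases z <;> simp [dX_apply, localDiff, emb_apply, hg]
    right
    rw [show a + (b + 1) + c = a + 1 + b + c by ring, sub_self]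
  rw [hv.eq]
  cases z
  · simp [dX_apply, localDiff, emb_apply]
    simp only [hg]
    rw [hsum (fun m => if N - 1 ≤ m then
      -(N : k)⁻¹ * u' ⟨.one, 0, .one, 0, .one, m - (N - 1)⟩ else 0) a b c,
      if_pos (Nat.le_add_left _ _), Nat.add_sub_cancel]
    field_simp
  · simp [dX_apply, localDiff, emb_apply]
    by_cases h : a + b + c < N - 1
    · rw [Finset.sum_eq_single ⟨_, h⟩]
      · simp
      · intro j _ hj
        rw [if_neg]
        rintro h'
        exact hj (Fin.ext h'.symm)
      · simp
    · rw [hvan _ (not_lt.1 h), Finset.sum_eq_zero]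
      intro j _
      rw [if_neg (by omega)]

/-- A primitive can be made symmetric without changing its differential. The 1|1|∂-part of that
differential is then S₃ - S₂ applied to a function of the total length, which is zero. -/
theorem sum_blockSum_ne_dX (N : ℕ) (a : Fin (N - 1) → k) (v : Chain k)
    (h : ∑ j, a j • blockSum k .one .one .del j = dX k N v) (j : Fin (N - 1)) : a j = 0 := by
  have hval : ∀ x a' y b z c, dX k N v ⟨x, a', y, b, z, c⟩ =
      ∑ j, a j * if .one = x ∧ .one = y ∧ .del = z ∧ a' + b + c = j then 1 else 0 := by
    intro x a' y b z c
    rw [← h, Finsupp.finsetSum_apply]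
    simp only [Finsupp.smul_apply, blockSum_apply, smul_eq_mul]
  obtain ⟨v', hv'⟩ := exists_isSymmetric N v (by simp [hval]) (by simp [hval])
  have := hval .one 0 .one 0 .del j
  rw [← dX_sub_dX N v v'] at this
  simp only [dX_apply, localDiff, hv'.x_del, hv'.y_del] at this
  rw [hv'.eq .one 0 (0 + 1) j, hv'.eq .one 0 0 (j + 1)] at this
  simpa [Fin.val_inj, add_comm] using this.symm

end HomologyX


/-! ### A grading for which the differential is homogeneous. -/

section Grading

variable {k : Type*} [Field k]

/-- The contribution of a distinguished entry to the grade. -/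
def Gen.grade (N : ℕ) : Gen → ℤ × ZMod 2
  | one => 0
  | del => (2 - N, 1)

/-- A grading, with values in `ℤ × ℤ/2`, for which the differential is homogeneous. -/
def Word.grade (N : ℕ) (w : Word ℕ) : ℤ × ZMod 2 :=
  w.x₁.grade N + w.x₂.grade N + w.x₃.grade N + (2 * ((w.l₁ + w.l₂ + w.l₃ : ℕ) : ℤ), 0)

/-- Both parts of the differential lower the grade by (N, 1): absorbing one ∂ into a unit changes 2
to 2 - N, and m_N changes (2 - N) + 2(N - 1) = N to 0. -/
theorem localDiff_ite_grade (N : ℕ) (hN : 1 ≤ N) (f : Gen → ℕ → ℕ → k) (m : ℤ × ZMod 2)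
    (x : Gen) (p q : ℕ) :
    localDiff N (fun g p q => if g.grade N + (2 * ((p + q : ℕ) : ℤ), 0) = m then f g p q else 0)
      x p q =
    if x.grade N + (2 * ((p + q : ℕ) : ℤ), 0) + ((N : ℤ), 1) = m then localDiff N f x p q else 0 := by
  cases x
  · have h : ∀ i ∈ Finset.range N, (Gen.grade N .del +
        (2 * (((p + i) + (q + (N - 1 - i)) : ℕ) : ℤ), 0)) =
        (Gen.grade N .one + (2 * ((p + q : ℕ) : ℤ), 0) + ((N : ℤ), 1)) := by
      intro i hi
      rw [Finset.mem_range] at hi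
      rw [show (p + i) + (q + (N - 1 - i)) = p + q + (N - 1) by omega]
      refine Prod.ext ?_ ?_
      · simp [Gen.grade, Nat.cast_sub hN]
        ring
      · simp [Gen.grade]
    simp only [localDiff]
    rw [Finset.sum_congr rfl (g := fun i => if
      Gen.grade N .one + (2 * ((p + q : ℕ) : ℤ), 0) + ((N : ℤ), 1) = m then
        f .del (p + i) (q + (N - 1 - i)) else 0) fun i hi => by rw [h i hi]]
    split_ifs <;> simp
  · have h1 : Gen.grade N .one + (2 * ((p + (q + 1) : ℕ) : ℤ), 0) =
        Gen.grade N .del + (2 * ((p + q : ℕ) : ℤ), 0) + ((N : ℤ), 1) := by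
      refine Prod.ext ?_ ?_
      · simp [Gen.grade]
        ring
      · change (0 + 0 : ZMod 2) = 1 + 0 + 1
        decide
    have h2 : Gen.grade N .one + (2 * ((p + 1 + q : ℕ) : ℤ), 0) =
        Gen.grade N .del + (2 * ((p + q : ℕ) : ℤ), 0) + ((N : ℤ), 1) := by
      rw [← h1]
      congr 4
      ring
    simp only [localDiff, h1, h2]
    split_ifs <;> simp

theorem Word.grade_mk (N : ℕ) (x : Gen) (a : ℕ) (y : Gen) (b : ℕ) (z : Gen) (c : ℕ) :
    (⟨x, a, y, b, z, c⟩ : Word ℕ).grade N =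
      x.grade N + y.grade N + z.grade N + (2 * ((a + b + c : ℕ) : ℤ), 0) := rfl

/-- Used to replace a primitive of a homogeneous chain by its homogeneous part. -/
theorem dX_filter_grade (N : ℕ) (hN : 1 ≤ N) (m : ℤ × ZMod 2) (u : Chain k) :
    dX k N (u.filter fun w => w.grade N = m + ((N : ℤ), 1)) =
      (dX k N u).filter fun w => w.grade N = m := by
  have key : ∀ (f : Gen → ℕ → ℕ → k) (h : Gen → ℕ → ℕ → ℤ × ZMod 2) (r : ℤ × ZMod 2)
      (_ : ∀ g p q, h g p q = g.grade N + (2 * ((p + q : ℕ) : ℤ), 0) + r) (x : Gen) (p q : ℕ),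
      localDiff N (fun g p q => if h g p q = m + ((N : ℤ), 1) then f g p q else 0) x p q =
        if h x p q = m then localDiff N f x p q else 0 := by
    intro f h r hr x p q
    have := localDiff_ite_grade N hN f (m + ((N : ℤ), 1) - r) x p q
    simp only [eq_sub_iff_add_eq] at this
    simp only [hr, this]
    congr 1
    rw [add_right_comm, add_left_inj]
  ext ⟨x, a, y, b, z, c⟩
  have hz : ∀ (s : ZMod 2), s + 0 = s := add_zero
  rw [Finsupp.filter_apply, dX_apply, dX_apply]
  simp only [Finsupp.filter_apply]
  rw [key _ _ (y.grade N + z.grade N + (2 * (b : ℤ), 0)),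
    key _ _ (x.grade N + z.grade N + (2 * (c : ℤ), 0)),
    key _ _ (x.grade N + y.grade N + (2 * (a : ℤ), 0))]
  · by_cases h : (⟨x, a, y, b, z, c⟩ : Word ℕ).grade N = m <;> simp [h]
  all_goals
    intro g p q
    rw [Word.grade_mk]
    refine Prod.ext ?_ ?_
    · simp only [Prod.fst_add]
      push_cast
      ring
    · simp only [Prod.snd_add]
      ring

theorem mem_supported_iff (s : Set (Word ℕ)) (u : Chain k) :
    u ∈ Finsupp.supported k k s ↔ ∀ x a y b z c, u ⟨x, a, y, b, z, c⟩ ≠ 0 →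
      (⟨x, a, y, b, z, c⟩ : Word ℕ) ∈ s := by
  rw [Finsupp.mem_supported]
  constructor
  · intro h x a y b z c hu
    exact h (Finset.mem_coe.2 (Finsupp.mem_support_iff.2 hu))
  · rintro h ⟨x, a, y, b, z, c⟩ hu
    exact h _ _ _ _ _ _ (Finsupp.mem_support_iff.1 (Finset.mem_coe.1 hu))

/-- The chains of a given grade. -/
def gradePart (k : Type*) [Field k] (N : ℕ) (m : ℤ × ZMod 2) : Submodule k (Chain k) :=
  Finsupp.supported k k {w | w.grade N = m}

theorem mem_gradePart {N : ℕ} {m : ℤ × ZMod 2} {u : Chain k} :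
    u ∈ gradePart k N m ↔ ∀ x a y b z c, u ⟨x, a, y, b, z, c⟩ ≠ 0 →
      (⟨x, a, y, b, z, c⟩ : Word ℕ).grade N = m := mem_supported_iff _ _

theorem τX_mem_gradePart {N : ℕ} {m : ℤ × ZMod 2} {u : Chain k} (hu : u ∈ gradePart k N m) :
    τX k u ∈ gradePart k N m := by
  rw [mem_gradePart] at hu ⊢
  intro x a y b z c h
  rw [rot_apply] at h
  rw [← hu _ _ _ _ _ _ (right_ne_zero_of_mul h), Word.grade_mk, Word.grade_mk,
    show a + b + c = b + c + a by ring]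
  abel

theorem sX_mem_gradePart {N : ℕ} {m : ℤ × ZMod 2} {u : Chain k} (hu : u ∈ gradePart k N m) :
    sX k u ∈ gradePart k N m := by
  rw [mem_gradePart] at hu ⊢
  intro x a y b z c h
  rw [sgn_apply] at h
  exact hu _ _ _ _ _ _ (right_ne_zero_of_mul h)

theorem homChain_mem_gradePart (N : ℕ) (x y z : Gen) (q : ℕ) (F : ℕ → ℕ → ℕ → k) :
    homChain x y z q F ∈ gradePart k N
      (x.grade N + y.grade N + z.grade N + (2 * (q : ℤ), 0)) := by
  rw [mem_gradePart]
  intro x' a y' b z' c h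
  rw [homChain_apply] at h
  split_ifs at h with h'
  · obtain ⟨rfl, rfl, rfl, rfl⟩ := h'
    rfl
  · exact absurd rfl h

theorem filter_eq_self_of_mem {N : ℕ} {m : ℤ × ZMod 2} {u : Chain k} (hu : u ∈ gradePart k N m) :
    u.filter (fun w => w.grade N = m) = u := by
  rw [Finsupp.filter_eq_self_iff]
  rintro ⟨x, a, y, b, z, c⟩ h
  exact mem_gradePart.1 hu _ _ _ _ _ _ h

/-- There is no homology in degrees other than those of the `1|1|∂`-chains `R_j`, `j ≤ N - 2`. -/
theorem exists_eq_dX_of_mem_gradePart (N : ℕ) (hN : (N : k) ≠ 0) (m : ℤ × ZMod 2)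
    (hm : ∀ j : Fin (N - 1), ((2 * (j : ℤ) + (2 - N), 1) : ℤ × ZMod 2) ≠ m) (u : Chain k)
    (hu : u ∈ gradePart k N m) (hdu : dX k N u = 0) :
    ∃ v ∈ gradePart k N (m + ((N : ℤ), 1)), u = dX k N v := by
  have hpos : 1 ≤ N := Nat.one_le_iff_ne_zero.2 fun h => hN (by simp [h])
  obtain ⟨a, v, h⟩ := exists_eq_sum_blockSum N hN u hdu
  refine ⟨v.filter fun w => w.grade N = m + ((N : ℤ), 1), ?_, ?_⟩
  · rw [mem_gradePart]
    intro x a y b z c h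
    rw [Finsupp.filter_apply] at h
    by_contra h'
    exact h (if_neg h')
  · rw [dX_filter_grade N hpos, ← filter_eq_self_of_mem hu]
    ext ⟨x, a', y, b, z, c⟩
    rw [Finsupp.filter_apply, Finsupp.filter_apply]
    split_ifs with hw
    · rw [h, Finsupp.add_apply, Finsupp.finsetSum_apply, Finset.sum_eq_zero, zero_add]
      intro j _
      rw [Finsupp.smul_apply, blockSum_apply, if_neg, smul_zero]
      rintro ⟨rfl, rfl, rfl, h'⟩
      apply hm j
      rw [← hw, Word.grade_mk, h']
      refine Prod.ext ?_ ?_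
      · simp [Gen.grade]
        ring
      · simp [Gen.grade]
    · rfl

end Grading


/-! ### A basis of the homology of the fixed point complex. -/

section FixedPointHomology

variable {k : Type*} [Field k] {M : Type*} [AddCommGroup M] [Module k M] {d τ s : Module.End k M}

theorem sum_C_smul_fst_zero {ι : Type*} [Fintype ι] (a : ι → k) (b : ι → PS M × PS M) :
    (∑ i, PowerSeries.C (a i) • b i).1 0 = ∑ i, a i • (b i).1 0 := by
  rw [Prod.fst_sum, PS.sum_apply]
  exact Finset.sum_congr rfl fun i _ => PS.C_smul_apply _ _ _

theorem sum_C_smul_snd_zero {ι : Type*} [Fintype ι] (a : ι → k) (b : ι → PS M × PS M) :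
    (∑ i, PowerSeries.C (a i) • b i).2 0 = ∑ i, a i • (b i).2 0 := by
  rw [Prod.snd_sum, PS.sum_apply]
  exact Finset.sum_congr rfl fun i _ => PS.C_smul_apply _ _ _

theorem prod_X_smul_fst_zero (x : PS M × PS M) :
    ((PowerSeries.X : PowerSeries k) • x).1 0 = 0 := PS.X_smul_zero x.1

theorem prod_X_smul_snd_zero (x : PS M × PS M) :
    ((PowerSeries.X : PowerSeries k) • x).2 0 = 0 := PS.X_smul_zero x.2

/-- Lifts `R_j + R'_j θ + ⋯` of a basis of the homology of `M`, together with their products with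
`θ`, give a basis of the equivariant homology. -/
theorem exists_fixDiff_homology_basis {ι : Type*} [Fintype ι] (hdτ : d * τ = τ * d)
    (hds : d * s = -(s * d)) (hD : fixDiff d τ s ∘ₗ fixDiff d τ s = 0) (R R' : ι → M)
    (hspan : ∀ u, d u = 0 → ∃ (a : ι → k) (v : M), u = ∑ i, a i • R i + d v)
    (hind : ∀ (a : ι → k) (v : M), ∑ i, a i • R i = d v → ∀ i, a i = 0)
    (hR : ∀ i, (τ * s) (R i) = -R i - d (R' i)) (hR' : ∀ i, ((τ - 1) * s) (R i) = -d (R' i))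
    (b : ι ⊕ ι → PS M × PS M) (hb : ∀ i, fixDiff d τ s (b i) = 0)
    (h₁ : ∀ i, (b (Sum.inl i)).1 0 = R i) (h₂ : ∀ i, (b (Sum.inl i)).2 0 = R' i)
    (h₃ : ∀ i, (b (Sum.inr i)).1 0 = 0) (h₄ : ∀ i, (b (Sum.inr i)).2 0 = (τ * s) (R i)) :
    ∃ B : Module.Basis (ι ⊕ ι) (PowerSeries k) (Homology (fixDiff d τ s)),
      ∀ i, B i = homologyClass (fixDiff d τ s) (b i) (hb i) := by
  have hcomm : ∀ v, ((τ - 1) * s) (d v) = -d (((τ - 1) * s) v) := fun v =>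
    eq_neg_of_add_eq_zero_right
      (LinearMap.congr_fun (mul_mul_add_mul_mul_eq_zero (commute_sub_one hdτ) hds) v)
  have hsum : ∀ (a : ι → k) (v : M), ((τ - 1) * s) (∑ i, a i • R i + d v) =
      -d (∑ i, a i • R' i + ((τ - 1) * s) v) := by
    intro a v
    rw [map_add, map_sum, hcomm, map_add, map_sum, neg_add, ← Finset.sum_neg_distrib]
    congr 1
    exact Finset.sum_congr rfl fun i _ => by rw [map_smul, hR', map_smul, smul_neg]
  have hsum' : ∀ a : ι → k, ∑ i, a i • (τ * s) (R i) =
      -∑ i, a i • R i - d (∑ i, a i • R' i) := by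
    intro a
    rw [map_sum, ← Finset.sum_neg_distrib, ← Finset.sum_sub_distrib]
    exact Finset.sum_congr rfl fun i _ => by rw [hR, map_smul, smul_sub, smul_neg]
  refine exists_homology_basis prod_isTAdic (fixDiff d τ s) hD b hb ?_ ?_
  · intro y z hy
    have h0 : d (y.1 0) = 0 := by
      rw [← fixDiff_fst_zero (τ := τ) (s := s), hy, prod_X_smul_fst_zero]
    have h1 : ((τ - 1) * s) (y.1 0) + d (y.2 0) = 0 := by
      rw [← fixDiff_snd, hy, prod_X_smul_snd_zero]
    obtain ⟨a, w₀, hw₀⟩ := hspan _ h0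
    obtain ⟨a', w₁, hw₁⟩ := hspan (y.2 0 - (∑ i, a i • R' i + ((τ - 1) * s) w₀)) (by
      rw [map_sub, sub_eq_zero]
      rw [hw₀, hsum, neg_add_eq_zero] at h1
      exact h1.symm)
    -- The θ-multiples begin with (τ s)R θ = -(R + d R')θ, which explains the sign of a' and the
    -- correction of w₁ by the R'.
    obtain ⟨y', hy'⟩ := exists_eq_X_smul_prod (k := k)
      (y - (∑ i, PowerSeries.C (Sum.elim a (fun i => -a' i) i) • b i +
        fixDiff d τ s (PS.monomial 0 w₀, PS.monomial 0 (w₁ - ∑ i, a' i • R' i)))) (by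
      rw [Prod.fst_sub, PS.sub_apply, Prod.fst_add, PS.add_apply, sum_C_smul_fst_zero,
        fixDiff_fst_zero]
      simp only [Fintype.sum_sum_type, Sum.elim_inl, Sum.elim_inr, h₁, h₃, smul_zero,
        Finset.sum_const_zero, add_zero, PS.monomial_apply, if_true]
      rw [hw₀, sub_self]) (by
      rw [Prod.snd_sub, PS.sub_apply, Prod.snd_add, PS.add_apply, sum_C_smul_snd_zero,
        fixDiff_snd]
      simp only [Fintype.sum_sum_type, Sum.elim_inl, Sum.elim_inr, h₂, h₄,
        PS.monomial_apply, if_true]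
      rw [hsum' fun i => -a' i, eq_add_of_sub_eq' hw₁]
      simp only [neg_smul, Finset.sum_neg_distrib, map_sub, map_neg]
      abel)
    exact ⟨_, _, y', eq_add_of_sub_eq' hy'⟩
  · intro a w y' h
    have h0 := congrArg (fun x : PS M × PS M => x.1 0) h
    have h1 := congrArg (fun x : PS M × PS M => x.2 0) h
    rw [Prod.fst_add, PS.add_apply, sum_C_smul_fst_zero, fixDiff_fst_zero, prod_X_smul_fst_zero]
      at h0
    rw [Prod.snd_add, PS.add_apply, sum_C_smul_snd_zero, fixDiff_snd, prod_X_smul_snd_zero] at h1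
    simp only [Fintype.sum_sum_type, h₁, h₂, h₃, h₄, smul_zero, Finset.sum_const_zero, add_zero]
      at h0 h1
    have ha := hind _ _ h0
    simp only [ha, zero_smul, Finset.sum_const_zero, zero_add] at h0 h1
    -- The first coefficient of `w` is now a cycle, and (τ - 1)s sends cycles to boundaries; so it
    -- cannot contribute to a relation between the R in the θ-coefficient.
    obtain ⟨e, v, hv⟩ := hspan _ h0.symm
    rw [hsum', hv, hsum, sub_eq_iff_eq_add, neg_eq_iff_eq_neg] at h1
    have ha' := hind (fun i => a (Sum.inr i)) (∑ i, e i • R' i + ((τ - 1) * s) v - w.2 0 -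
      ∑ i, a (Sum.inr i) • R' i) (by
        rw [h1]
        simp only [map_sub, map_add]
        abel)
    rintro (i | i)
    · exact ha i
    · exact ha' i

end FixedPointHomology

/-! ### The generators are cycles and give a basis. -/

section Generators

variable {k : Type*} [Field k]

/-- The differential of a chain whose coefficients depend only on the distinguished entries and the
total length of the blocks. -/
theorem dX_apply_of_eq (N : ℕ) (c : Chain k) (G : Gen → Gen → Gen → ℕ → k)
    (hc : ∀ x a y b z e, c ⟨x, a, y, b, z, e⟩ = G x y z (a + b + e))
    (x : Gen) (a : ℕ) (y : Gen) (b : ℕ) (z : Gen) (e : ℕ) :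
    dX k N c ⟨x, a, y, b, z, e⟩ =
      -(N * ((if x = .one then y.sign k * z.sign k * G .del y z (a + b + e + (N - 1)) else 0) +
        (if y = .one then z.sign k * G x .del z (a + b + e + (N - 1)) else 0) +
        if z = .one then G x y .del (a + b + e + (N - 1)) else 0)) := by
  have key : ∀ (F : Gen → ℕ → ℕ → k) (F' : Gen → ℕ → k) (l : ℕ)
      (_ : ∀ g p q, F g p q = F' g (l + (p + q))) (g : Gen) (p q : ℕ), localDiff N F g p q =
        -(N * if g = .one then F' .del (l + (p + q) + (N - 1)) else 0) := by
    intro F F' l h g p q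
    cases g
    · simp only [localDiff, h]
      rw [Finset.sum_congr rfl (g := fun _ => F' .del (l + (p + q) + (N - 1)))]
      · simp
      · intro i hi
        rw [Finset.mem_range] at hi
        congr 1
        omega
    · simp only [localDiff, h]
      rw [show p + (q + 1) = p + 1 + q by ring]
      simp
  rw [dX_apply, key _ (fun g n => G g y z n) b, key _ (fun g n => G x g z n) e,
    key _ (fun g n => G x y g n) a, show b + (e + a) = a + b + e by ring,
    show e + (a + b) = a + b + e by ring, show a + (b + e) = a + b + e by ring]
  · cases x <;> cases y <;> cases z <;> simp [Gen.sign, Gen.deg] <;> ring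
  all_goals
    intro g p q
    rw [hc]
    congr 1
    ring

theorem dX_blockSum_apply (N : ℕ) (x' y' z' : Gen) (n : ℕ)
    (x : Gen) (a : ℕ) (y : Gen) (b : ℕ) (z : Gen) (e : ℕ) :
    dX k N (blockSum k x' y' z' n) ⟨x, a, y, b, z, e⟩ =
      -(N * ((if x = .one then y.sign k * z.sign k *
          (if x' = .del ∧ y' = y ∧ z' = z ∧ a + b + e + (N - 1) = n then 1 else 0) else 0) +
        (if y = .one then z.sign k *
          (if x' = x ∧ y' = .del ∧ z' = z ∧ a + b + e + (N - 1) = n then 1 else 0) else 0) +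
        if z = .one then
          (if x' = x ∧ y' = y ∧ z' = .del ∧ a + b + e + (N - 1) = n then 1 else 0) else 0)) :=
  dX_apply_of_eq N (blockSum k x' y' z' n) (fun x y z m => if x' = x ∧ y' = y ∧ z' = z ∧ m = n
    then 1 else 0) (blockSum_apply x' y' z' n) x a y b z e

theorem dX_blockSum_one_one_del (N j : ℕ) (hj : j < N - 1) :
    dX k N (blockSum k .one .one .del j) = 0 := by
  ext ⟨x, a, y, b, z, e⟩
  rw [dX_blockSum_apply]
  have : a + b + e + (N - 1) ≠ j := by omega
  simp [this]

theorem sX_blockSum (x' y' z' : Gen) (n : ℕ) :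
    sX k (blockSum k x' y' z' n) = (-1 : k) ^ (x'.deg + y'.deg + z'.deg) • blockSum k x' y' z' n := by
  ext ⟨x, a, y, b, z, e⟩
  rw [sgn_apply, Finsupp.smul_apply, blockSum_apply]
  split_ifs with h
  · obtain ⟨rfl, rfl, rfl, -⟩ := h
    rfl
  · simp

theorem τX_blockSum (x' y' z' : Gen) (n : ℕ) :
    τX k (blockSum k x' y' z' n) =
      (-1 : k) ^ (z'.deg * (x'.deg + y'.deg)) • blockSum k z' x' y' n := by
  ext ⟨x, a, y, b, z, e⟩
  rw [rot_apply, Finsupp.smul_apply, blockSum_apply, blockSum_apply, show b + e + a = a + b + e by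
    ring]
  by_cases h : x' = y ∧ y' = z ∧ z' = x ∧ a + b + e = n
  · rw [if_pos h, if_pos ⟨h.2.2.1, h.1, h.2.1, h.2.2.2⟩]
    obtain ⟨rfl, rfl, rfl, -⟩ := h
    rfl
  · rw [if_neg h, if_neg fun h' => h ⟨h'.2.1, h'.2.2.1, h'.1, h'.2.2.2⟩]
    simp

/-- As N is invertible, 1|1|∂ and its rotation ∂|1|1 are homologous; this primitive gives the
θ-coefficient -1/N of the generators. -/
theorem dX_blockSum_del_one_del (N n : ℕ) : dX k N (blockSum k .del .one .del (n + (N - 1))) =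
    (N : k) • (blockSum k .one .one .del n - blockSum k .del .one .one n) := by
  ext ⟨x, a, y, b, z, e⟩
  rw [dX_blockSum_apply, Finsupp.smul_apply, Finsupp.sub_apply, blockSum_apply, blockSum_apply]
  cases x <;> cases y <;> cases z <;> simp [Gen.sign, Gen.deg, neg_ite]

/-- The right side is, up to a scalar, the norm of ∂|1|∂ under the rotation; dividing by N once more
gives the t-coefficient 1/N². -/
theorem dX_blockSum_del_del_del (N n : ℕ) : dX k N (blockSum k .del .del .del (n + (N - 1))) =
    -(N : k) • (blockSum k .one .del .del n - blockSum k .del .one .del n +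
      blockSum k .del .del .one n) := by
  ext ⟨x, a, y, b, z, e⟩
  rw [dX_blockSum_apply, Finsupp.smul_apply, Finsupp.add_apply, Finsupp.sub_apply, blockSum_apply,
    blockSum_apply, blockSum_apply]
  cases x <;> cases y <;> cases z <;> simp [Gen.sign, Gen.deg, neg_ite]

theorem eqDiff_fst_zero (N : ℕ) (x : EqChain k) : (eqDiff k N x).1 0 = dX k N (x.1 0) :=
  fixDiff_fst_zero (M := Chain k) x

theorem eqDiff_fst_succ (N : ℕ) (x : EqChain k) (n : ℕ) : (eqDiff k N x).1 (n + 1) =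
    dX k N (x.1 (n + 1)) + (sX k (x.2 n) + τX k (sX k (x.2 n)) + τX k (τX k (sX k (x.2 n)))) :=
  fixDiff_fst_succ (M := Chain k) x n

theorem eqDiff_snd (N : ℕ) (x : EqChain k) (n : ℕ) : (eqDiff k N x).2 n =
    τX k (sX k (x.1 n)) - sX k (x.1 n) + dX k N (x.2 n) := rfl

theorem Rtilde_fst (N j n : ℕ) : (Rtilde k N j).1 n =
    (if n = 0 then blockSum k .one .one .del j else 0) +
      if n = 1 then ((N : k) ^ 2)⁻¹ • blockSum k .del .del .del (j + 2 * (N - 1)) else 0 := rfl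

theorem Rtilde_snd (N j n : ℕ) : (Rtilde k N j).2 n =
    if n = 0 then -(N : k)⁻¹ • blockSum k .del .one .del (j + (N - 1)) else 0 := rfl

theorem τX_sX_blockSum_one_one_del (n : ℕ) : τX k (sX k (blockSum k .one .one .del n)) =
    -blockSum k .del .one .one n := by
  rw [sX_blockSum, map_smul, τX_blockSum]
  simp [Gen.deg]

theorem sX_blockSum_one_one_del (n : ℕ) : sX k (blockSum k .one .one .del n) =
    -blockSum k .one .one .del n := by
  rw [sX_blockSum]
  simp [Gen.deg]

theorem dX_neg_inv_smul_blockSum (N n : ℕ) (hN : (N : k) ≠ 0) :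
    dX k N (-(N : k)⁻¹ • blockSum k .del .one .del (n + (N - 1))) =
      blockSum k .del .one .one n - blockSum k .one .one .del n := by
  rw [map_smul, dX_blockSum_del_one_del, smul_smul, neg_mul, inv_mul_cancel₀ hN, neg_smul, one_smul,
    neg_sub]

theorem eqDiff_Rtilde (N : ℕ) (hN : (N : k) ≠ 0) (j : ℕ) (hj : j < N - 1) :
    eqDiff k N (Rtilde k N j) = 0 := by
  refine Prod.ext (PS.ext fun n => ?_) (PS.ext fun n => ?_)
  · rcases n with _ | _ | n
    · rw [eqDiff_fst_zero, Rtilde_fst, if_pos rfl, if_neg (by simp), add_zero,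
        dX_blockSum_one_one_del N j hj]
      rfl
    · rw [eqDiff_fst_succ, Rtilde_fst, Rtilde_snd, if_neg (by simp), if_pos (by simp), if_pos rfl,
        zero_add, map_smul, show j + 2 * (N - 1) = j + (N - 1) + (N - 1) by ring,
        dX_blockSum_del_del_del]
      simp only [map_smul, sX_blockSum, τX_blockSum]
      simp only [Gen.deg]
      refine Eq.trans ?_ (PS.zero_apply 1).symm
      have : ((N : k) ^ 2)⁻¹ * N = (N : k)⁻¹ := by field_simp
      rw [smul_smul, mul_neg, this]
      simp only [smul_smul]
      norm_num
      simp only [smul_sub]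
      abel
    · rw [eqDiff_fst_succ, Rtilde_fst, Rtilde_snd, if_neg (by simp), if_neg (by simp),
        if_neg (by simp)]
      simp only [map_zero, add_zero]
      rfl
  · rcases n with _ | n
    · rw [eqDiff_snd, Rtilde_fst, Rtilde_snd, if_pos rfl, if_neg (by simp), if_pos rfl, add_zero,
        dX_neg_inv_smul_blockSum N j hN, τX_sX_blockSum_one_one_del, sX_blockSum_one_one_del]
      refine Eq.trans ?_ (PS.zero_apply 0).symm
      abel
    · rw [eqDiff_snd, Rtilde_fst, Rtilde_snd]
      rcases n with _ | n
      -- The ∂|∂|∂-term is invariant under the rotation, so it has no θ-part and the lift stops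
      -- here.
      · rw [if_neg (by simp), if_pos (by simp), if_neg (by simp), zero_add, map_smul, map_smul, sX_blockSum, map_smul, τX_blockSum]
        simp only [Gen.deg, map_zero, add_zero]
        refine Eq.trans ?_ (PS.zero_apply 1).symm
        norm_num
      · rw [if_neg (by simp), if_neg (by simp), if_neg (by simp)]
        simp only [map_zero, add_zero, sub_zero]
        rfl

theorem exists_basis_HHEq [CharP k 3] (N : ℕ) (hN : (N : k) ≠ 0)
    (hθ : Descends (eqDiff k N) (thetaAct k))
    (hR : ∀ j : Fin (N - 1), eqDiff k N (Rtilde k N j) = 0) :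
    ∃ b : Module.Basis (Fin (N - 1) ⊕ Fin (N - 1)) (PowerSeries k) (HHEq k N),
      ∀ j, b (Sum.inl j) = RClass k N hR j ∧
        b (Sum.inr j) = thetaHH k N hθ (RClass k N hR j) := by
  have hb : ∀ i, fixDiff (dX k N) (τX k) (sX k) (Sum.elim (fun j : Fin (N - 1) => Rtilde k N j)
      (fun j : Fin (N - 1) => thetaAct k (Rtilde k N j)) i) = 0 := by
    rintro (j | j)
    · exact hR j
    · exact hθ.1 _ (hR j)
  obtain ⟨B, hB⟩ := exists_fixDiff_homology_basis (M := Chain k) (dX_mul_τX N) (dX_mul_sX N)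
    (eqDiff_comp_eqDiff N) (fun j : Fin (N - 1) => blockSum k .one .one .del j)
    (fun j : Fin (N - 1) => -(N : k)⁻¹ • blockSum k .del .one .del (j + (N - 1)))
    (fun u hu => exists_eq_sum_blockSum N hN u hu) (fun a v h => sum_blockSum_ne_dX N a v h)
    (fun i => by
      rw [dX_neg_inv_smul_blockSum N i hN, Module.End.mul_apply, τX_sX_blockSum_one_one_del]
      abel)
    (fun i => by
      rw [dX_neg_inv_smul_blockSum N i hN, Module.End.mul_apply, LinearMap.sub_apply,
        τX_sX_blockSum_one_one_del, Module.End.one_apply, sX_blockSum_one_one_del]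
      abel)
    _ hb
    (fun i => by
      rw [Sum.elim_inl, Rtilde_fst, if_pos rfl, if_neg (by simp), add_zero])
    (fun i => by
      rw [Sum.elim_inl, Rtilde_snd, if_pos rfl])
    (fun i => PS.X_smul_zero _)
    (fun i => by
      change (τX k * sX k) ((Rtilde k N i).1 0) = _
      rw [Rtilde_fst, if_pos rfl, if_neg (by simp), add_zero])
  exact ⟨B, fun j => ⟨hB (Sum.inl j), hB (Sum.inr j)⟩⟩

end Generators


/-! ### The cap product on the generators. -/

section Cap

variable {k : Type*} [Field k] {N : ℕ}

theorem capX_blockSum_add_three (x y z : Gen) (n : ℕ) :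
    capX k N (blockSum k x y z (n + 3)) = blockSum k x y z n := by
  ext ⟨x', a, y', b, z', e⟩
  rw [capX_apply, blockSum_apply, blockSum_apply,
    show a + 1 + (b + 1) + (e + 1) = a + b + e + 3 by ring]
  simp only [Nat.add_right_cancel_iff]

theorem capX_blockSum_of_lt (x y z : Gen) (n : ℕ) (hn : n < 3) :
    capX k N (blockSum k x y z n) = 0 := by
  ext ⟨x', a, y', b, z', e⟩
  rw [capX_apply, blockSum_apply, if_neg (by omega)]
  rfl

theorem eqCap_fst (N : ℕ) (x : EqChain k) (n : ℕ) :
    (eqCap k N (phiOne k 1) x).1 n = capX k N (x.1 n) := rfl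

theorem eqCap_snd (N : ℕ) (x : EqChain k) (n : ℕ) :
    (eqCap k N (phiOne k 1) x).2 n = capX k N (x.2 n) := rfl

/-- The sum is N(N - 1)/2, and 1/2 = -1 in characteristic 3. -/
theorem sum_range_cast_rev [CharP k 3] (N : ℕ) (hN : 1 ≤ N) :
    ∑ i ∈ Finset.range N, ((N - 1 - i : ℕ) : k) = N * (1 - N) := by
  rw [Finset.sum_range_reflect (fun i => (i : k))]
  have h3 : (3 : k) = 0 := CharP.cast_eq_zero k 3
  have h := congrArg (Nat.cast (R := k)) (Finset.sum_range_id_mul_two N)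
  push_cast [Nat.cast_sub hN] at h
  linear_combination (-1) * h + (∑ i ∈ Finset.range N, (i : k)) * h3

/-- A coefficient linear in c has constant difference under S₁ - S₃ and none under S₂ - S₁, as
required. The constant (1 - N)/N makes the coefficients have sum zero over c = 0, …, N - 1, which
cancels the 1|1|1-part. -/
theorem dX_primitive_one [CharP k 3] (N m : ℕ) (hN : (N : k) ≠ 0) (hm : m + 2 ≤ N) :
    dX k N (homChain .one .one .del (N - 1 - m) fun _ _ c => -(N : k)⁻¹ * c + (1 - N) / N) =
      -(N : k)⁻¹ • blockSum k .del .one .del (N - 2 - m) := by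
  ext ⟨x, a, y, b, z, e⟩
  rw [Finsupp.smul_apply, blockSum_apply]
  cases x <;> cases y <;> cases z <;> simp [dX_apply, localDiff, homChain_apply, Gen.sign, Gen.deg]
  -- The total length N - 1 - m admits an application of m_N only for m = 0, with nothing left over.
  · by_cases h : a + b + e + m = 0
    · obtain ⟨rfl, rfl, rfl, rfl⟩ : a = 0 ∧ b = 0 ∧ e = 0 ∧ m = 0 := by omega
      rw [Finset.sum_congr rfl (g := fun i =>
        -(N : k)⁻¹ * ((N - 1 - i : ℕ) : k) + (1 - N) / N)]
      · rw [Finset.sum_add_distrib, ← Finset.mul_sum, sum_range_cast_rev N (by omega)]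
        simp
        field_simp
        ring
      · intro i hi
        rw [Finset.mem_range] at hi
        rw [if_pos (by omega)]
        simp
    · refine Finset.sum_eq_zero fun i hi => ?_
      rw [Finset.mem_range] at hi
      rw [if_neg (by omega)]
  · rw [show a + 1 + b + e = a + (b + 1) + e by ring, sub_self]
  · by_cases h : a + b + e = N - 2 - m
    · rw [if_pos (by omega), if_pos (by omega), if_pos h]
      ring
    · rw [if_neg (by omega), if_neg (by omega), if_neg h, sub_self]

/-- The ∂|∂|1-part, linear in b, produces the ∂|∂|∂-sum. The quadratic 1|1|1-part cancels its
remaining differential and the norm of y₁ at ∂|1|1 and 1|∂|1; what survives at 1|1|∂ is the constant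
-m/N, the source of the factor in the cap product. -/
theorem dX_primitive_zero [CharP k 3] (N m : ℕ) (hN : (N : k) ≠ 0) (hm : m + 2 ≤ N)
    (y₁ : Chain k) (hy₁ : y₁ = homChain .one .one .del (N - 1 - m) fun _ _ c => -(N : k)⁻¹ * c + (1 - N) / N) :
    dX k N (homChain .del .del .one (2 * N - 2 - m) (fun _ b _ => -((N : k) ^ 2)⁻¹ * b) +
      homChain .one .one .one (N - m) fun _ b c =>
        (N : k)⁻¹ * (c * (c - 1) - m * c) + (1 - N) / N * (b - c)) +
      (sX k y₁ + τX k (sX k y₁) + τX k (τX k (sX k y₁))) =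
      ((N : k) ^ 2)⁻¹ • blockSum k .del .del .del (2 * N - 3 - m) -
        (m / N : k) • blockSum k .one .one .del (N - 1 - m) := by
  subst hy₁
  have h3 : (3 : k) = 0 := CharP.cast_eq_zero k 3
  ext ⟨x, a, y, b, z, e⟩
  simp only [map_add, Finsupp.add_apply, Finsupp.sub_apply, Finsupp.smul_apply, blockSum_apply]
  cases x <;> cases y <;> cases z <;> simp [dX_apply, localDiff, homChain_apply, Gen.sign, Gen.deg, rot_apply, sgn_apply]
  -- The component 1|1|∂: the terms in c and the constants from y₁ and y₀ add up to multiples of 3,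
  -- leaving only -m/N.
  · by_cases h : a + b + e = N - 1 - m
    · rw [if_pos (by omega), if_pos (by omega), if_pos h, if_pos h]
      field_simp
      linear_combination (e - 1 + N) * h3
    · rw [if_neg (by omega), if_neg (by omega), if_neg h, if_neg h]
      simp
  · by_cases h : a + b + e = N - 1 - m
    · rw [if_pos (by omega), if_pos (by omega), if_pos (by omega),
        Finset.sum_congr rfl (g := fun _ => -(((N : k) ^ 2)⁻¹ * b))]
      · simp
        field_simp
        ring
      · intro i hi
        rw [Finset.mem_range] at hi
        rw [if_pos (by omega)]
    · rw [if_neg (by omega), if_neg (by omega), if_neg (by omega), Finset.sum_eq_zero]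
      · simp
      · intro i hi
        rw [Finset.mem_range] at hi
        rw [if_neg (by omega)]
  · by_cases h : a + b + e = N - 1 - m
    · have h' : (a + b + e + m + 1 : k) = N := by
        rw [← (show a + b + e + m + 1 = N by omega)]
        push_cast
        rfl
      rw [if_pos (by omega), if_pos (by omega), if_pos (by omega),
        Finset.sum_congr rfl (g := fun i =>
          -((N : k) ^ 2)⁻¹ * b + -((N : k) ^ 2)⁻¹ * ((N - 1 - i : ℕ) : k))]
      · rw [Finset.sum_add_distrib, ← Finset.mul_sum, ← Finset.mul_sum, sum_range_cast_rev N (by omega)]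
        simp
        field_simp
        linear_combination h' - e * h3
      · intro i hi
        rw [Finset.mem_range] at hi
        rw [if_pos (by omega)]
        ring
    · rw [if_neg (by omega), if_neg (by omega), if_neg (by omega), Finset.sum_eq_zero]
      · simp
      · intro i hi
        rw [Finset.mem_range] at hi
        rw [if_neg (by omega)]
  · by_cases h : a + b + e = 2 * N - 3 - m
    · rw [if_pos (by omega), if_pos (by omega), if_pos h]
      ring
    · rw [if_neg (by omega), if_neg (by omega), if_neg h, sub_self]
theorem eqCap_Rtilde_add_three (N j : ℕ) :
    eqCap k N (phiOne k 1) (Rtilde k N (j + 3)) = Rtilde k N j := by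
  refine Prod.ext (PS.ext fun n => ?_) (PS.ext fun n => ?_)
  · rw [eqCap_fst, Rtilde_fst, Rtilde_fst, map_add, apply_ite (capX k N), apply_ite (capX k N),
      map_zero, map_smul, capX_blockSum_add_three,
      show j + 3 + 2 * (N - 1) = j + 2 * (N - 1) + 3 by ring, capX_blockSum_add_three]
  · rw [eqCap_snd, Rtilde_snd, Rtilde_snd, apply_ite (capX k N), map_zero, map_smul,
      show j + 3 + (N - 1) = j + (N - 1) + 3 by ring, capX_blockSum_add_three]

theorem eqCap_Rtilde_two_zero : eqCap k 2 (phiOne k 1) (Rtilde k 2 0) = 0 := by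
  refine Prod.ext (PS.ext fun n => ?_) (PS.ext fun n => ?_)
  · rw [eqCap_fst, Rtilde_fst, map_add, apply_ite (capX k 2), apply_ite (capX k 2),
      map_zero, map_smul, capX_blockSum_of_lt _ _ _ _ (by norm_num),
      capX_blockSum_of_lt _ _ _ _ (by norm_num), smul_zero, ite_self, ite_self, add_zero]
    rfl
  · rw [eqCap_snd, Rtilde_snd, apply_ite (capX k 2), map_zero, map_smul,
      capX_blockSum_of_lt _ _ _ _ (by norm_num), smul_zero, ite_self]
    rfl

/-- Parity forces p to be even, hence p ≥ 2. Then the integer component on the right is at least 3N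
- 2m ≥ N, while the homology of X lives in integer grades at most N - 2. -/
theorem ne_grade (N m p : ℕ) (hm : m ≤ N) (hp : 1 ≤ p) (j : Fin (N - 1)) :
    ((2 * (j : ℤ) + (2 - N), 1) : ℤ × ZMod 2) ≠
      ((N : ℤ) - 2 * m, 1) + p • ((N : ℤ), (1 : ZMod 2)) := by
  intro h
  have h1 := congrArg Prod.fst h
  have h2 := congrArg Prod.snd h
  simp only [Prod.fst_add, Prod.smul_fst, Prod.snd_add, Prod.smul_snd, left_eq_add] at h1 h2
  rw [nsmul_eq_mul] at h1 h2
  rw [mul_one] at h2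
  obtain ⟨n, rfl⟩ := (ZMod.natCast_eq_zero_iff p 2).1 h2
  have hj := j.2
  have hn : 1 ≤ n := by omega
  have : (N : ℤ) * 1 ≤ N * n := by
    gcongr
    exact_mod_cast hn
  push_cast at h1
  have h4 : (2 * n * N : ℤ) = 2 * (N * n) := by ring
  omega

/-- A coefficientwise comparison. The error ξ collects the higher terms of t R_{N-1-m} and the
θ-part of the differential of y₀ t, divided by t. -/
theorem eqCap_Rtilde_eq [CharP k 3] (N m : ℕ) (hN4 : 4 ≤ N) (hm : m ≤ 2)
    (y₀ y₁ : Chain k) (ξ : EqChain k)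
    (h1 : dX k N y₁ = -(N : k)⁻¹ • blockSum k .del .one .del (N - 2 - m))
    (h0 : dX k N y₀ + (sX k y₁ + τX k (sX k y₁) + τX k (τX k (sX k y₁))) =
      ((N : k) ^ 2)⁻¹ • blockSum k .del .del .del (2 * N - 3 - m) -
        (m / N : k) • blockSum k .one .one .del (N - 1 - m))
    (hξ : ξ =
      (PS.monomial 1 (-(m / N : k) • ((N : k) ^ 2)⁻¹ • blockSum k .del .del .del (3 * N - 3 - m)),
      PS.monomial 0 ((m / N : k) • (N : k)⁻¹ • blockSum k .del .one .del (2 * N - 2 - m) -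
        (τX k (sX k y₀) - sX k y₀)))) :
    eqCap k N (phiOne k 1) (Rtilde k N (2 - m)) =
      PowerSeries.C (m / N : k) • (PowerSeries.X : PowerSeries k) • Rtilde k N (N - 1 - m) +
        eqDiff k N (PS.monomial 1 y₀, PS.monomial 0 y₁) + (PowerSeries.X : PowerSeries k) • ξ := by
  have hC : ∀ (r : k) (x : EqChain k) (n : ℕ), (PowerSeries.C r • x).1 n = r • x.1 n :=
    fun r x n => PS.C_smul_apply r x.1 n
  have hC' : ∀ (r : k) (x : EqChain k) (n : ℕ), (PowerSeries.C r • x).2 n = r • x.2 n :=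
    fun r x n => PS.C_smul_apply r x.2 n
  refine Prod.ext (PS.ext fun n => ?_) (PS.ext fun n => ?_)
  · rw [Prod.fst_add, PS.add_apply, Prod.fst_add, PS.add_apply, eqCap_fst, hC, Rtilde_fst]
    rcases n with _ | n
    · rw [prod_X_smul_fst_zero, prod_X_smul_fst_zero, eqDiff_fst_zero]
      simp only [PS.monomial_apply, if_true, zero_ne_one, if_false, add_zero, map_zero, smul_zero]
      exact capX_blockSum_of_lt _ _ _ _ (by omega)
    · rw [prod_X_smul_fst_succ, prod_X_smul_fst_succ, eqDiff_fst_succ, hξ, Rtilde_fst]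
      simp only [PS.monomial_apply, Nat.succ_ne_zero, Nat.add_eq_right, if_false, zero_add]
      rcases n with _ | _ | n
      · simp only [if_true, zero_ne_one, if_false, add_zero]
        rw [map_smul, h0, show 2 - m + 2 * (N - 1) = 2 * N - 3 - m + 3 by omega,
          capX_blockSum_add_three, add_sub_cancel]
      · simp only [if_true, zero_add, one_ne_zero, if_false, map_zero, add_zero]
        rw [show N - 1 - m + 2 * (N - 1) = 3 * N - 3 - m by omega, neg_smul, add_neg_cancel]
      · simp [map_zero]
  · rw [Prod.snd_add, PS.add_apply, Prod.snd_add, PS.add_apply, eqCap_snd, hC', Rtilde_snd,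
      eqDiff_snd]
    rcases n with _ | _ | n
    · rw [prod_X_smul_snd_zero, prod_X_smul_snd_zero]
      simp only [PS.monomial_apply, if_true, zero_ne_one, if_false, map_zero, sub_zero, smul_zero,
        zero_add, add_zero]
      rw [h1, map_smul, show 2 - m + (N - 1) = N - 2 - m + 3 by omega, capX_blockSum_add_three]
    · rw [prod_X_smul_snd_succ, prod_X_smul_snd_succ, hξ, Rtilde_snd]
      simp only [PS.monomial_apply, if_true, zero_add, one_ne_zero, if_false, map_zero, add_zero]
      rw [show N - 1 - m + (N - 1) = 2 * N - 2 - m by omega, neg_smul, smul_neg]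
      abel
    · rw [prod_X_smul_snd_succ, prod_X_smul_snd_succ, hξ, Rtilde_snd]
      simp [PS.monomial_apply]

theorem map_smul_smul_eq_zero {R E : Type*} [CommRing R] [AddCommGroup E] [Module R E]
    (D : E →ₗ[R] E) (r r' : R) (x : E) (h : r = 0 ∨ D x = 0) : D (r • r' • x) = 0 := by
  rcases h with h | h <;> simp [h]

theorem IsTAdic.map_eq_zero {E : Type*} [AddCommGroup E] [Module (PowerSeries k) E]
    (hE : IsTAdic k E) {D : E →ₗ[PowerSeries k] E} (hD : D ∘ₗ D = 0) {x a y ξ : E}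
    (h : x = a + D y + (PowerSeries.X : PowerSeries k) • ξ) (hx : D x = 0) (ha : D a = 0) :
    D ξ = 0 := by
  have hDD : D (D y) = 0 := LinearMap.congr_fun hD y
  rw [h, map_add, map_add, ha, hDD, map_smul, zero_add, zero_add] at hx
  exact hE.torsionFree _ hx

theorem add_map_add_smul_map {R E : Type*} [CommRing R] [AddCommGroup E] [Module R E]
    (D : E →ₗ[R] E) (r : R) (a y z : E) : a + D y + r • D z = a + D (y + r • z) := by
  rw [map_add, map_smul, add_assoc]

/-- The cap product of `R_{2 - m}` with `φ^1_1` is `(m / N) t R_{N - 1 - m}` up to a boundary. -/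
theorem exists_eqCap_Rtilde [CharP k 3] (N m : ℕ) (hN : (N : k) ≠ 0) (hN4 : 4 ≤ N) (hm : m ≤ 2) :
    ∃ z, eqCap k N (phiOne k 1) (Rtilde k N (2 - m)) =
      PowerSeries.C (m / N : k) • (PowerSeries.X : PowerSeries k) • Rtilde k N (N - 1 - m) +
        eqDiff k N z := by
  obtain ⟨y₁, hy₁⟩ : ∃ y₁ : Chain k, y₁ =
    homChain .one .one .del (N - 1 - m) fun _ _ c => -(N : k)⁻¹ * c + (1 - N) / N := ⟨_, rfl⟩
  obtain ⟨y₀, hy₀⟩ : ∃ y₀ : Chain k, y₀ =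
    homChain .del .del .one (2 * N - 2 - m) (fun _ b _ => -((N : k) ^ 2)⁻¹ * b) +
      homChain .one .one .one (N - m) fun _ b c =>
        (N : k)⁻¹ * (c * (c - 1) - m * c) + (1 - N) / N * (b - c) := ⟨_, rfl⟩
  have h1 := dX_primitive_one (k := k) N m hN (by omega)
  have h0 := dX_primitive_zero (k := k) N m hN (by omega) y₁ hy₁
  rw [← hy₁] at h1
  rw [← hy₀] at h0
  obtain ⟨ξ, hξ⟩ : ∃ ξ : EqChain k, ξ =
    (PS.monomial 1 (-(m / N : k) • ((N : k) ^ 2)⁻¹ • blockSum k .del .del .del (3 * N - 3 - m)),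
      PS.monomial 0 ((m / N : k) • (N : k)⁻¹ • blockSum k .del .one .del (2 * N - 2 - m) -
        (τX k (sX k y₀) - sX k y₀))) := ⟨_, rfl⟩
  have key := eqCap_Rtilde_eq N m hN4 hm y₀ y₁ ξ h1 h0 hξ
  have hξd : eqDiff k N ξ = 0 :=
    (prod_isTAdic (M := Chain k)).map_eq_zero (eqDiff_comp_eqDiff N) key
      ((descends_eqCap N).1 _ (eqDiff_Rtilde N hN _ (by omega)))
      (map_smul_smul_eq_zero _ _ _ _ (by
        -- For m = 0 the chain R_{N-1} is not a cycle, but its coefficient m/N vanishes.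
        rcases Nat.eq_zero_or_pos m with rfl | h
        · exact Or.inl (by simp)
        · exact Or.inr (eqDiff_Rtilde N hN _ (by omega))))
  -- Here δ is the drop of the grade under the differential, and α is chosen so that the
  -- θ-coefficient of ξ has grade α + δ and its t-coefficient α + 2δ.
  obtain ⟨α, hα⟩ : ∃ α : ℤ × ZMod 2, α = ((N : ℤ) - 2 * m, 1) := ⟨_, rfl⟩
  obtain ⟨δ, hδ⟩ : ∃ δ : ℤ × ZMod 2, δ = ((N : ℤ), 1) := ⟨_, rfl⟩
  have hmem : ∀ (x y z : Gen) (q p : ℕ) (F : ℕ → ℕ → ℕ → k)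
      (_ : (x.grade N).1 + (y.grade N).1 + (z.grade N).1 + 2 * (q : ℤ) = N - 2 * m + p * N)
      (_ : (x.grade N).2 + (y.grade N).2 + (z.grade N).2 = 1 + p),
      homChain x y z q F ∈ gradePart k N (α + p • δ) := by
    intro x y z q p F h h'
    have : α + p • δ = x.grade N + y.grade N + z.grade N + (2 * (q : ℤ), 0) := by
      rw [hα, hδ]
      refine Prod.ext ?_ ?_
      · simpa using h.symm
      · simpa using h'.symm
    rw [this]
    exact homChain_mem_gradePart N x y z q F
  have hB : blockSum k .del .del .del (3 * N - 3 - m) ∈ gradePart k N (α + 2 • δ) :=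
    hmem _ _ _ _ _ (fun _ _ _ => 1) (by simp only [Gen.grade]; push_cast; omega) (by
      simp only [Gen.grade]; decide)
  have hB' : blockSum k .del .one .del (2 * N - 2 - m) ∈ gradePart k N (α + 1 • δ) :=
    hmem _ _ _ _ _ (fun _ _ _ => 1) (by simp [Gen.grade]; omega) (by
      simp [Gen.grade])
  have hy₀' : y₀ ∈ gradePart k N (α + 1 • δ) := by
    rw [hy₀]
    exact Submodule.add_mem _
      (hmem _ _ _ _ _ _ (by simp [Gen.grade]; omega) (by simp [Gen.grade]))
      (hmem _ _ _ _ _ _ (by simp [Gen.grade]; omega) (by simp only [Gen.grade]; decide))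
  obtain ⟨z, hz⟩ := mem_range_fixDiff (M := Chain k) (dX_mul_τX N) (dX_mul_sX N)
    (eqDiff_comp_eqDiff N) (fun p => gradePart k N (α + p • δ))
    (fun p u hu => τX_mem_gradePart hu) (fun p u hu => sX_mem_gradePart hu)
    (fun p hp u hu hdu => by
      have := exists_eq_dX_of_mem_gradePart N hN _ (by
        intro j
        rw [hα, hδ]
        exact ne_grade N m p (by omega) hp j) u hu hdu
      rwa [add_assoc, ← hδ, ← succ_nsmul] at this)
    ξ hξd (by rw [hξ]; rfl) (by
      intro l
      rw [hξ]
      simp only [PS.monomial_apply]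
      split_ifs with h
      · subst h
        exact Submodule.smul_mem _ _ (Submodule.smul_mem _ _ hB)
      · exact Submodule.zero_mem _) (by
      intro l
      rw [hξ]
      simp only [PS.monomial_apply]
      split_ifs with h
      · subst h
        refine Submodule.sub_mem _ (Submodule.smul_mem _ _ (Submodule.smul_mem _ _ hB'))
          (Submodule.sub_mem _ (τX_mem_gradePart (sX_mem_gradePart hy₀')) (sX_mem_gradePart hy₀'))
      · exact Submodule.zero_mem _)
  refine ⟨(PS.monomial 1 y₀, PS.monomial 0 y₁) + (PowerSeries.X : PowerSeries k) • z, ?_⟩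
  rw [key, hz]
  exact add_map_add_smul_map (eqDiff k N) _ _ _ _

end Cap


/-! ### Passage from chain-level identities to the matrix. -/

section Matrix

variable {k : Type*} [Field k]

/-- If `f (c_j)` is homologous to a linear combination of cycles, then so is the induced map. -/
theorem homologyMap_eq_sum {R E : Type*} [CommRing R] [AddCommGroup E] [Module R E]
    {d f : E →ₗ[R] E} (hf : Descends d f) {ι : Type*} [Fintype ι] (c : ι → E)
    (hc : ∀ i, d (c i) = 0) (j : ι) (a : ι → R) (h : ∃ z, f (c j) = ∑ i, a i • c i + d z) :
    homologyMap d f hf (homologyClass d (c j) (hc j)) =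
      ∑ i, a i • homologyClass d (c i) (hc i) := by
  have h0 : d (∑ i, a i • c i) = 0 := by simp [hc]
  rw [sum_smul_homologyClass c hc a h0, homologyMap_mk, homologyClass_eq_iff]
  exact h

variable {E : Type*} [AddCommGroup E] [Module (PowerSeries k) E]

theorem sum_capMatrix_of_three_le (N : ℕ) (c : ℕ → E) (j : Fin (N - 1)) (hj : 3 ≤ (j : ℕ)) :
    ∑ i, capMatrix k N i j • c i = c (j - 3) := by
  rw [Finset.sum_eq_single ⟨j - 3, by omega⟩]
  · rw [capMatrix, Matrix.of_apply, if_pos (by simp only; omega), one_smul]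
  · intro i _ hi
    rw [capMatrix, Matrix.of_apply, if_neg, if_neg (by omega), if_neg (by omega), zero_smul]
    intro h
    apply hi
    ext
    simp only
    omega
  · simp

/-- Unifies the columns 0, 1, 2 as m = 2, 1, 0. The entry -t/N is (2/N)t in characteristic 3. -/
theorem sum_capMatrix_of_lt [CharP k 3] (N : ℕ) (hN : 4 ≤ N) (c : ℕ → E) (j : Fin (N - 1)) (m : ℕ)
    (hj : (j : ℕ) + m = 2) : ∑ i, capMatrix k N i j • c i =
      PowerSeries.C (m / N : k) • (PowerSeries.X : PowerSeries k) • c (N - 1 - m) := by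
  have h2 : (2 : k) = -1 := by
    have h3 : (3 : k) = 0 := CharP.cast_eq_zero k 3
    linear_combination h3
  rw [smul_smul]
  rcases Nat.eq_zero_or_pos m with rfl | hm
  · rw [Finset.sum_eq_zero]
    · simp
    · intro i _
      rw [capMatrix, Matrix.of_apply, if_neg (by omega), if_neg (by omega), if_neg (by omega),
        zero_smul]
  · rw [Finset.sum_eq_single ⟨N - 1 - m, by omega⟩]
    · rw [capMatrix, Matrix.of_apply, if_neg (by omega)]
      obtain rfl | rfl : m = 1 ∨ m = 2 := by omega
      · rw [if_neg (by omega), if_pos (by simp only; omega)]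
        simp
      · rw [if_pos (by simp only; omega)]
        simp [h2, neg_div]
    · intro i _ hi
      have : (i : ℕ) ≠ N - 1 - m := fun h => hi (Fin.ext h)
      rw [capMatrix, Matrix.of_apply, if_neg (by omega), if_neg (by omega), if_neg (by omega),
        zero_smul]
    · simp

theorem sum_capMatrix_two (c : ℕ → E) (j : Fin (2 - 1)) :
    ∑ i, capMatrix k 2 i j • c i = 0 := by
  refine Finset.sum_eq_zero fun i _ => ?_
  rw [capMatrix, Matrix.of_apply, if_neg (by omega), if_neg (by omega), if_neg (by omega),
    zero_smul]

theorem exists_eqCap_eq_sum [CharP k 3] (N : ℕ) (hN2 : 2 ≤ N) (h3 : ¬ 3 ∣ N) (hN : (N : k) ≠ 0)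
    (j : Fin (N - 1)) : ∃ z, eqCap k N (phiOne k 1) (Rtilde k N j) =
      ∑ i, capMatrix k N i j • Rtilde k N i + eqDiff k N z := by
  by_cases hj : 3 ≤ (j : ℕ)
  · refine ⟨0, ?_⟩
    rw [sum_capMatrix_of_three_le (k := k) (E := EqChain k) N (fun i => Rtilde k N i) j hj, map_zero, add_zero,
      ← eqCap_Rtilde_add_three N (j - 3), Nat.sub_add_cancel hj]
  by_cases hN4 : 4 ≤ N
  · rw [sum_capMatrix_of_lt (k := k) (E := EqChain k) N hN4 (fun i => Rtilde k N i) j (2 - j) (by omega)]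
    obtain ⟨z, hz⟩ := exists_eqCap_Rtilde N (2 - j) hN hN4 (by omega)
    rw [show 2 - (2 - (j : ℕ)) = j by omega] at hz
    exact ⟨z, hz⟩
  -- As 3 does not divide N, only N = 2 remains. There the blocks of R_0 have total length at most
  -- 2, so the cap product vanishes on chains.
  · obtain rfl : N = 2 := by
      have : N ≠ 3 := fun h => h3 (h ▸ dvd_rfl)
      omega
    refine ⟨0, ?_⟩
    rw [sum_capMatrix_two (k := k) (E := EqChain k) (fun i => Rtilde k 2 i) j, map_zero, add_zero,
      show (j : ℕ) = 0 by omega, eqCap_Rtilde_two_zero]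

end Matrix

/-! ### The B-side: twisted de Rham cohomology. -/

section Forms

variable {k : Type*} [Field k]

theorem formsDiff_fst (N : ℕ) (y : Forms k) : (formsDiff k N y).1 = 0 := rfl

theorem derivative_X_pow (n : ℕ) : PowerSeries.derivative k ((PowerSeries.X : PowerSeries k) ^ n) =
    (n : PowerSeries k) * PowerSeries.X ^ (n - 1) := by
  rw [PowerSeries.derivative_pow, PowerSeries.derivative_X, mul_one]

theorem formsDiff_snd_zero (N : ℕ) (y : Forms k) :
    (formsDiff k N y).2 0 = -((N : PowerSeries k) * PowerSeries.X ^ (N - 1) * y.1 0) := by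
  change ((PowerSeries.X : PowerSeries k) • PS.map _ y.1 - PS.map _ y.1 : PS (PowerSeries k)) 0 = _
  rw [PS.sub_apply, PS.X_smul_zero, zero_sub, ← derivative_X_pow]
  rfl

theorem formsDiff_snd_succ (N : ℕ) (y : Forms k) (n : ℕ) :
    (formsDiff k N y).2 (n + 1) = PowerSeries.derivative k (y.1 n) -
      (N : PowerSeries k) * PowerSeries.X ^ (N - 1) * y.1 (n + 1) := by
  change ((PowerSeries.X : PowerSeries k) • PS.map _ y.1 - PS.map _ y.1 : PS (PowerSeries k)) _ = _
  rw [PS.sub_apply, PS.X_smul_succ, ← derivative_X_pow]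
  rfl

theorem formsDiff_comp_formsDiff (N : ℕ) : formsDiff k N ∘ₗ formsDiff k N = 0 := by
  refine LinearMap.ext fun y => Prod.ext rfl (PS.ext fun n => ?_)
  rw [LinearMap.comp_apply]
  refine Eq.trans ?_ (PS.zero_apply n).symm
  cases n
  · rw [formsDiff_snd_zero, formsDiff_fst, PS.zero_apply, mul_zero, neg_zero]
  · rw [formsDiff_snd_succ, formsDiff_fst, PS.zero_apply, PS.zero_apply, map_zero, mul_zero,
      sub_zero]

theorem formsMul_fst (a : PowerSeries k) (y : Forms k) (n : ℕ) :
    (formsMul k a y).1 n = a ^ 3 * y.1 n := rfl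

theorem formsMul_snd (a : PowerSeries k) (y : Forms k) (n : ℕ) :
    (formsMul k a y).2 n = a ^ 3 * y.2 n := rfl

/-- Multiplication by cubes commutes with the differential in characteristic `3`. -/
theorem formsMul_formsDiff [CharP k 3] (N : ℕ) (a : PowerSeries k) (y : Forms k) :
    formsMul k a (formsDiff k N y) = formsDiff k N (formsMul k a y) := by
  have h3 : (3 : PowerSeries k) = 0 := by
    have h3 : (3 : k) = 0 := CharP.cast_eq_zero k 3
    rw [← map_ofNat (PowerSeries.C (R := k)) 3, h3, map_zero]
  refine Prod.ext (PS.ext fun n => ?_) (PS.ext fun n => ?_)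
  · rw [formsMul_fst, formsDiff_fst, formsDiff_fst, PS.zero_apply, mul_zero]
  · cases n
    · rw [formsMul_snd, formsDiff_snd_zero, formsDiff_snd_zero, formsMul_fst]
      ring
    · rw [formsMul_snd, formsDiff_snd_succ, formsDiff_snd_succ, formsMul_fst, formsMul_fst,
        Derivation.leibniz, PowerSeries.derivative_pow, smul_eq_mul, smul_eq_mul, Nat.cast_ofNat, h3]
      ring

theorem descends_formsMul [CharP k 3] (N : ℕ) (a : PowerSeries k) :
    Descends (formsDiff k N) (formsMul k a) :=
  ⟨fun x hx => by rw [← formsMul_formsDiff, hx, map_zero],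
    fun x => ⟨_, (formsMul_formsDiff N a x).symm⟩⟩

theorem zdz_fst (m n : ℕ) : (zdz k m).1 n = 0 := rfl

theorem zdz_snd (m n : ℕ) : (zdz k m).2 n = if n = 0 then PowerSeries.X ^ m else 0 := rfl

theorem zdz_snd_zero (m : ℕ) : (zdz k m).2 0 = PowerSeries.X ^ m := rfl

theorem formsDiff_zdz (N m : ℕ) : formsDiff k N (zdz k m) = 0 := by
  refine Prod.ext rfl (PS.ext fun n => ?_)
  refine Eq.trans ?_ (PS.zero_apply n).symm
  cases n
  · rw [formsDiff_snd_zero, zdz_fst, mul_zero, neg_zero]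
  · rw [formsDiff_snd_succ, zdz_fst, zdz_fst, map_zero, mul_zero,
      sub_zero]

/-- Modulo t the differential is multiplication by -N z^(N-1), which is injective with cokernel
spanned by 1, z, …, z^(N-2). -/
theorem exists_basis_HForms (N : ℕ) (hN : (N : k) ≠ 0)
    (hz : ∀ j : Fin (N - 1), formsDiff k N (zdz k (N - 2 - j)) = 0) :
    ∃ b : Module.Basis (Fin (N - 1)) (PowerSeries k) (HForms k N), ∀ j, b j = zClass k N hz j := by
  have hpos : 1 ≤ N := Nat.one_le_iff_ne_zero.2 fun h => hN (by simp [h])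
  have hNC : (N : PowerSeries k) = PowerSeries.C (N : k) := by simp
  have hN' : (N : PowerSeries k) * PowerSeries.C (N : k)⁻¹ = 1 := by
    rw [hNC, ← map_mul, mul_inv_cancel₀ hN, map_one]
  have hNX : (N : PowerSeries k) * PowerSeries.X ^ (N - 1) ≠ 0 :=
    mul_ne_zero (left_ne_zero_of_mul_eq_one hN') (pow_ne_zero _ PowerSeries.X_ne_zero)
  have hcoeff : ∀ (a : Fin (N - 1) → k) (i : Fin (N - 1)),
      PowerSeries.coeff (N - 2 - i) (∑ j, a j • (PowerSeries.X : PowerSeries k) ^ (N - 2 - (j : ℕ))) =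
        a i := by
    intro a i
    rw [map_sum, Finset.sum_eq_single i]
    · simp
    · intro j _ hj
      rw [map_smul, PowerSeries.coeff_X_pow, if_neg, smul_zero]
      intro h
      apply hj
      ext
      omega
    · simp
  refine exists_homology_basis prod_isTAdic (formsDiff k N) (formsDiff_comp_formsDiff N)
    (fun j : Fin (N - 1) => zdz k (N - 2 - j)) hz ?_ ?_
  · intro y z hy
    have h0 : y.1 0 = 0 := by
      have := formsDiff_snd_zero N y
      rw [hy, prod_X_smul_snd_zero, eq_comm, neg_eq_zero] at this
      exact (mul_eq_zero.1 this).resolve_left hNX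
    obtain ⟨w, hw⟩ := PowerSeries.X_pow_dvd_iff.2 (show ∀ i < N - 1, PowerSeries.coeff i
        (y.2 0 - ∑ j : Fin (N - 1), PowerSeries.coeff (N - 2 - j) (y.2 0) •
          (PowerSeries.X : PowerSeries k) ^ (N - 2 - (j : ℕ))) = 0 by
      intro i hi
      have := hcoeff (fun j => PowerSeries.coeff (N - 2 - j) (y.2 0)) ⟨N - 2 - i, by omega⟩
      simp only [show N - 2 - (N - 2 - i) = i by omega] at this
      rw [map_sub, this, sub_self])
    obtain ⟨y', hy'⟩ := exists_eq_X_smul_prod (k := k)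
      (y - (∑ j : Fin (N - 1), PowerSeries.C (PowerSeries.coeff (N - 2 - j) (y.2 0)) •
        zdz k (N - 2 - j) + formsDiff k N (PS.monomial 0 (-(PowerSeries.C (N : k)⁻¹ * w)), 0))) (by
      rw [Prod.fst_sub, PS.sub_apply, Prod.fst_add, PS.add_apply, sum_C_smul_fst_zero,
        formsDiff_fst, h0, Finset.sum_eq_zero]
      · rw [PS.zero_apply, add_zero, sub_zero]
      · intro j _
        exact smul_zero _) (by
      rw [Prod.snd_sub, PS.sub_apply, Prod.snd_add, PS.add_apply, sum_C_smul_snd_zero,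
        formsDiff_snd_zero]
      simp only [zdz_snd_zero, PS.monomial_apply, if_true]
      linear_combination hw - (PowerSeries.X ^ (N - 1) * w) * hN')
    exact ⟨_, _, y', eq_add_of_sub_eq' hy'⟩
  · intro a w y' h i
    have h1 := congrArg (fun x : Forms k => x.2 0) h
    rw [Prod.snd_add, PS.add_apply, sum_C_smul_snd_zero, formsDiff_snd_zero,
      prod_X_smul_snd_zero] at h1
    simp only [zdz_snd_zero] at h1
    rw [← hcoeff a i, h1, add_zero, map_neg, mul_right_comm, PowerSeries.coeff_mul_X_pow',
      if_neg (by omega), neg_zero]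

theorem formsMul_zdz (m : ℕ) : formsMul k PowerSeries.X (zdz k m) = zdz k (m + 3) := by
  refine Prod.ext (PS.ext fun n => ?_) (PS.ext fun n => ?_)
  · rw [formsMul_fst, zdz_fst, zdz_fst, mul_zero]
  · rw [formsMul_snd, zdz_snd, zdz_snd, mul_ite, mul_zero, pow_add, mul_comm]

/-- The differential of -z^m/N is z^(N-1+m) dz - (m/N) t z^(m-1) dz. For m = 0 the truncated
exponent m - 1 is harmless, since its coefficient is 0. -/
theorem exists_zdz_eq (N m : ℕ) (hN : (N : k) ≠ 0) : ∃ z, zdz k (N - 1 + m) =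
    PowerSeries.C (m / N : k) • (PowerSeries.X : PowerSeries k) • zdz k (m - 1) +
      formsDiff k N z := by
  have hNC : (N : PowerSeries k) = PowerSeries.C (N : k) := by simp
  have hN' : (N : PowerSeries k) * PowerSeries.C (N : k)⁻¹ = 1 := by
    rw [hNC, ← map_mul, mul_inv_cancel₀ hN, map_one]
  refine ⟨(PS.monomial 0 (-(N : k)⁻¹ • PowerSeries.X ^ m), 0), ?_⟩
  refine Prod.ext ?_ (PS.ext fun n => ?_)
  · rw [Prod.fst_add, formsDiff_fst, add_zero]
    change (0 : PS (PowerSeries k)) = _ • _ • (0 : PS (PowerSeries k))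
    rw [smul_zero, smul_zero]
  · rw [Prod.snd_add, PS.add_apply, show (PowerSeries.C (m / N : k) •
      (PowerSeries.X : PowerSeries k) • zdz k (m - 1)).2 n = (m / N : k) •
      ((PowerSeries.X : PowerSeries k) • zdz k (m - 1)).2 n from PS.C_smul_apply _ _ n]
    rcases n with _ | n
    · rw [prod_X_smul_snd_zero, formsDiff_snd_zero]
      simp only [zdz_snd, PS.monomial_apply, if_true, smul_zero, zero_add, PowerSeries.smul_eq_C_mul,
        map_neg]
      rw [pow_add]
      linear_combination (-PowerSeries.X ^ (N - 1) * PowerSeries.X ^ m) * hN'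
    · rw [prod_X_smul_snd_succ, formsDiff_snd_succ]
      simp only [zdz_snd, PS.monomial_apply, Nat.succ_ne_zero, if_false, mul_zero, sub_zero]
      rcases n with _ | n
      · simp only [if_true]
        rw [Derivation.map_smul, derivative_X_pow, ← nsmul_eq_mul, ← Nat.cast_smul_eq_nsmul k, smul_smul,
          ← add_smul, div_eq_mul_inv]
        rw [show (m * (N : k)⁻¹ + -(N : k)⁻¹ * m) = 0 by ring, zero_smul]
      · simp

theorem exists_formsMul_eq_sum [CharP k 3] (N : ℕ) (hN2 : 2 ≤ N) (h3 : ¬ 3 ∣ N) (hN : (N : k) ≠ 0)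
    (j : Fin (N - 1)) : ∃ z, formsMul k PowerSeries.X (zdz k (N - 2 - j)) =
      ∑ i : Fin (N - 1), capMatrix k N i j • zdz k (N - 2 - i) + formsDiff k N z := by
  rw [formsMul_zdz]
  by_cases hj : 3 ≤ (j : ℕ)
  · refine ⟨0, ?_⟩
    rw [sum_capMatrix_of_three_le (k := k) (E := Forms k) N (fun i => zdz k (N - 2 - i)) j hj, map_zero, add_zero]
    congr 1
    omega
  obtain ⟨z, hz⟩ := exists_zdz_eq N (2 - j) hN
  rw [show N - 2 - (j : ℕ) + 3 = N - 1 + (2 - j) by omega]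
  by_cases hN4 : 4 ≤ N
  · rw [sum_capMatrix_of_lt (k := k) (E := Forms k) N hN4 (fun i => zdz k (N - 2 - i)) j (2 - j) (by omega)]
    refine ⟨z, ?_⟩
    rw [hz]
    rcases Nat.eq_zero_or_pos (2 - (j : ℕ)) with h | h
    · rw [h]
      simp
    · rw [show N - 2 - (N - 1 - (2 - (j : ℕ))) = 2 - j - 1 by omega]
  · obtain rfl : N = 2 := by
      have : N ≠ 3 := fun h => h3 (h ▸ dvd_rfl)
      omega
    rw [sum_capMatrix_two (k := k) (E := Forms k) (fun i => zdz k (2 - 2 - i)) j]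
    obtain ⟨z', hz'⟩ := exists_zdz_eq 2 0 hN
    have hj0 : (j : ℕ) = 0 := by omega
    rw [hj0] at hz
    rw [Nat.cast_zero, zero_div, map_zero, zero_smul, zero_add] at hz'
    -- For N = 2 the form z³ dz is cohomologous to t z dz, and z dz is itself exact (the case m =
    -- 0); the two primitives are combined.
    refine ⟨PowerSeries.C ((2 - 0 : ℕ) / (2 : ℕ) : k) • (PowerSeries.X : PowerSeries k) • z' + z, ?_⟩
    rw [hj0, hz, map_add, map_smul, map_smul, ← hz', zero_add]

end Forms

end ZModThreeCap

/-- Let `k` be a field of characteristic `3` and let `N ≥ 2` with `3 ∤ N`. The equivariant complex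
is a complex, the cap product with `φ^1_1` and the action of `θ` descend to its homology, the
`₃R̃^j_∂`, `0 ≤ j ≤ N-2`, are cycles whose classes form a basis over `k[[t, θ]]`, the cap product is
`k[[t, θ]]`-linear and its matrix in this basis is `capMatrix`. The classes `[z^{N-2-j} dz]` form a
basis over `k[[t]]` of the cohomology of `(Ω^*[[t]], t d - d(z^N) ∧)`, multiplication by `z^3` has
the same matrix in it, and the two actions agree under `[z^{N-2-j} dz] ↔ ₃R̃^j_∂`. -/
theorem theorem6p2 (k : Type*) [Field k] [CharP k 3] (N : ℕ) (hN : 2 ≤ N) (h3 : ¬ 3 ∣ N) :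
    eqDiff k N ∘ₗ eqDiff k N = 0 ∧
    ∃ (hcap : Descends (eqDiff k N) (eqCap k N (phiOne k 1)))
      (hθ : Descends (eqDiff k N) (thetaAct k))
      (hR : ∀ j : Fin (N - 1), eqDiff k N (Rtilde k N j) = 0)
      (hmul : Descends (formsDiff k N) (formsMul k PowerSeries.X))
      (hz : ∀ j : Fin (N - 1), formsDiff k N (zdz k (N - 2 - j)) = 0),
      thetaHH k N hθ ∘ₗ thetaHH k N hθ = 0 ∧
      capHH k N hcap ∘ₗ thetaHH k N hθ = thetaHH k N hθ ∘ₗ capHH k N hcap ∧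
      (∃ b : Module.Basis (Fin (N - 1) ⊕ Fin (N - 1)) (PowerSeries k) (HHEq k N),
        ∀ j, b (Sum.inl j) = RClass k N hR j ∧
          b (Sum.inr j) = thetaHH k N hθ (RClass k N hR j)) ∧
      (∀ j, capHH k N hcap (RClass k N hR j) = ∑ i, capMatrix k N i j • RClass k N hR i) ∧
      (∃ b : Module.Basis (Fin (N - 1)) (PowerSeries k) (HForms k N),
        ∀ j, b j = zClass k N hz j) ∧
      (∀ j, mulHForms k N hmul (zClass k N hz j) =
        ∑ i, capMatrix k N i j • zClass k N hz i) ∧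
      (∃ Φ : HForms k N →ₗ[PowerSeries k] HHEq k N,
        (∀ j, Φ (zClass k N hz j) = RClass k N hR j) ∧
          Φ ∘ₗ mulHForms k N hmul = capHH k N hcap ∘ₗ Φ) := by
  have h3' : (N : k) ≠ 0 := fun h => h3 ((CharP.cast_eq_zero_iff k 3 N).1 h)
  have hR : ∀ j : Fin (N - 1), eqDiff k N (Rtilde k N j) = 0 := fun j =>
    eqDiff_Rtilde N h3' j j.2
  have hz : ∀ j : Fin (N - 1), formsDiff k N (zdz k (N - 2 - j)) = 0 := fun j =>
    formsDiff_zdz N _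
  have hcap := descends_eqCap (k := k) N
  have hθ := descends_thetaAct (k := k) N
  have hmul := descends_formsMul (k := k) N PowerSeries.X
  obtain ⟨b, hb⟩ := exists_basis_HForms N h3' hz
  have hcapR : ∀ j, capHH k N hcap (RClass k N hR j) =
      ∑ i, capMatrix k N i j • RClass k N hR i := fun j =>
    homologyMap_eq_sum hcap (fun j : Fin (N - 1) => Rtilde k N j) hR j _
      (exists_eqCap_eq_sum N hN h3 h3' j)
  have hmulz : ∀ j, mulHForms k N hmul (zClass k N hz j) =
      ∑ i, capMatrix k N i j • zClass k N hz i := fun j =>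
    homologyMap_eq_sum hmul (fun j : Fin (N - 1) => zdz k (N - 2 - j)) hz j _
      (exists_formsMul_eq_sum N hN h3 h3' j)
  have hΦ : ∀ j, b.constr (PowerSeries k) (RClass k N hR) (zClass k N hz j) = RClass k N hR j :=
    fun j => by rw [← hb, Module.Basis.constr_basis]
  refine ⟨eqDiff_comp_eqDiff N, hcap, hθ, hR, hmul, hz, thetaHH_comp_thetaHH N hθ,
    capHH_comp_thetaHH N hcap hθ, exists_basis_HHEq N h3' hθ hR, hcapR, ⟨b, hb⟩, hmulz,
    b.constr (PowerSeries k) (RClass k N hR), hΦ, b.ext fun j => ?_⟩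
  rw [LinearMap.comp_apply, LinearMap.comp_apply, hb, hΦ, hmulz, hcapR, map_sum]
  exact Finset.sum_congr rfl fun i _ => by rw [map_smul, hΦ]
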